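/- Computational model: a randomized word RAM with unit-cost instructions on words of $O(\log n)$ bits, whose only source of randomness is an instruction that tosses a fair coin; a program is fixed independently of the input size, and running times are worst-case (over inputs and coin tosses). Bits of the input and of the output are stored one per memory cell. Let $\omega\ge 2$ be any real number such that two $n\times n$ matrices over $\mathbb F_2$ can be multiplied in time $O(n^\omega)$ in this model (a matrix multiplication exponent), and put $t_\omega(n)=n^\omega$ if $\omega>2$ and $t_2(n)=n^2\log n$. **Graph states.** For a graph $G=(V,E)$ with $n=|V|$ vertices let $|G\rangle=\bigl(\prod_{\{u,v\}\in E}\mathrm{CZ}_{uv}\bigr)H^{\otimes n}|0^n\rangle$. In the graph state simulation problem the input is $G$ (as an adjacency matrix), a basis $P_v\in\{X,Y,Z\}$ for each $v\in V$, a subset $\mathcal P\subseteq V$ and a string $m\in\{0,1\}^{\mathcal P}$. Let $U_v$ be unitaries with $U_vP_vU_v^\dagger=Z$, let $|\varphi\rangle=\bigotimes_v U_v|G\rangle$ and $\mathcal S=V\setminus\mathcal P$. If $p_{\mathcal P}(m)=\sum_{x\in\{0,1\}^{\mathcal S}}|\langle x|_{\mathcal S}\langle m|_{\mathcal P}|\varphi\rangle|^2$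 is zero, the output must be an error flag; otherwise the output must be a string $x\in\{0,1\}^{\mathcal S}$ drawn exactly from the distribution $p_{\mathcal S}(x|m)=|\langle x|_{\mathcal S}\langle m|_{\mathcal P}|\varphi\rangle|^2/p_{\mathcal P}(m)$ (which does not depend on the choice of the $U_v$). There is an algorithm that solves this problem on all $n$-vertex graphs in time $O(t_\omega(n))$. **Stabilizer states.** The tableau of an $n$-qubit Clifford unitary $Q$ consists of a $2n\times 2n$ binary matrix $M=\begin{pmatrix}A&B\\C&D\end{pmatrix}$, a phase vector $\begin{pmatrix}\alpha\\\delta\end{pmatrix}$ and a sign vector $\begin{pmatrix}\beta\\\epsilon\end{pmatrix}$ such that $QX_jQ^\dagger=i^{\alpha_j}(-1)^{\beta_j}X^{A_j}Z^{B_j}$ and $QZ_jQ^\dagger=i^{\delta_j}(-1)^{\epsilon_j}X^{C_j}Z^{D_j}$ for all $j$, where $A_j,B_j,C_j,D_j$ denote rows; it represents the stabilizer state $|\psi\rangle=Q|0^n\rangle$. There is an algorithm that, given a tableau representing an $n$-qubit stabilizer state $|\psi\rangle$, a subset $\mathcal P$ of the qubits and a string $z\in\{0,1\}^{\mathcal P}$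 of postselected outcomes, runs in time $O(t_\omega(n))$, outputs an error flag if $(\langle z|_{\mathcal P}\otimes I)|\psi\rangle=0$, and otherwise outputs a string drawn exactly from the distribution of the outcomes of a computational-basis measurement of the normalized state $(\langle z|_{\mathcal P}\otimes I)|\psi\rangle$. This distribution is uniform on the set of outcomes that have nonzero probability. -/

import Mathlib

open Filter Asymptotics

/-! ## The machine model: a randomized word RAM -/

namespace WordRAM

/-- The binary word operations; each costs one step. Subtraction is truncated at zero,
comparisons return `1` or `0`. -/
inductive BinOp
  | add | sub | mul | div | mod | land | lor | xor | eq | lt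

/-- The value of a word operation. -/
def BinOp.eval : BinOp → ℕ → ℕ → ℕ
  | .add, x, y => x + y
  | .sub, x, y => x - y
  | .mul, x, y => x * y
  | .div, x, y => x / y
  | .mod, x, y => x % y
  | .land, x, y => x &&& y
  | .lor, x, y => x ||| y
  | .xor, x, y => x ^^^ y
  | .eq, x, y => if x = y then 1 else 0
  | .lt, x, y => if x < y then 1 else 0

/-- Programs. A program is a finite object and mentions only finitely many registers.
* `const d k`: register `d` becomes the literal `k`;
* `op o d a b`: register `d` becomes `o` applied to registers `a` and `b`;
* `load d a`: register `d` becomes the content of the memory cell whose address is in register `a`;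
* `store a b`: the memory cell whose address is in register `a` becomes the content of register `b`;
* `coin d`: register `d` becomes a fresh fair random bit;
* `ite a c₁ c₂` and `while a c` test whether register `a` is nonzero. -/
inductive Cmd
  | skip
  | const (d k : ℕ)
  | op (o : BinOp) (d a b : ℕ)
  | load (d a : ℕ)
  | store (a b : ℕ)
  | coin (d : ℕ)
  | seq (c₁ c₂ : Cmd)
  | ite (a : ℕ) (c₁ c₂ : Cmd)
  | while (a : ℕ) (c : Cmd)

/-- A configuration: registers, random access memory, and the number of coins used so far. -/
structure State where
  reg : ℕ → ℕ
  mem : ℕ → ℕ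
  pos : ℕ

/-- Write a register. -/
def State.setReg (s : State) (d x : ℕ) : State := { s with reg := Function.update s.reg d x }

/-- Write a memory cell. -/
def State.setMem (s : State) (a x : ℕ) : State := { s with mem := Function.update s.mem a x }

/-- The initial configuration: the input occupies the memory cells `0, 1, 2, …`, and every other
cell and every register is zero. -/
def init (input : List ℕ) : State := ⟨fun _ => 0, fun i => input.getD i 0, 0⟩

/-- `Runs W coins c s t s'`: with the sequence of coin tosses `coins`, the program `c` started in
the configuration `s` halts after exactly `t` steps in the configuration `s'`, and no instruction
produces a value that is not smaller than `W` (a machine word holds `log₂ W` bits; a program that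
overflows a word gets stuck). Every instruction and every test costs one step. -/
inductive Runs (W : ℕ) (coins : ℕ → Bool) : Cmd → State → ℕ → State → Prop
  | skip (s : State) : Runs W coins .skip s 1 s
  | const (s : State) (d k : ℕ) (h : k < W) : Runs W coins (.const d k) s 1 (s.setReg d k)
  | op (s : State) (o : BinOp) (d a b : ℕ) (h : o.eval (s.reg a) (s.reg b) < W) :
      Runs W coins (.op o d a b) s 1 (s.setReg d (o.eval (s.reg a) (s.reg b)))
  | load (s : State) (d a : ℕ) : Runs W coins (.load d a) s 1 (s.setReg d (s.mem (s.reg a)))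
  | store (s : State) (a b : ℕ) : Runs W coins (.store a b) s 1 (s.setMem (s.reg a) (s.reg b))
  | coin (s : State) (d : ℕ) :
      Runs W coins (.coin d) s 1
        { s.setReg d (if coins s.pos then 1 else 0) with pos := s.pos + 1 }
  | seq {c₁ c₂ : Cmd} {s₁ s₂ s₃ : State} {t₁ t₂ : ℕ} (h₁ : Runs W coins c₁ s₁ t₁ s₂)
      (h₂ : Runs W coins c₂ s₂ t₂ s₃) : Runs W coins (.seq c₁ c₂) s₁ (t₁ + t₂) s₃
  | ite_true {a : ℕ} {c₁ c₂ : Cmd} {s s' : State} {t : ℕ} (ha : s.reg a ≠ 0)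
      (h : Runs W coins c₁ s t s') : Runs W coins (.ite a c₁ c₂) s (t + 1) s'
  | ite_false {a : ℕ} {c₁ c₂ : Cmd} {s s' : State} {t : ℕ} (ha : s.reg a = 0)
      (h : Runs W coins c₂ s t s') : Runs W coins (.ite a c₁ c₂) s (t + 1) s'
  | while_done {a : ℕ} {c : Cmd} {s : State} (ha : s.reg a = 0) : Runs W coins (.while a c) s 1 s
  | while_step {a : ℕ} {c : Cmd} {s₁ s₂ s₃ : State} {t₁ t₂ : ℕ} (ha : s₁.reg a ≠ 0)
      (h₁ : Runs W coins c s₁ t₁ s₂) (h₂ : Runs W coins (.while a c) s₂ t₂ s₃) :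
      Runs W coins (.while a c) s₁ (t₁ + t₂ + 1) s₃

/-- The model is deterministic once the coins are fixed. -/
theorem Runs.unique {W : ℕ} {coins : ℕ → Bool} {c : Cmd} {s s₁ s₂ : State} {t₁ t₂ : ℕ}
    (h₁ : Runs W coins c s t₁ s₁) (h₂ : Runs W coins c s t₂ s₂) : t₁ = t₂ ∧ s₁ = s₂ := by
  induction h₁ generalizing t₂ s₂ with
  | seq _ _ ih₁ ih₂ =>
    cases h₂ with
    | seq g₁ g₂ =>
      obtain ⟨rfl, rfl⟩ := ih₁ g₁
      obtain ⟨rfl, rfl⟩ := ih₂ g₂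
      exact ⟨rfl, rfl⟩
  | ite_true ha _ ih =>
    cases h₂ with
    | ite_true _ g => obtain ⟨rfl, rfl⟩ := ih g; exact ⟨rfl, rfl⟩
    | ite_false hb _ => exact absurd hb ha
  | ite_false ha _ ih =>
    cases h₂ with
    | ite_true hb _ => exact absurd ha hb
    | ite_false _ g => obtain ⟨rfl, rfl⟩ := ih g; exact ⟨rfl, rfl⟩
  | while_done ha =>
    cases h₂ with
    | while_done _ => exact ⟨rfl, rfl⟩
    | while_step hb _ _ => exact absurd ha hb
  | while_step ha _ _ ih₁ ih₂ =>
    cases h₂ with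
    | while_done hb => exact absurd hb ha
    | while_step _ g₁ g₂ =>
      obtain ⟨rfl, rfl⟩ := ih₁ g₁
      obtain ⟨rfl, rfl⟩ := ih₂ g₂
      exact ⟨rfl, rfl⟩
  | _ => cases h₂; exact ⟨rfl, rfl⟩

/-- The word bound for inputs of size parameter `n`: values below `(n + 2) ^ κ`, that is, words of
`κ log₂ (n + 2) = O(log n)` bits. -/
def wordBound (κ n : ℕ) : ℕ := (n + 2) ^ κ

/-- Extend finitely many coin tosses to a sequence. (A computation of at most `T` steps tosses at
most `T` coins, so the extension is never read.) -/
def tape {T : ℕ} (r : Fin T → Bool) (i : ℕ) : Bool := if h : i < T then r ⟨i, h⟩ else false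

/-- The words `0`, `1` of a bit vector. -/
def bits {n : ℕ} (v : Fin n → ZMod 2) : List ℕ := List.ofFn fun i => (v i).val

/-- The entries of a bit matrix, row by row. -/
def matBits {k n : ℕ} (A : Matrix (Fin k) (Fin n) (ZMod 2)) : List ℕ :=
  (List.ofFn fun i => bits (A i)).flatten

/-- Two `n × n` matrices over `𝔽₂` can be multiplied in time `O(n ^ ω)`, with one matrix entry per
memory cell for the input and for the output. -/
def MatMulInTime (ω : ℝ) : Prop :=
  ∃ (c : Cmd) (κ : ℕ) (T : ℕ → ℕ),
    (fun n => (T n : ℝ)) =O[atTop] (fun n : ℕ => (n : ℝ) ^ ω) ∧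
    ∀ (n : ℕ) (A B : Matrix (Fin n) (Fin n) (ZMod 2)) (coins : ℕ → Bool),
      ∃ t ≤ T n, ∃ s' : State,
        Runs (wordBound κ n) coins c (init (n :: (matBits A ++ matBits B))) t s' ∧
        ∀ i j : Fin n, s'.mem (i * n + j) = ((A * B) i j).val

end WordRAM

/-! ## Qubits -/

namespace Qubit

/-- An `n`-qubit vector, by its amplitudes in the computational basis. -/
abbrev Vec (n : ℕ) := (Fin n → ZMod 2) → ℂ

/-- An `n`-qubit operator, by its matrix in the computational basis. -/
abbrev Op (n : ℕ) := Matrix (Fin n → ZMod 2) (Fin n → ZMod 2) ℂ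

/-- A single-qubit operator. -/
abbrev Op1 := Matrix (ZMod 2) (ZMod 2) ℂ

/-- The computational basis vector `|y⟩`. -/
noncomputable def ket {n : ℕ} (y : Fin n → ZMod 2) : Vec n := Pi.single y 1

/-- The tensor product of single-qubit operators. -/
noncomputable def tensor {n : ℕ} (U : Fin n → Op1) : Op n := fun x y => ∏ v, U v (x v) (y v)

/-- The single-qubit operator `X^a Z^b`, which maps `|y⟩` to `(-1)^(b y) |y + a⟩`. -/
noncomputable def xz1 (a b : ZMod 2) : Op1 :=
  fun x y => if x = y + a then (-1 : ℂ) ^ (b * y).val else 0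

/-- The `n`-qubit operator `X^a Z^b`. -/
noncomputable def xz {n : ℕ} (a b : Fin n → ZMod 2) : Op n := tensor fun v => xz1 (a v) (b v)

/-- The Hadamard gate. -/
noncomputable def hadamard : Op1 := fun x y => (-1 : ℂ) ^ (x * y).val / (Real.sqrt 2 : ℂ)

/-- The three measurement bases. -/
inductive Basis
  | X | Y | Z

/-- The Pauli operators. -/
noncomputable def Basis.pauli : Basis → Op1
  | .X => xz1 1 0
  | .Y => Complex.I • xz1 1 1
  | .Z => xz1 0 1

/-- The code of a basis in the input of an algorithm. -/
def Basis.code : Basis → ℕ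
  | .X => 0
  | .Y => 1
  | .Z => 2

open Classical in
/-- The graph state: one controlled-`Z` gate for every edge, applied to `H ⊗ ⋯ ⊗ H |0⋯0⟩`. The gate
on the edge `{u, v}` is the diagonal operator with `|y⟩ ↦ (-1)^(y u * y v) |y⟩`. -/
noncomputable def graphState {n : ℕ} (G : SimpleGraph (Fin n)) : Vec n :=
  (Matrix.diagonal fun y => ∏ e : Fin n × Fin n with e.1 < e.2 ∧ G.Adj e.1 e.2,
      (-1 : ℂ) ^ (y e.1 * y e.2).val : Op n).mulVec
    ((tensor fun _ => hadamard : Op n).mulVec (ket 0))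

/-- The tableau of an `n`-qubit Clifford unitary: a `2n × 2n` binary matrix, a phase vector and a
sign vector. The rows `inl j` belong to the images of the operators `X_j` (destabilizers), the rows
`inr j` to the images of the `Z_j` (stabilizers); the columns `inl` hold `X`-exponents, the columns
`inr` hold `Z`-exponents. -/
structure Tableau (n : ℕ) where
  M : Matrix (Fin n ⊕ Fin n) (Fin n ⊕ Fin n) (ZMod 2)
  p : Fin n ⊕ Fin n → ZMod 2
  s : Fin n ⊕ Fin n → ZMod 2

/-- The Pauli operator `i^p (-1)^s X^a Z^b` described by a row of a tableau. -/
noncomputable def Tableau.rowOp {n : ℕ} (τ : Tableau n) (r : Fin n ⊕ Fin n) : Op n :=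
  (Complex.I ^ (τ.p r).val * (-1 : ℂ) ^ (τ.s r).val) •
    xz (fun v => τ.M r (.inl v)) (fun v => τ.M r (.inr v))

/-- `τ` is the tableau of the unitary `Q` (which is then a Clifford unitary): `Q X_j Q†` and
`Q Z_j Q†` are the Pauli operators in the rows of `τ`. -/
def Tableau.IsTableauOf {n : ℕ} (τ : Tableau n) (Q : Op n) : Prop :=
  Q ∈ Matrix.unitaryGroup (Fin n → ZMod 2) ℂ ∧
    ∀ j : Fin n, Q * xz (Pi.single j 1) 0 * Q.conjTranspose = τ.rowOp (.inl j) ∧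
      Q * xz 0 (Pi.single j 1) * Q.conjTranspose = τ.rowOp (.inr j)

/-- `τ` represents the stabilizer state `ψ`: it is the tableau of a Clifford unitary that maps
`|0⋯0⟩` to `ψ`. -/
def Tableau.Represents {n : ℕ} (τ : Tableau n) (ψ : Vec n) : Prop :=
  ∃ Q : Op n, τ.IsTableauOf Q ∧ ψ = Q.mulVec (ket 0)

/-- The `n`-bit string with the bits `m` on `P` and the bits `x` elsewhere. -/
def join {n : ℕ} {P : Finset (Fin n)} (m : {v // v ∈ P} → ZMod 2) (x : {v // v ∉ P} → ZMod 2) :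
    Fin n → ZMod 2 :=
  fun v => if h : v ∈ P then m ⟨v, h⟩ else x ⟨v, h⟩

/-- The probability of the outcomes `m` when the qubits in `P` are measured. -/
noncomputable def margProb {n : ℕ} (φ : Vec n) {P : Finset (Fin n)}
    (m : {v // v ∈ P} → ZMod 2) : ℝ :=
  ∑ x : {v // v ∉ P} → ZMod 2, ‖φ (join m x)‖ ^ 2

/-- The probability of the outcomes `x` on the qubits outside `P`, conditioned on the outcomes `m`
on `P` (meaningful if `margProb φ m ≠ 0`). -/
noncomputable def condProb {n : ℕ} (φ : Vec n) {P : Finset (Fin n)}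
    (m : {v // v ∈ P} → ZMod 2) (x : {v // v ∉ P} → ZMod 2) : ℝ :=
  ‖φ (join m x)‖ ^ 2 / margProb φ m

end Qubit

/-! ## The sampling problems -/

namespace StabSim

open WordRAM Qubit

/-- The words that describe the set `P` and the outcomes `m`: one word for every qubit, which is the
postselected outcome for the qubits in `P` and `2` for the others. -/
def postWords {n : ℕ} {P : Finset (Fin n)} (m : {v // v ∈ P} → ZMod 2) : List ℕ :=
  List.ofFn fun v => if h : v ∈ P then (m ⟨v, h⟩).val else 2

/-- Within `T` steps, for all coin tosses, the program `c` halts on the given input, and it samples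
the measurement of the qubits outside `P` after postselecting the outcomes `m` on `P`, in the state
`φ`. If the postselected event has probability zero, it leaves the error flag `0` in cell `0`.
Otherwise it leaves `1` in cell `0` and the outcome of every qubit `v ∉ P` in cell `v + 1`, where
the outcomes have exactly the conditional distribution when the coins are fair and independent. -/
def SamplesPostselected (c : Cmd) (W T : ℕ) (input : List ℕ) {n : ℕ} (φ : Vec n)
    (P : Finset (Fin n)) (m : {v // v ∈ P} → ZMod 2) : Prop :=
  ∃ out : (Fin T → Bool) → State,
    (∀ r, ∃ t ≤ T, Runs W (tape r) c (init input) t (out r)) ∧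
    (margProb φ m = 0 → ∀ r, (out r).mem 0 = 0) ∧
    (margProb φ m ≠ 0 → (∀ r, (out r).mem 0 = 1) ∧
      ∀ x : {v // v ∉ P} → ZMod 2,
        (Nat.card {r : Fin T → Bool // ∀ v, (out r).mem (v.1 + 1) = (x v).val} : ℝ) / 2 ^ T =
          condProb φ m x)

open Classical in
/-- The input of the graph state simulation problem: the number of vertices, the adjacency matrix,
the measurement bases, and the postselected outcomes. -/
noncomputable def graphInput {n : ℕ} (G : SimpleGraph (Fin n)) (B : Fin n → Basis)
    {P : Finset (Fin n)} (m : {v // v ∈ P} → ZMod 2) : List ℕ :=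
  n :: (matBits (G.adjMatrix (ZMod 2)) ++ (List.ofFn fun v => (B v).code) ++ postWords m)

/-- `U v` is a unitary that maps the basis `B v` to the computational basis. -/
def IsBasisChange {n : ℕ} (B : Fin n → Basis) (U : Fin n → Op1) : Prop :=
  ∀ v, U v ∈ Matrix.unitaryGroup (ZMod 2) ℂ ∧
    U v * (B v).pauli * (U v).conjTranspose = Basis.Z.pauli

/-- One algorithm solves the graph state simulation problem, with postselection, on all graphs with
`n` vertices, in time `O(b n)`. -/
def GraphStateSimulation (b : ℕ → ℝ) : Prop :=
  ∃ (c : Cmd) (κ : ℕ) (T : ℕ → ℕ), (fun n => (T n : ℝ)) =O[atTop] b ∧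
    ∀ (n : ℕ) (G : SimpleGraph (Fin n)) (B : Fin n → Basis) (P : Finset (Fin n))
      (m : {v // v ∈ P} → ZMod 2) (U : Fin n → Op1), IsBasisChange B U →
      SamplesPostselected c (wordBound κ n) (T n) (graphInput G B m)
        ((tensor U).mulVec (graphState G)) P m

/-- The `4n(n+1)` bits of a tableau: the matrix row by row, the phase vector, the sign vector. -/
def tableauBits {n : ℕ} (τ : Tableau n) : List ℕ :=
  matBits (τ.M.reindex finSumFinEquiv finSumFinEquiv) ++
    bits (fun i => τ.p (finSumFinEquiv.symm i)) ++ bits (fun i => τ.s (finSumFinEquiv.symm i))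

/-- One algorithm samples computational-basis measurements of postselected `n`-qubit stabilizer
states, given by a tableau, in time `O(b n)`. -/
def StabilizerSampling (b : ℕ → ℝ) : Prop :=
  ∃ (c : Cmd) (κ : ℕ) (T : ℕ → ℕ), (fun n => (T n : ℝ)) =O[atTop] b ∧
    ∀ (n : ℕ) (τ : Tableau n) (ψ : Vec n) (P : Finset (Fin n))
      (m : {v // v ∈ P} → ZMod 2), τ.Represents ψ →
      SamplesPostselected c (wordBound κ n) (T n) (n :: (tableauBits τ ++ postWords m)) ψ P m

/-- `n ^ ω`, with an extra factor `log n` if `ω = 2`. -/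
noncomputable def timeBound (ω : ℝ) (n : ℕ) : ℝ :=
  if ω = 2 then (n : ℝ) ^ 2 * Real.log n else (n : ℝ) ^ ω

end StabSim

/-! Support of a stabilizer state. Let `ψ ≠ 0` be fixed by `n` independent generators `i^p (-1)^s
X^C Z^D`. The product of the generators with exponents `l` translates the basis labels by `l C`. If
`l C = 0`, it is a diagonal operator `± Z^(l D)`, so `ψ y ≠ 0` forces `(l D) · y` to equal a sign
bit, which is a quadratic form in `l` (`eq_of_prod_fix`). If `C G C = C`, the rows of `1 + C G` span
the left kernel of `C`, and all these conditions together say that `D y + C z = offset` for some `z`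
(`Stabilizes.add_offset`). Conversely, the generators span a maximal isotropic subspace
(`Stabilizes.exists_vecMul`), so two solutions `y` differ by some `l C`, and translation by `l C`
preserves the modulus of the amplitude. Hence the support is an affine space
(`Stabilizes.support_iff`) on which the modulus is constant (`Stabilizes.norm_eq`). Postselection
fixes some coordinates of `y`; what remains is a linear system `A u = b` whose unknowns are the free
outcomes and `z` (`ne_zero_of_solution`, `exists_solution`).

Sampling. Let `A G' A = A`. The system is solvable iff `A G' b = b`, and then `u = G' (b + A ρ) + ρ`
is a solution for every vector `ρ` of coins. Adding a kernel vector of `A` to `ρ` adds the same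
vector to `u`, so any two outcomes in the support have equally many preimages among the coin
sequences. The sampled and the wanted distribution both vanish off the support, are constant on it
and have sum one, so they agree (`samplesPostselected_sampleC`).

Running time. Apart from a fixed number of matrix products, the algorithm needs two generalized
inverses. They are computed by halving the columns: an inverse `g` of the left half `a` and an
inverse `h` of the residue `(1 + a g) b` of the right half `b` give one of the whole
(`ginv_combine`, `ginv_step`, `Tri.tree`). Joining blocks of width `w` in a matrix of size `N` takes
`O(N / w)` products of `w × w` matrices. Put `r = 2^(ω - 2)`. The blocks of width `2^e` contribute
`O(N² r^e)` in all, so the sum over `e` is geometric if `ω > 2` and has `log N` equal terms if `ω =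
2` (`treeTime_le`, `isBigO_sampleTime`).

Machine level. Programs are written in a small language of variables and arrays. `Rep` relates its
stores to machine configurations, and `Tri` is total correctness with a time bound. The given
multiplication program runs as a subroutine on a virtual memory that is cleared in constant time by
time stamps (`runs_virtual`). Coins are tossed only after `G'` and `b` have been computed, so these
do not depend on the coins (`runs_sampleC`). -/

/-! ## A structured programming language on top of the word RAM -/

namespace WordRAM

/-- The variables of structured programs. -/
inductive Var
  | n | N | kk | lev | idx | ph | w | ra | rb | rc | t | ia | ic | ib | q | u | piv | r | flag
  deriving DecidableEq

/-- The arrays of structured programs. The array `io` is the part of the memory that holds the input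
and the output, the array `vm` is the virtual memory of a subroutine. -/
inductive Arr
  | io | vm | px | py | pz | acc | xa | g | cm | dm | am | pv | sv | post | rnd | uu | km | ku | wd
  | bm | gb | ym
  deriving DecidableEq

theorem Var.ctorIdx_inj {x y : Var} : x.ctorIdx = y.ctorIdx ↔ x = y :=
  ⟨fun h => by rw [← Var.ofNat_ctorIdx x, h, Var.ofNat_ctorIdx], fun h => h ▸ rfl⟩

theorem Arr.ctorIdx_inj {x y : Arr} : x.ctorIdx = y.ctorIdx ↔ x = y :=
  ⟨fun h => by rw [← Arr.ofNat_ctorIdx x, h, Arr.ofNat_ctorIdx], fun h => h ▸ rfl⟩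

theorem Arr.ctorIdx_lt (α : Arr) : α.ctorIdx < 32 := by cases α <;> decide

/-- The array `io` lies at the bottom of the memory, so the codes 0 and 1 of `io` and `vm` are free.
They serve for the values and the time stamps of the virtual memory, and every other array has to
stay away from them. -/
theorem Arr.two_le_ctorIdx {α : Arr} (h₁ : α ≠ .io) (h₂ : α ≠ .vm) : 2 ≤ α.ctorIdx := by
  cases α <;> first | contradiction | decide

/-- The values of variables and arrays, and the number of coins used so far. -/
structure Store where
  v : Var → ℕ
  a : Arr → ℕ → ℕ
  pos : ℕ

namespace Store

/-- Assign a variable. -/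
def setV (σ : Store) (x : Var) (k : ℕ) : Store := { σ with v := Function.update σ.v x k }

/-- Replace an array. -/
def setA (σ : Store) (α : Arr) (f : ℕ → ℕ) : Store := { σ with a := Function.update σ.a α f }

/-- Toss a coin. -/
def toss (σ : Store) (x : Var) (b : Bool) : Store :=
  { σ.setV x (if b then 1 else 0) with pos := σ.pos + 1 }

@[simp] theorem setV_v (σ : Store) (x y : Var) (k : ℕ) :
    (σ.setV x k).v y = if y = x then k else σ.v y := by
  simp [setV, Function.update_apply]
@[simp] theorem setV_a (σ : Store) (x : Var) (k : ℕ) : (σ.setV x k).a = σ.a := rfl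
@[simp] theorem setV_pos (σ : Store) (x : Var) (k : ℕ) : (σ.setV x k).pos = σ.pos := rfl
@[simp] theorem setA_a (σ : Store) (α β : Arr) (f : ℕ → ℕ) :
    (σ.setA α f).a β = if β = α then f else σ.a β := by
  simp [setA, Function.update_apply]
@[simp] theorem setA_v (σ : Store) (α : Arr) (f : ℕ → ℕ) : (σ.setA α f).v = σ.v := rfl
@[simp] theorem setA_pos (σ : Store) (α : Arr) (f : ℕ → ℕ) : (σ.setA α f).pos = σ.pos := rfl

end Store

/-- Expressions over variables and arrays. -/
inductive Expr
  | var (x : Var)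
  | lit (k : ℕ)
  | bin (o : BinOp) (e₁ e₂ : Expr)
  | rd (α : Arr) (e : Expr)

namespace Expr

instance : Coe Var Expr := ⟨.var⟩
instance (k : ℕ) : OfNat Expr k := ⟨.lit k⟩
instance : Add Expr := ⟨.bin .add⟩
instance : Sub Expr := ⟨.bin .sub⟩
instance : Mul Expr := ⟨.bin .mul⟩
instance : Div Expr := ⟨.bin .div⟩
instance : Mod Expr := ⟨.bin .mod⟩

/-- The comparison `e₁ < e₂`. -/
def lt (e₁ e₂ : Expr) : Expr := .bin .lt e₁ e₂
/-- The comparison `e₁ = e₂`. -/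
def eq (e₁ e₂ : Expr) : Expr := .bin .eq e₁ e₂

/-- The value of an expression. -/
def eval (σ : Store) : Expr → ℕ
  | var x => σ.v x
  | lit k => k
  | bin o e₁ e₂ => o.eval (e₁.eval σ) (e₂.eval σ)
  | rd α e => σ.a α (e.eval σ)

/-- A measure of the size of an expression, which bounds its values and its evaluation time. -/
def deg : Expr → ℕ
  | var _ => 1
  | lit k => k + 1
  | bin _ e₁ e₂ => e₁.deg + e₂.deg + 1
  | rd _ e => e.deg + 3

variable (σ : Store) (e e₁ e₂ : Expr) (x : Var) (k : ℕ) (α : Arr)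

@[simp] theorem eval_var : (Expr.var x).eval σ = σ.v x := rfl
@[simp] theorem eval_ofNat : (ofNat(k) : Expr).eval σ = k := rfl
@[simp] theorem eval_lit : (Expr.lit k).eval σ = k := rfl
@[simp] theorem eval_add : (e₁ + e₂).eval σ = e₁.eval σ + e₂.eval σ := rfl
@[simp] theorem eval_sub : (e₁ - e₂).eval σ = e₁.eval σ - e₂.eval σ := rfl
@[simp] theorem eval_mul : (e₁ * e₂).eval σ = e₁.eval σ * e₂.eval σ := rfl
@[simp] theorem eval_div : (e₁ / e₂).eval σ = e₁.eval σ / e₂.eval σ := rfl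
@[simp] theorem eval_mod : (e₁ % e₂).eval σ = e₁.eval σ % e₂.eval σ := rfl
@[simp] theorem eval_lt : (e₁.lt e₂).eval σ = if e₁.eval σ < e₂.eval σ then 1 else 0 := rfl
@[simp] theorem eval_eq : (e₁.eq e₂).eval σ = if e₁.eval σ = e₂.eval σ then 1 else 0 := rfl
@[simp] theorem eval_rd : (rd α e).eval σ = σ.a α (e.eval σ) := rfl

@[simp] theorem deg_var : (Expr.var x).deg = 1 := rfl
@[simp] theorem deg_ofNat : (ofNat(k) : Expr).deg = k + 1 := rfl
@[simp] theorem deg_add : (e₁ + e₂).deg = e₁.deg + e₂.deg + 1 := rfl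
@[simp] theorem deg_sub : (e₁ - e₂).deg = e₁.deg + e₂.deg + 1 := rfl
@[simp] theorem deg_mul : (e₁ * e₂).deg = e₁.deg + e₂.deg + 1 := rfl
@[simp] theorem deg_div : (e₁ / e₂).deg = e₁.deg + e₂.deg + 1 := rfl
@[simp] theorem deg_mod : (e₁ % e₂).deg = e₁.deg + e₂.deg + 1 := rfl
@[simp] theorem deg_lt : (e₁.lt e₂).deg = e₁.deg + e₂.deg + 1 := rfl
@[simp] theorem deg_eq : (e₁.eq e₂).deg = e₁.deg + e₂.deg + 1 := rfl
@[simp] theorem deg_rd : (rd α e).deg = e.deg + 3 := rfl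

end Expr

/-- One bound for all operations. Bitwise or and exclusive or can exceed both operands, but stay
below the next power of two, which is at most twice the larger operand plus two. -/
theorem BinOp.eval_le (o : BinOp) (x y : ℕ) : o.eval x y ≤ 2 * ((x + 1) * (y + 1)) := by
  have hm : max x y + 1 ≤ (x + 1) * (y + 1) := by
    rcases max_cases x y with ⟨h, _⟩ | ⟨h, _⟩ <;> rw [h] <;> nlinarith [Nat.zero_le (x * y)]
  have hp : 2 ^ ((max x y).log2 + 1) ≤ 2 * (max x y + 1) := by
    by_cases h0 : max x y = 0
    · simp [h0]
    · have := Nat.log2_self_le h0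
      rw [pow_succ]; omega
  have hx : x < 2 ^ ((max x y).log2 + 1) := (le_max_left _ _).trans_lt Nat.lt_log2_self
  have hy : y < 2 ^ ((max x y).log2 + 1) := (le_max_right _ _).trans_lt Nat.lt_log2_self
  have h1 : x ≤ (x + 1) * (y + 1) := by nlinarith [Nat.zero_le (x * y)]
  cases o <;> simp only [BinOp.eval]
  · nlinarith [Nat.zero_le (x * y)]
  · omega
  · nlinarith [Nat.zero_le (x * y)]
  · have := Nat.div_le_self x y; omega
  · have := Nat.mod_le x y; omega
  · have := Nat.and_le_left (n := x) (m := y); omega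
  · have := Nat.or_lt_two_pow hx hy; omega
  · have := Nat.xor_lt_two_pow hx hy; omega
  · split_ifs <;> nlinarith [Nat.zero_le (x * y)]
  · split_ifs <;> nlinarith [Nat.zero_le (x * y)]

/-- The parameters of an execution: a bound `B` for the values of variables and array entries, the
size `L` of the input and output region, the word bound `W`, and the coin tosses. -/
structure Env where
  B : ℕ
  L : ℕ
  W : ℕ
  coins : ℕ → Bool
  hB : 32 ≤ B
  hL : L ≤ B
  -- Expressions are used up to degree 90, so all intermediate values are at most `B ^ 90`. The
  -- remaining powers leave room for the addresses of array entries.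
  hW : B ^ 100 < W

/-- Each operation costs one extra power of `B`, which absorbs the factor 8 coming from
`BinOp.eval_le`. Array reads are bounded by `B` whatever the index is. -/
theorem Expr.eval_le {B : ℕ} (hB : 32 ≤ B) {σ : Store} (hv : ∀ x, σ.v x ≤ B)
    (ha : ∀ α i, σ.a α i ≤ B) (e : Expr) : e.eval σ ≤ B ^ e.deg := by
  induction e with
  | var x => simpa [Expr.deg] using hv x
  | lit k =>
    have : k < 2 ^ k := Nat.lt_two_pow_self
    calc k ≤ 2 ^ k := this.le
      _ ≤ B ^ k := Nat.pow_le_pow_left (by omega) k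
      _ ≤ B ^ (k + 1) := Nat.pow_le_pow_right (by omega) (by omega)
  | bin o e₁ e₂ h₁ h₂ =>
    have p₁ : 1 ≤ B ^ e₁.deg := Nat.one_le_pow _ _ (by omega)
    have p₂ : 1 ≤ B ^ e₂.deg := Nat.one_le_pow _ _ (by omega)
    calc o.eval (e₁.eval σ) (e₂.eval σ)
        ≤ 2 * ((e₁.eval σ + 1) * (e₂.eval σ + 1)) := o.eval_le _ _
      _ ≤ 2 * ((2 * B ^ e₁.deg) * (2 * B ^ e₂.deg)) := by gcongr <;> omega
      _ = 8 * (B ^ e₁.deg * B ^ e₂.deg) := by ring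
      _ ≤ B * (B ^ e₁.deg * B ^ e₂.deg) := by gcongr; omega
      _ = B ^ (e₁.deg + e₂.deg + 1) := by ring
  | rd α e _ =>
    calc σ.a α (e.eval σ) ≤ B := ha _ _
      _ = B ^ 1 := (pow_one B).symm
      _ ≤ B ^ (e.deg + 3) := Nat.pow_le_pow_right (by omega) (by omega)

/-! ### Implementation on the word RAM -/

/-- The register of a variable. -/
def Var.reg (x : Var) : ℕ := 4 * x.ctorIdx + 1

/-- The address of entry `i` of the array with code `c`. -/
def Env.addr (E : Env) (c i : ℕ) : ℕ := 32 * i + c + E.L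

/-- Replace the index in register `4 * k` by the address of the entry of the array with code `c`. -/
def addrC (k c : ℕ) : Cmd :=
  .seq (.const (4 * k + 4) 32) (.seq (.op .mul (4 * k) (4 * k) (4 * k + 4))
    (.seq (.const (4 * k + 4) c) (.seq (.op .add (4 * k) (4 * k) (4 * k + 4))
      (.op .add (4 * k) (4 * k) 2))))

/-- Replace the index in register `4 * k` by the array entry. -/
def readC (α : Arr) (k : ℕ) : Cmd :=
  if α = .io then
    .seq (.op .lt (4 * k + 4) (4 * k) 2) (.ite (4 * k + 4) (.load (4 * k) (4 * k)) (.const (4 * k) 0))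
  else if α = .vm then
    .seq (addrC k 0) (.seq (.const (4 * k + 4) 1) (.seq (.op .add (4 * k + 4) (4 * k) (4 * k + 4))
      (.seq (.load (4 * k + 4) (4 * k + 4)) (.seq (.op .eq (4 * k + 4) (4 * k + 4) 6)
        (.ite (4 * k + 4) (.load (4 * k) (4 * k)) (.const (4 * k) 0))))))
  else .seq (addrC k α.ctorIdx) (.load (4 * k) (4 * k))

/-- Store the value in register `4` at the index in register `0`. -/
def writeC (α : Arr) : Cmd :=
  if α = .io then .seq .skip (.store 0 4)
  else if α = .vm then
    .seq (.seq (.const 8 0) (.op .add 8 4 8)) (.seq (addrC 0 0) (.seq (.store 0 8)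
      (.seq (.const 4 1) (.seq (.op .add 0 0 4) (.store 0 6)))))
  else .seq (.seq (.const 8 0) (.op .add 8 4 8)) (.seq (addrC 0 α.ctorIdx) (.store 0 8))

/-- Evaluate an expression into register `4 * k`. -/
def Expr.comp : Expr → ℕ → Cmd
  | .var x, k => .seq (.const (4 * k) 0) (.op .add (4 * k) (4 * k) x.reg)
  | .lit c, k => .const (4 * k) c
  | .bin o e₁ e₂, k => .seq (e₁.comp k) (.seq (e₂.comp (k + 1)) (.op o (4 * k) (4 * k) (4 * k + 4)))
  | .rd α e, k => .seq (e.comp k) (readC α k)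

/-- The configuration `s` implements the store `σ`, where the subroutine memory was cleared `ctr`
times. -/
structure Rep (E : Env) (ctr : ℕ) (s : State) (σ : Store) : Prop where
  -- Registers are separated by their residues modulo 4: multiples of 4 are scratch space, the
  -- residue 1 holds variables, the residue 3 belongs to the subroutine, and the registers 2 and 6
  -- hold `L` and the clear counter.
  reg : ∀ x : Var, s.reg x.reg = σ.v x
  io_lt : ∀ i < E.L, s.mem i = σ.a .io i
  io_ge : ∀ i, E.L ≤ i → σ.a .io i = 0
  arr : ∀ α : Arr, α ≠ .io → α ≠ .vm → ∀ i, s.mem (E.addr α.ctorIdx i) = σ.a α i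
  -- A cell of the virtual memory counts only if its stamp is the current counter; otherwise it
  -- reads as zero. No stamp exceeds the counter, so incrementing the counter clears everything at
  -- once.
  vm : ∀ i, σ.a .vm i = if s.mem (E.addr 1 i) = ctr then s.mem (E.addr 0 i) else 0
  stamp : ∀ i, s.mem (E.addr 1 i) ≤ ctr
  rl : s.reg 2 = E.L
  rctr : s.reg 6 = ctr
  pos : s.pos = σ.pos
  bv : ∀ x, σ.v x ≤ E.B
  ba : ∀ α i, σ.a α i ≤ E.B

/-- `s'` differs from `s` only in the temporary registers from `4 * k` on. -/
structure TempEq (k : ℕ) (s s' : State) : Prop where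
  mem : s'.mem = s.mem
  pos : s'.pos = s.pos
  reg : ∀ r, r % 4 ≠ 0 ∨ r < 4 * k → s'.reg r = s.reg r

theorem TempEq.trans {k : ℕ} {s₁ s₂ s₃ : State} (h₁ : TempEq k s₁ s₂) (h₂ : TempEq k s₂ s₃) :
    TempEq k s₁ s₃ :=
  ⟨h₂.mem.trans h₁.mem, h₂.pos.trans h₁.pos, fun r hr => (h₂.reg r hr).trans (h₁.reg r hr)⟩

theorem TempEq.mono {k l : ℕ} (hkl : k ≤ l) {s₁ s₂ : State} (h : TempEq l s₁ s₂) :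
    TempEq k s₁ s₂ :=
  ⟨h.mem, h.pos, fun r hr => h.reg r (by omega)⟩

/-- Scratch registers and the registers of the subroutine are invisible to the representation. -/
theorem Rep.congr {E : Env} {ctr : ℕ} {s s' : State} {σ : Store} (h : Rep E ctr s σ)
    (hm : s'.mem = s.mem) (hp : s'.pos = s.pos) (hr : ∀ r, r % 4 = 1 ∨ r % 4 = 2 → s'.reg r = s.reg r) :
    Rep E ctr s' σ where
  reg x := by rw [hr _ (by unfold Var.reg; omega), h.reg]
  io_lt := by rw [hm]; exact h.io_lt
  io_ge := h.io_ge
  arr := by rw [hm]; exact h.arr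
  vm := by rw [hm]; exact h.vm
  stamp := by rw [hm]; exact h.stamp
  rl := by rw [hr _ (by omega), h.rl]
  rctr := by rw [hr _ (by omega), h.rctr]
  pos := hp.trans h.pos
  bv := h.bv
  ba := h.ba

theorem Rep.tempEq {E : Env} {ctr : ℕ} {s s' : State} {σ : Store} (h : Rep E ctr s σ) {k : ℕ}
    (ht : TempEq k s s') : Rep E ctr s' σ :=
  h.congr ht.mem ht.pos fun r hr => ht.reg r (by omega)

@[simp] theorem State.setReg_reg (s : State) (d x r : ℕ) :
    (s.setReg d x).reg r = if r = d then x else s.reg r := by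
  simp [State.setReg, Function.update_apply]
@[simp] theorem State.setReg_mem (s : State) (d x : ℕ) : (s.setReg d x).mem = s.mem := rfl
@[simp] theorem State.setReg_pos (s : State) (d x : ℕ) : (s.setReg d x).pos = s.pos := rfl
@[simp] theorem State.setMem_mem (s : State) (d x r : ℕ) :
    (s.setMem d x).mem r = if r = d then x else s.mem r := by
  simp [State.setMem, Function.update_apply]
@[simp] theorem State.setMem_reg (s : State) (d x : ℕ) : (s.setMem d x).reg = s.reg := rfl
@[simp] theorem State.setMem_pos (s : State) (d x : ℕ) : (s.setMem d x).pos = s.pos := rfl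

theorem Env.small (E : Env) {x : ℕ} (h : x ≤ E.B ^ 100) : x < E.W := h.trans_lt E.hW

theorem Env.B_le (E : Env) {d : ℕ} (h : 1 ≤ d) : E.B ≤ E.B ^ d :=
  Nat.le_self_pow (by omega) _

theorem Env.small_of_le_B (E : Env) {x : ℕ} (h : x ≤ E.B) : x < E.W :=
  E.small (h.trans (E.B_le (by norm_num)))

theorem Env.ite_lt (E : Env) (p : Prop) [Decidable p] : (if p then 1 else 0) < E.W := by
  have := E.hB
  split_ifs <;> exact E.small_of_le_B (by omega)

/-- Addresses of entries at indices below `B ^ 90` are small. -/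
theorem Env.addr_le (E : Env) {c i : ℕ} (hc : c < 32) (hi : i ≤ E.B ^ 93) :
    32 * i + c + E.L + 1 ≤ E.B ^ 100 := by
  have h1 : E.B * E.B ^ 93 = E.B ^ 94 := by ring
  have h2 : E.B ≤ E.B ^ 94 := E.B_le (by norm_num)
  have h3 : E.B ^ 94 * 32 ≤ E.B ^ 94 * E.B := Nat.mul_le_mul_left _ E.hB
  have h4 : E.B ^ 94 * E.B = E.B ^ 95 := by ring
  have h5 : E.B ^ 95 ≤ E.B ^ 100 := Nat.pow_le_pow_right (by have := E.hB; omega) (by norm_num)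
  have h6 : 32 * i ≤ E.B * E.B ^ 93 := Nat.mul_le_mul E.hB hi
  have := E.hL; have := E.hB
  omega

theorem runs_addrC (E : Env) {k c : ℕ} (hc : c < 32) {s : State} (hl : s.reg 2 = E.L)
    (hi : s.reg (4 * k) ≤ E.B ^ 93) :
    ∃ s', Runs E.W E.coins (addrC k c) s 5 s' ∧ s'.reg (4 * k) = E.addr c (s.reg (4 * k)) ∧
      TempEq k s s' ∧ ∀ r, r ≠ 4 * k → r ≠ 4 * k + 4 → s'.reg r = s.reg r := by
  have ha := E.addr_le hc hi
  have hB := E.hB.trans (E.B_le (d := 100) (by norm_num))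
  refine ⟨_, Runs.seq (Runs.const _ _ _ (E.small (by omega)))
    (Runs.seq (Runs.op _ _ _ _ _ (E.small ?_)) (Runs.seq (Runs.const _ _ _ (E.small (by omega)))
    (Runs.seq (Runs.op _ _ _ _ _ (E.small ?_)) (Runs.op _ _ _ _ _ (E.small ?_))))), ?_, ⟨rfl, rfl, ?_⟩, ?_⟩
  · simp [BinOp.eval]; omega
  · simp [BinOp.eval]; omega
  · have : ¬ 2 = 4 * k := by omega
    have : ¬ 2 = 4 * k + 4 := by omega
    simp [BinOp.eval, *]; omega
  · have : ¬ 2 = 4 * k := by omega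
    have : ¬ 2 = 4 * k + 4 := by omega
    simp [BinOp.eval, Env.addr, *]; ring
  · intro r hr
    have h1 : ¬ r = 4 * k := by omega
    have h2 : ¬ r = 4 * k + 4 := by omega
    simp [h1, h2]
  · intro r h1 h2
    simp [h1, h2]

theorem runs_readC {E : Env} {ctr k : ℕ} (α : Arr) {s : State} {σ : Store} (h : Rep E ctr s σ)
    (hi : s.reg (4 * k) ≤ E.B ^ 93) :
    ∃ t ≤ 13, ∃ s', Runs E.W E.coins (readC α k) s t s' ∧
      s'.reg (4 * k) = σ.a α (s.reg (4 * k)) ∧ TempEq k s s' := by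
  have n2 : ¬ 2 = 4 * k := by omega
  have n6 : ¬ 6 = 4 * k := by omega
  have n2' : ¬ 2 = 4 * k + 4 := by omega
  have n6' : ¬ 6 = 4 * k + 4 := by omega
  have s0 : 0 < E.W := E.small (Nat.zero_le _)
  have s1 : 1 < E.W := E.small_of_le_B (by have := E.hB; omega)
  have te : ∀ r, r % 4 ≠ 0 ∨ r < 4 * k → ¬ r = 4 * k ∧ ¬ r = 4 * k + 4 := by omega
  unfold readC
  split_ifs with h1 h2
  · subst h1
    by_cases hlt : s.reg (4 * k) < E.L
    · refine ⟨_, ?_, _, Runs.seq (Runs.op _ _ _ _ _ ?_) (Runs.ite_true ?_ (Runs.load _ _ _)),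
        ?_, rfl, rfl, ?_⟩
      · norm_num
      · exact E.ite_lt _
      · simp [BinOp.eval, h.rl, hlt]
      · simp [BinOp.eval, h.io_lt _ hlt]
      · intro r hr; simp [te r hr]
    · refine ⟨_, ?_, _, Runs.seq (Runs.op _ _ _ _ _ ?_) (Runs.ite_false ?_ (Runs.const _ _ _ s0)),
        ?_, rfl, rfl, ?_⟩
      · norm_num
      · exact E.ite_lt _
      · simp only [BinOp.eval, State.setReg_reg, h.rl]; simp [hlt]
      · simp [h.io_ge _ (not_lt.1 hlt)]
      · intro r hr; simp [te r hr]
  · subst h2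
    obtain ⟨s1', r1, v1, e1, -⟩ := runs_addrC E (k := k) (c := 0) (by norm_num) h.rl hi
    have ha := E.addr_le (c := 0) (by norm_num) hi
    have hc6 : s1'.reg 6 = ctr := by rw [e1.reg _ (by omega), h.rctr]
    -- The stamp of an entry is stored right after its value, since the codes are 1 and 0.
    have had : s1'.reg (4 * k) + 1 = E.addr 1 (s.reg (4 * k)) := by
      rw [v1]; simp only [Env.addr]; omega
    by_cases hst : s.mem (E.addr 1 (s.reg (4 * k))) = ctr
    · refine ⟨_, ?_, _, Runs.seq r1 (Runs.seq (Runs.const _ _ _ s1) (Runs.seq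
        (Runs.op _ _ _ _ _ ?_) (Runs.seq (Runs.load _ _ _) (Runs.seq (Runs.op _ _ _ _ _ ?_)
          (Runs.ite_true ?_ (Runs.load _ _ _)))))), ?_, e1.trans ⟨rfl, rfl, ?_⟩⟩
      · norm_num
      · simp only [BinOp.eval, State.setReg_reg]
        apply E.small; simp [v1, Env.addr]; omega
      · exact E.ite_lt _
      · simp only [BinOp.eval, State.setReg_reg, State.setReg_mem]
        simp [n6', hc6, had, e1.mem, hst]
      · simp [BinOp.eval, h.vm, hst, e1.mem, v1]
      · intro r hr; simp [te r hr]
    · refine ⟨_, ?_, _, Runs.seq r1 (Runs.seq (Runs.const _ _ _ s1) (Runs.seq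
        (Runs.op _ _ _ _ _ ?_) (Runs.seq (Runs.load _ _ _) (Runs.seq (Runs.op _ _ _ _ _ ?_)
          (Runs.ite_false ?_ (Runs.const _ _ _ s0)))))), ?_, e1.trans ⟨rfl, rfl, ?_⟩⟩
      · norm_num
      · simp only [BinOp.eval, State.setReg_reg]
        apply E.small; simp [v1, Env.addr]; omega
      · exact E.ite_lt _
      · simp only [BinOp.eval, State.setReg_reg, State.setReg_mem]
        simp [n6', hc6, had, e1.mem, hst]
      · simp [h.vm, hst]
      · intro r hr; simp [te r hr]
  · obtain ⟨s1', r1, v1, e1, -⟩ := runs_addrC E (k := k) α.ctorIdx_lt h.rl hi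
    refine ⟨_, ?_, _, Runs.seq r1 (Runs.load _ _ _), ?_, e1.trans ⟨rfl, rfl, ?_⟩⟩
    · norm_num
    · simp [v1, e1.mem, h.arr α h1 h2]
    · intro r hr; simp [te r hr]

theorem Expr.runs_comp {E : Env} {ctr : ℕ} {σ : Store} (e : Expr) (hd : e.deg ≤ 90) (k : ℕ)
    {s : State} (h : Rep E ctr s σ) :
    ∃ t ≤ 20 * e.deg, ∃ s', Runs E.W E.coins (e.comp k) s t s' ∧ s'.reg (4 * k) = e.eval σ ∧
      TempEq k s s' := by
  have hB := E.hB
  induction e generalizing k s with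
  | var x =>
    refine ⟨_, ?_, _, Runs.seq (Runs.const _ _ _ (E.small (Nat.zero_le _)))
      (Runs.op _ _ _ _ _ ?_), ?_, rfl, rfl, ?_⟩
    · simp [deg]
    · have : ¬ x.reg = 4 * k := by unfold Var.reg; omega
      simpa [BinOp.eval, this, h.reg] using E.small_of_le_B (h.bv x)
    · have : ¬ x.reg = 4 * k := by unfold Var.reg; omega
      simp [BinOp.eval, this, h.reg]
    · intro r hr
      have : ¬ r = 4 * k := by omega
      simp [this]
  | lit c =>
    refine ⟨_, ?_, _, Runs.const _ _ _ (E.small ?_), ?_, rfl, rfl, ?_⟩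
    · simp only [deg]; omega
    · have := Expr.eval_le hB h.bv h.ba (.lit c)
      exact this.trans (Nat.pow_le_pow_right (by omega) (by omega))
    · simp
    · intro r hr
      have : ¬ r = 4 * k := by omega
      simp [this]
  | bin o e₁ e₂ ih₁ ih₂ =>
    have hd' : e₁.deg + e₂.deg + 1 ≤ 90 := hd
    obtain ⟨t₁, ht₁, s₁, r₁, v₁, q₁⟩ := ih₁ (by omega) k h
    obtain ⟨t₂, ht₂, s₂, r₂, v₂, q₂⟩ := ih₂ (by omega) (k + 1) (h.tempEq q₁)
    have v₁' : s₂.reg (4 * k) = e₁.eval σ := by rw [q₂.reg _ (by omega), v₁]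
    have v₂' : s₂.reg (4 * k + 4) = e₂.eval σ := by rw [← v₂]; rfl
    refine ⟨_, ?_, _, Runs.seq r₁ (Runs.seq r₂ (Runs.op _ _ _ _ _ (E.small ?_))), ?_,
      q₁.trans ((q₂.mono (by omega)).trans ⟨rfl, rfl, ?_⟩)⟩
    · simp only [deg]; omega
    · rw [v₁', v₂']
      exact (Expr.eval_le hB h.bv h.ba (.bin o e₁ e₂)).trans
        (Nat.pow_le_pow_right (by omega) (by omega))
    · simp [v₁', v₂', eval]
    · intro r hr
      have : ¬ r = 4 * k := by omega
      simp [this]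
  | rd α e ih =>
    have hd' : e.deg + 3 ≤ 90 := hd
    obtain ⟨t₁, ht₁, s₁, r₁, v₁, q₁⟩ := ih (by omega) k h
    obtain ⟨t₂, ht₂, s₂, r₂, v₂, q₂⟩ := runs_readC α (k := k) (h.tempEq q₁) (by
      rw [v₁]
      exact (Expr.eval_le hB h.bv h.ba e).trans (Nat.pow_le_pow_right (by omega) (by omega)))
    refine ⟨_, ?_, _, Runs.seq r₁ r₂, ?_, q₁.trans q₂⟩
    · simp only [deg]; omega
    · rw [v₂, v₁]; rfl

end WordRAM


/-! ### Writing to arrays in memory. -/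

namespace WordRAM

theorem Env.addr_inj (E : Env) {c c' i i' : ℕ} (hc : c < 32) (hc' : c' < 32) :
    E.addr c i = E.addr c' i' ↔ c = c' ∧ i = i' := by
  unfold Env.addr; omega

theorem Env.le_addr (E : Env) (c i : ℕ) : E.L ≤ E.addr c i := by
  unfold Env.addr; omega

theorem update_le {f : ℕ → ℕ} {b i x : ℕ} (hf : ∀ j, f j ≤ b) (hx : x ≤ b) (j : ℕ) :
    Function.update f i x j ≤ b := by
  rw [Function.update_apply]; split_ifs
  · exact hx
  · exact hf j

/-- The write also sets the stamp to the current counter, which makes a stale entry valid. All other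
arrays have codes at least 2 and are not touched. -/
theorem Rep.setVM {E : Env} {ctr : ℕ} {s s' : State} {σ : Store} (h : Rep E ctr s σ) {i x : ℕ}
    (hx : x ≤ E.B) (hm : s'.mem = Function.update (Function.update s.mem (E.addr 0 i) x)
      (E.addr 1 i) ctr) (hp : s'.pos = s.pos)
    (hr : ∀ r, r % 4 = 1 ∨ r % 4 = 2 → s'.reg r = s.reg r) :
    Rep E ctr s' (σ.setA .vm (Function.update (σ.a .vm) i x)) where
  reg x := by rw [hr _ (by unfold Var.reg; omega), h.reg]; rfl
  io_lt j hj := by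
    have h0 := E.le_addr 0 i; have h1 := E.le_addr 1 i
    rw [hm, Function.update_of_ne (by omega), Function.update_of_ne (by omega), h.io_lt j hj]; simp
  io_ge j hj := by simp [h.io_ge j hj]
  arr β h1 h2 j := by
    have := Arr.two_le_ctorIdx h1 h2
    have := β.ctorIdx_lt
    rw [hm, Function.update_of_ne, Function.update_of_ne, h.arr β h1 h2]
    · simp [h2]
    · rw [Ne, E.addr_inj] <;> omega
    · rw [Ne, E.addr_inj] <;> omega
  vm j := by
    rw [hm]
    by_cases hj : j = i
    · subst hj
      simp [E.addr_inj]
    · simp [hj, E.addr_inj, h.vm]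
  stamp j := by
    rw [hm]
    by_cases hj : j = i
    · simp [hj]
    · simp [hj, E.addr_inj, h.stamp]
  rl := by rw [hr _ (by omega), h.rl]
  rctr := by rw [hr _ (by omega), h.rctr]
  pos := hp.trans h.pos
  bv := h.bv
  ba β j := by
    simp only [Store.setA_a]
    split_ifs
    · exact update_le (h.ba _) hx j
    · exact h.ba β j

theorem Rep.setArr {E : Env} {ctr : ℕ} {s s' : State} {σ : Store} (h : Rep E ctr s σ) {α : Arr}
    (hα : α ≠ .io) (hα' : α ≠ .vm) {i x : ℕ}
    (hx : x ≤ E.B) (hm : s'.mem = Function.update s.mem (E.addr α.ctorIdx i) x)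
    (hp : s'.pos = s.pos) (hr : ∀ r, r % 4 = 1 ∨ r % 4 = 2 → s'.reg r = s.reg r) :
    Rep E ctr s' (σ.setA α (Function.update (σ.a α) i x)) where
  reg x := by rw [hr _ (by unfold Var.reg; omega), h.reg]; rfl
  io_lt j hj := by
    have h0 := E.le_addr α.ctorIdx i
    rw [hm, Function.update_of_ne (by omega), h.io_lt j hj]; simp [hα.symm]
  io_ge j hj := by simp [h.io_ge j hj, hα.symm]
  arr β h1 h2 j := by
    have := β.ctorIdx_lt
    rw [hm]
    by_cases hβ : β = α
    · subst hβ
      simp only [Function.update_apply, E.addr_inj β.ctorIdx_lt β.ctorIdx_lt, Store.setA_a,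
        h.arr β h1 h2]
      simp [Function.update_apply]
    · rw [Function.update_of_ne, h.arr β h1 h2]
      · simp [hβ]
      · rw [Ne, E.addr_inj β.ctorIdx_lt α.ctorIdx_lt, Arr.ctorIdx_inj]; tauto
  vm j := by
    have := Arr.two_le_ctorIdx hα hα'
    have := α.ctorIdx_lt
    rw [hm, Function.update_of_ne, Function.update_of_ne]
    · simp [hα'.symm, h.vm]
    · rw [Ne, E.addr_inj] <;> omega
    · rw [Ne, E.addr_inj] <;> omega
  stamp j := by
    have := Arr.two_le_ctorIdx hα hα'
    have := α.ctorIdx_lt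
    rw [hm, Function.update_of_ne]
    · exact h.stamp j
    · rw [Ne, E.addr_inj] <;> omega
  rl := by rw [hr _ (by omega), h.rl]
  rctr := by rw [hr _ (by omega), h.rctr]
  pos := hp.trans h.pos
  bv := h.bv
  ba β j := by
    simp only [Store.setA_a]
    split_ifs
    · exact update_le (h.ba _) hx j
    · exact h.ba β j

theorem Rep.setInOut {E : Env} {ctr : ℕ} {s s' : State} {σ : Store} (h : Rep E ctr s σ) {i x : ℕ}
    (hi : i < E.L) (hx : x ≤ E.B) (hm : s'.mem = Function.update s.mem i x)
    (hp : s'.pos = s.pos) (hr : ∀ r, r % 4 = 1 ∨ r % 4 = 2 → s'.reg r = s.reg r) :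
    Rep E ctr s' (σ.setA .io (Function.update (σ.a .io) i x)) := by
  have hne : ∀ c j, E.addr c j ≠ i := fun c j => by have := E.le_addr c j; omega
  refine
    { reg := fun x => by rw [hr _ (by unfold Var.reg; omega), h.reg]; rfl
      io_lt := fun j hj => ?_
      io_ge := fun j hj => ?_
      arr := fun β h1 h2 j => ?_
      vm := fun j => ?_
      stamp := fun j => ?_
      rl := by rw [hr _ (by omega), h.rl]
      rctr := by rw [hr _ (by omega), h.rctr]
      pos := hp.trans h.pos
      bv := h.bv
      ba := fun β j => ?_ }
  · rw [hm]
    by_cases hj' : j = i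
    · simp [hj']
    · simp [hj', h.io_lt j hj]
  · simp only [Store.setA_a, if_true]
    rw [Function.update_of_ne (by omega), h.io_ge j hj]
  · rw [hm, Function.update_of_ne (hne _ _), h.arr β h1 h2]; simp [h1]
  · rw [hm, Function.update_of_ne (hne _ _), Function.update_of_ne (hne _ _)]; simp [h.vm]
  · rw [hm, Function.update_of_ne (hne _ _)]; exact h.stamp j
  · simp only [Store.setA_a]
    split_ifs
    · exact update_le (h.ba _) hx j
    · exact h.ba β j

theorem runs_writeC {E : Env} {ctr : ℕ} (α : Arr) {s : State} {σ : Store} (h : Rep E ctr s σ)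
    (hi : s.reg 0 ≤ E.B ^ 93) (hx : s.reg 4 ≤ E.B) (hio : α = .io → s.reg 0 < E.L) :
    ∃ t ≤ 13, ∃ s', Runs E.W E.coins (writeC α) s t s' ∧
      Rep E ctr s' (σ.setA α (Function.update (σ.a α) (s.reg 0) (s.reg 4))) ∧
      ∀ r, r % 4 = 3 → s'.reg r = s.reg r := by
  have z : 0 < E.W := E.small (Nat.zero_le _)
  have hx' := E.small_of_le_B hx
  have s1 : 1 < E.W := E.small_of_le_B (by have := E.hB; omega)
  unfold writeC
  split_ifs with h1 h2
  · subst h1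
    exact ⟨_, by norm_num, _, Runs.seq (Runs.skip _) (Runs.store _ _ _),
      h.setInOut (hio rfl) hx rfl rfl fun _ _ => rfl, fun _ _ => rfl⟩
  · subst h2
    obtain ⟨s', r, v, e, e'⟩ := runs_addrC E (k := 0) (c := 0)
      (s := (s.setReg 8 0).setReg 8 (s.reg 4)) (by norm_num) (by simp [h.rl]) (by simpa using hi)
    have ha := E.addr_le (c := 0) (by norm_num) hi
    have e0 : s'.reg 0 = E.addr 0 (s.reg 0) := by simpa using v
    have e8 : s'.reg 8 = s.reg 4 := by simpa using e' 8 (by norm_num) (by norm_num)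
    have e6 : s'.reg 6 = ctr := by simpa [h.rctr] using e' 6 (by norm_num) (by norm_num)
    refine ⟨_, ?_, _, Runs.seq (Runs.seq (Runs.const _ _ _ z) (Runs.op _ _ _ _ _ ?_))
      (Runs.seq (s₂ := s') (t₁ := 5) ?_ (Runs.seq (Runs.store _ _ _) (Runs.seq (Runs.const _ _ _ s1)
        (Runs.seq (Runs.op _ _ _ _ _ (E.small ?_)) (Runs.store _ _ _))))),
      h.setVM hx ?_ ?_ ?_, ?_⟩
    · norm_num
    · simpa [BinOp.eval] using hx'
    · convert r using 1
      simp [BinOp.eval]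
    · simp [BinOp.eval, e0, Env.addr]; omega
    · funext j
      simp only [BinOp.eval, State.setMem_mem, State.setReg_mem, State.setReg_reg,
        State.setMem_reg, e.mem, e0, e8, e6, Function.update_apply]
      have : E.addr 0 (s.reg 0) + 1 = E.addr 1 (s.reg 0) := by unfold Env.addr; omega
      simp [this]
    · simp [e.pos]
    · intro r hr
      have : ¬ r = 0 := by omega
      have : ¬ r = 4 := by omega
      have : ¬ r = 8 := by omega
      simp [*]
    · intro r hr
      have : ¬ r = 0 := by omega
      have : ¬ r = 4 := by omega
      have : ¬ r = 8 := by omega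
      simp [*]
  · obtain ⟨s', r, v, e, e'⟩ := runs_addrC E (k := 0) (c := α.ctorIdx)
      (s := (s.setReg 8 0).setReg 8 (s.reg 4)) α.ctorIdx_lt (by simp [h.rl]) (by simpa using hi)
    have e0 : s'.reg 0 = E.addr α.ctorIdx (s.reg 0) := by simpa using v
    have e8 : s'.reg 8 = s.reg 4 := by simpa using e' 8 (by norm_num) (by norm_num)
    refine ⟨_, ?_, _, Runs.seq (Runs.seq (Runs.const _ _ _ z) (Runs.op _ _ _ _ _ ?_))
      (Runs.seq (s₂ := s') (t₁ := 5) ?_ (Runs.store _ _ _)),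
      h.setArr h1 h2 hx ?_ ?_ ?_, ?_⟩
    · norm_num
    · simpa [BinOp.eval] using hx'
    · convert r using 1
      simp [BinOp.eval]
    · funext j
      simp [e0, e8, e.mem, Function.update_apply]
    · simp [e.pos]
    · intro r hr
      have : ¬ r = 0 := by omega
      have : ¬ r = 4 := by omega
      have : ¬ r = 8 := by omega
      simp [*]
    · intro r hr
      have : ¬ r = 0 := by omega
      have : ¬ r = 4 := by omega
      have : ¬ r = 8 := by omega
      simp [*]

end WordRAM


namespace WordRAM

/-! ### Structured commands -/

/-- Assign the value of an expression to a variable. -/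
def assign (x : Var) (e : Expr) : Cmd :=
  .seq (e.comp 0) (.seq (.const 4 0) (.op .add x.reg 0 4))

/-- Store the value of `e` at the index `ix` of the array `α`. -/
def storeA (α : Arr) (ix e : Expr) : Cmd :=
  .seq (ix.comp 0) (.seq (e.comp 1) (writeC α))

/-- Toss a coin. -/
def coinV (x : Var) : Cmd := .coin x.reg

/-- Conditional execution. -/
def iteE (e : Expr) (c₁ c₂ : Cmd) : Cmd := .seq (e.comp 0) (.ite 0 c₁ c₂)

/-- A loop that runs as long as the expression is nonzero. -/
def whileE (e : Expr) (c : Cmd) : Cmd := .seq (e.comp 0) (.while 0 (.seq c (e.comp 0)))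

/-- Clear the virtual memory. -/
def clearVM : Cmd := .seq (.const 0 1) (.op .add 6 6 0)

/-- The loop `for x < e do c`. -/
def forC (x : Var) (e : Expr) (c : Cmd) : Cmd :=
  .seq (assign x 0) (whileE (Expr.lt x e) (.seq c (assign x (x + 1))))

/-- The loop that stores `e` at the index `ix` of `α` for all values of `x` below `len`. -/
def scatter (x : Var) (len : Expr) (α : Arr) (ix e : Expr) : Cmd := forC x len (storeA α ix e)

/-- The number of steps of one assignment. -/
@[irreducible] def cst : ℕ := 4000

/-- Total correctness with a time bound: from every configuration that implements `σ`, the command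
halts within `t` steps in a configuration that implements a store with the property `Q`. -/
def Tri (E : Env) (c : Cmd) (σ : Store) (t : ℕ) (Q : Store → Prop) : Prop :=
  -- The virtual memory is cleared at most once per step, so the budget `ctr + t ≤ E.B` keeps the
  -- clear counter bounded by `B`, hence within a machine word.
  ∀ ctr s, Rep E ctr s σ → ctr + t ≤ E.B → ∃ t' ≤ t, ∃ s' ctr' σ',
    Runs E.W E.coins c s t' s' ∧ ctr' ≤ ctr + t ∧ Rep E ctr' s' σ' ∧ Q σ'

namespace Tri

variable {E : Env} {σ : Store} {t t₁ t₂ : ℕ} {Q : Store → Prop}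

theorem mono {c : Cmd} {R : Store → Prop} (h : Tri E c σ t₁ R) (ht : t₁ ≤ t)
    (hQ : ∀ σ', R σ' → Q σ') : Tri E c σ t Q := by
  intro ctr s hs hb
  obtain ⟨t', ht', s', ctr', σ', r, hc, hr, hq⟩ := h ctr s hs (by omega)
  exact ⟨t', by omega, s', ctr', σ', r, by omega, hr, hQ _ hq⟩

theorem time {c : Cmd} (h : Tri E c σ t₁ Q) (ht : t₁ ≤ t) : Tri E c σ t Q := h.mono ht fun _ => id

/-- The postcondition of the first command is the triple of the second one. Correctness proofs
therefore follow the program text in continuation style, without named intermediate assertions. -/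
theorem seq {c₁ c₂ : Cmd} (h : Tri E c₁ σ t₁ fun σ' => Tri E c₂ σ' t₂ Q) :
    Tri E (.seq c₁ c₂) σ (t₁ + t₂) Q := by
  intro ctr s hs hb
  obtain ⟨t', ht', s', ctr', σ', r, hc, hr, hq⟩ := h ctr s hs (by omega)
  obtain ⟨t'', ht'', s'', ctr'', σ'', r', hc', hr', hq'⟩ := hq ctr' s' hr (by omega)
  exact ⟨_, by omega, s'', ctr'', σ'', Runs.seq r r', by omega, hr', hq'⟩

/-- The stores that are implemented have bounded entries. -/
theorem bdd {c : Cmd} (h : (∀ x, σ.v x ≤ E.B) → (∀ α i, σ.a α i ≤ E.B) → Tri E c σ t Q) :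
    Tri E c σ t Q := fun ctr s hs hb => h hs.bv hs.ba ctr s hs hb

theorem skip (h : Q σ) : Tri E .skip σ 1 Q := fun ctr s hs _ =>
  ⟨1, le_rfl, s, ctr, σ, Runs.skip s, by omega, hs, h⟩

theorem assign {x : Var} {e : Expr} (hd : e.deg ≤ 90) (hv : e.eval σ ≤ E.B)
    (h : Q (σ.setV x (e.eval σ))) : Tri E (assign x e) σ cst Q := by
  intro ctr s hs hb
  obtain ⟨t, ht, s', r, v, q⟩ := e.runs_comp hd 0 hs
  have hs' := hs.tempEq q
  refine ⟨_, ?_, _, ctr, _, Runs.seq r (Runs.seq (Runs.const _ _ _ (E.small (Nat.zero_le _)))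
    (Runs.op _ _ _ _ _ ?_)), by omega, ?_, h⟩
  · unfold cst; omega
  · simpa [BinOp.eval, v] using E.small_of_le_B hv
  · have hx : ∀ k, k % 4 ≠ 1 → ¬ k = x.reg := by unfold Var.reg; omega
    refine ⟨fun y => ?_, hs'.io_lt, hs'.io_ge, hs'.arr, hs'.vm, hs'.stamp, ?_, ?_, hs'.pos,
      fun y => ?_, hs'.ba⟩
    · have : y.reg = x.reg ↔ y = x := by
        rw [← Var.ctorIdx_inj]; unfold Var.reg; omega
      have h4 : ¬ y.reg = 4 := by unfold Var.reg; omega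
      simp only [BinOp.eval, State.setReg_reg, Store.setV_v, this, h4, if_false, hs'.reg]
      simp [v]
    · simp [hx, hs'.rl]
    · simp [hx, hs'.rctr]
    · simp only [Store.setV_v]; split_ifs
      · exact hv
      · exact hs'.bv y

theorem storeA {α : Arr} {ix e : Expr} (hdi : ix.deg ≤ 90) (hd : e.deg ≤ 90)
    (hio : α = .io → ix.eval σ < E.L) (hv : e.eval σ ≤ E.B)
    (h : Q (σ.setA α (Function.update (σ.a α) (ix.eval σ) (e.eval σ)))) :
    Tri E (storeA α ix e) σ cst Q := by
  intro ctr s hs hb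
  obtain ⟨t₁, ht₁, s₁, r₁, v₁, q₁⟩ := ix.runs_comp hdi 0 hs
  obtain ⟨t₂, ht₂, s₂, r₂, v₂, q₂⟩ := e.runs_comp hd 1 (hs.tempEq q₁)
  have v₁' : s₂.reg 0 = ix.eval σ := by rw [← v₁, q₂.reg 0 (by norm_num)]
  have v₂' : s₂.reg 4 = e.eval σ := v₂
  obtain ⟨t₃, ht₃, s₃, r₃, h₃, -⟩ := runs_writeC α ((hs.tempEq q₁).tempEq q₂)
    (by rw [v₁']; exact (Expr.eval_le E.hB hs.bv hs.ba ix).trans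
          (Nat.pow_le_pow_right (by have := E.hB; omega) (by omega)))
    (by rw [v₂']; exact hv) (by rw [v₁']; exact hio)
  rw [v₁', v₂'] at h₃
  exact ⟨_, by unfold cst; omega, s₃, ctr, _, Runs.seq r₁ (Runs.seq r₂ r₃), by omega, h₃, h⟩

theorem coinV {x : Var}
    (h : Q (σ.toss x (E.coins σ.pos))) :
    Tri E (coinV x) σ 1 Q := by
  intro ctr s hs hb
  have hx : ∀ k, k % 4 ≠ 1 → ¬ k = x.reg := by unfold Var.reg; omega
  refine ⟨_, le_rfl, _, ctr, σ.toss x (E.coins σ.pos), Runs.coin _ _, by omega, ⟨fun y => ?_, hs.io_lt, hs.io_ge, hs.arr,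
      hs.vm, hs.stamp, ?_, ?_, ?_, fun y => ?_, hs.ba⟩, h⟩
  · have : y.reg = x.reg ↔ y = x := by
      rw [← Var.ctorIdx_inj]; unfold Var.reg; omega
    simp only [State.setReg_reg, Store.toss, Store.setV_v, this, hs.reg, hs.pos]
  · simp [hx, hs.rl]
  · simp [hx, hs.rctr]
  · simp [hs.pos, Store.toss]
  · have := E.hB
    simp only [Store.toss, Store.setV_v]; split_ifs
    · omega
    · omega
    · exact hs.bv y

theorem iteE {e : Expr} {c₁ c₂ : Cmd} (hd : e.deg ≤ 90) (h₁ : e.eval σ ≠ 0 → Tri E c₁ σ t Q)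
    (h₂ : e.eval σ = 0 → Tri E c₂ σ t Q) : Tri E (iteE e c₁ c₂) σ (t + cst) Q := by
  intro ctr s hs hb
  obtain ⟨t₁, ht₁, s₁, r₁, v₁, q₁⟩ := e.runs_comp hd 0 hs
  by_cases he : e.eval σ = 0
  · obtain ⟨t', ht', s', ctr', σ', r, hc, hr, hq⟩ := h₂ he ctr s₁ (hs.tempEq q₁) (by omega)
    exact ⟨_, by unfold cst; omega, s', ctr', σ', Runs.seq r₁ (Runs.ite_false (v₁.trans he) r),
      by omega, hr, hq⟩
  · obtain ⟨t', ht', s', ctr', σ', r, hc, hr, hq⟩ := h₁ he ctr s₁ (hs.tempEq q₁) (by omega)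
    exact ⟨_, by unfold cst; omega, s', ctr', σ',
      Runs.seq r₁ (Runs.ite_true (by rw [show s₁.reg 0 = _ from v₁]; exact he) r),
      by omega, hr, hq⟩

theorem while_done {e : Expr} {c : Cmd} (hd : e.deg ≤ 90) (he : e.eval σ = 0) (h : Q σ) :
    Tri E (whileE e c) σ cst Q := by
  intro ctr s hs hb
  obtain ⟨t₁, ht₁, s₁, r₁, v₁, q₁⟩ := e.runs_comp hd 0 hs
  exact ⟨_, by unfold cst; omega, s₁, ctr, σ, Runs.seq r₁ (Runs.while_done (v₁.trans he)),
    by omega, hs.tempEq q₁, h⟩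

theorem while_step {e : Expr} {c : Cmd} (hd : e.deg ≤ 90) (he : e.eval σ ≠ 0)
    (h : Tri E c σ t₁ fun σ' => Tri E (whileE e c) σ' t₂ Q) :
    Tri E (whileE e c) σ (t₁ + t₂ + cst) Q := by
  intro ctr s hs hb
  obtain ⟨t₀, ht₀, s₀, r₀, v₀, q₀⟩ := e.runs_comp hd 0 hs
  obtain ⟨t', ht', s', ctr', σ', r, hc, hr, hq⟩ := h ctr s₀ (hs.tempEq q₀) (by omega)
  obtain ⟨t'', ht'', s'', ctr'', σ'', r', hc', hr', hq'⟩ := hq ctr' s' hr (by omega)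
  -- The run of the remaining loop begins by evaluating the test. This evaluation is split off and
  -- becomes the end of the loop body just executed.
  cases r' with
  | seq g₁ g₂ =>
    refine ⟨_, ?_, s'', ctr'', σ'', Runs.seq r₀ (Runs.while_step
      (by rw [show s₀.reg 0 = _ from v₀]; exact he) (Runs.seq r g₁) g₂), by omega, hr', hq'⟩
    unfold cst; omega

/-- Every stamp is at most the old counter, so after the increment no stamp is current and all
entries read as zero. -/
theorem clearVM (h : Q (σ.setA .vm fun _ => 0)) : Tri E clearVM σ 2 Q := by
  intro ctr s hs hb
  have hB := E.hB
  have s1 : 1 < E.W := E.small_of_le_B (by omega)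
  refine ⟨_, le_rfl, _, ctr + 1, σ.setA .vm fun _ => 0, Runs.seq (Runs.const _ _ _ s1) (Runs.op _ _ _ _ _
    (E.small_of_le_B ?_)), by omega, ⟨fun y => ?_, fun i hi => ?_, fun i hi => ?_,
      fun α h₁ h₂ i => ?_, fun i => ?_, fun i => ?_, ?_, ?_, ?_, hs.bv, fun α i => ?_⟩, h⟩
  · simp [BinOp.eval, hs.rctr]; omega
  · have h6 : ¬ y.reg = 6 := by unfold Var.reg; omega
    have h0 : ¬ y.reg = 0 := by unfold Var.reg; omega
    simp [h6, h0, hs.reg]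
  · simp [hs.io_lt i hi]
  · simp [hs.io_ge i hi]
  · simp [hs.arr α h₁ h₂, h₂]
  · have := hs.stamp i
    have : ¬ s.mem (E.addr 1 i) = ctr + 1 := by omega
    simp [this]
  · have := hs.stamp i
    simp only [State.setReg_mem]; omega
  · simp [hs.rl]
  · simp [hs.rctr, BinOp.eval]
  · simp [hs.pos]
  · simp only [Store.setA_a]; split_ifs
    · simp
    · exact hs.ba α i

/-- The invariant `I i` describes the store at the loop head with the counter equal to `i`. The body
has to leave the counter alone, because the loop itself increments it; hence the two-part
postcondition of the body. The induction is on the number of remaining rounds. -/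
theorem forC {x : Var} {e : Expr} {c : Cmd} {m τ : ℕ} (I : ℕ → Store → Prop) (hd : e.deg ≤ 80)
    (hm : m ≤ E.B) (hI : ∀ i ≤ m, ∀ σ', I i σ' → σ'.v x = i ∧ e.eval σ' = m)
    (h₀ : I 0 (σ.setV x 0))
    (hs : ∀ i < m, ∀ σ', I i σ' →
      Tri E c σ' τ fun σ'' => σ''.v x = i ∧ I (i + 1) (σ''.setV x (i + 1)))
    (hQ : ∀ σ', I m σ' → Q σ') : Tri E (forC x e c) σ (m * (τ + 2 * cst) + 2 * cst) Q := by
  have hd' : (Expr.lt x e).deg ≤ 90 := by simp only [Expr.lt, Expr.deg]; omega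
  have key : ∀ k i, i + k = m → ∀ σ', I i σ' → Tri E (whileE (Expr.lt x e)
      (.seq c (WordRAM.assign x (x + 1)))) σ' (k * (τ + 2 * cst) + cst) Q := by
    intro k
    induction k with
    | zero =>
      intro i hi σ' h
      obtain rfl : i = m := by omega
      obtain ⟨h₁, h₂⟩ := hI i le_rfl σ' h
      refine (while_done hd' ?_ (hQ _ h)).time (by omega)
      simp [h₁, h₂]
    | succ k ih =>
      intro i hi σ' h
      obtain ⟨h₁, h₂⟩ := hI i (by omega) σ' h
      refine (while_step (t₁ := τ + cst) (t₂ := k * (τ + 2 * cst) + cst) hd' ?_ ?_).time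
        (by ring_nf; omega)
      · simp [h₁, h₂]; omega
      · refine seq ((hs i (by omega) σ' h).mono le_rfl fun σ'' h'' => ?_)
        refine assign (by simp) ?_ ?_
        · simp [h''.1]; omega
        · have : (Expr.var x + 1).eval σ'' = i + 1 := by simp [h''.1]
          rw [this]
          exact ih (i + 1) (by omega) _ h''.2
  exact (seq (t₁ := cst) (assign (by simp) (by simp) (key m 0 (by omega) _ h₀))).time
    (by ring_nf; omega)

/-- Filling array entries by a loop. -/
theorem scatter {x : Var} {len ix e : Expr} {α : Arr} (m : ℕ) (f g : ℕ → ℕ) (hdl : len.deg ≤ 80)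
    (hdi : ix.deg ≤ 90) (hd : e.deg ≤ 90) (hm : m ≤ E.B) (hα : α ≠ .io)
    (hlen : ∀ i h, len.eval ((σ.setV x i).setA α h) = m)
    (hinj : ∀ i < m, ∀ j < m, f i = f j → i = j)
    (hix : ∀ i < m, ∀ h, ix.eval ((σ.setV x i).setA α h) = f i)
    -- The expression may read the array that is being filled. Two facts about the partially filled
    -- array are available: the entry about to be written is still old, and so is everything outside
    -- the range of `f`.
    (he : ∀ i < m, ∀ h, h (f i) = σ.a α (f i) → (∀ j, (∀ k < m, f k ≠ j) → h j = σ.a α j) →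
      e.eval ((σ.setV x i).setA α h) = g i)
    (hg : ∀ i < m, g i ≤ E.B)
    (h : ∀ h, (∀ i < m, h (f i) = g i) → (∀ j, (∀ i < m, f i ≠ j) → h j = σ.a α j) →
      Q ((σ.setV x m).setA α h)) :
    Tri E (scatter x len α ix e) σ ((m + 1) * (3 * cst)) Q := by
  refine (forC (τ := cst) (fun i σ' => ∃ h, σ' = (σ.setV x i).setA α h ∧
    (∀ j < i, h (f j) = g j) ∧ (∀ j, (∀ k < i, f k ≠ j) → h j = σ.a α j)) hdl hm ?_ ?_ ?_ ?_).time
    (by ring_nf; omega)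
  · rintro i _ _ ⟨h, rfl, -, -⟩
    exact ⟨by simp, hlen _ _⟩
  · refine ⟨σ.a α, ?_, by simp, by simp⟩
    cases σ; simp [Store.setA, Store.setV]
  · rintro i hi _ ⟨h, rfl, h₁, h₂⟩
    have hx := he i hi h (h₂ _ fun k hk hki => by have := hinj k (by omega) i hi hki; omega)
      fun j hj => h₂ j fun k hk => hj k (by omega)
    refine storeA hdi hd (fun h => absurd h hα) (by rw [hx]; exact hg i hi) ⟨by simp, ?_⟩
    rw [hx, hix i hi]
    refine ⟨Function.update h (f i) (g i), ?_, fun j hj => ?_, fun j hj => ?_⟩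
    · cases σ; simp [Store.setA, Store.setV]
    · rcases Nat.lt_succ_iff_lt_or_eq.1 hj with hj | rfl
      · rw [Function.update_of_ne, h₁ j hj]
        intro hji; have := hinj j (by omega) i hi hji; omega
      · simp
    · rw [Function.update_of_ne (hj i (by omega)).symm, h₂ j fun k hk => hj k (by omega)]
  · rintro _ ⟨h', rfl, h₁, h₂⟩
    exact h h' h₁ h₂

end Tri

end WordRAM


namespace WordRAM

/-! ### Running a program as a subroutine on the virtual memory -/

/-- The register of the subroutine's register `j`. -/
def subReg (j : ℕ) : ℕ := 4 * j + 3

/-- Copy register `b` to register `d`, using register `z`. -/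
def moveC (z d b : ℕ) : Cmd := .seq (.const z 0) (.op .add d b z)

/-- The program `c`, working on renamed registers and on the virtual memory, without coins. -/
def Cmd.virtual : Cmd → Cmd
  | .skip => .skip
  | .const d k => .const (subReg d) k
  | .op o d a b => .op o (subReg d) (subReg a) (subReg b)
  | .load d a => .seq (moveC 4 0 (subReg a)) (.seq (readC .vm 0) (moveC 4 (subReg d) 0))
  | .store a b => .seq (moveC 4 0 (subReg a)) (.seq (moveC 8 4 (subReg b)) (writeC .vm))
  -- The multiplication program is correct for every coin sequence, in particular for the constant
  -- one, so its coins can be replaced by zeros. The subroutine is then free of coins.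
  | .coin d => .const (subReg d) 0
  | .seq c₁ c₂ => .seq c₁.virtual c₂.virtual
  | .ite a c₁ c₂ => .ite (subReg a) c₁.virtual c₂.virtual
  | .while a c => .while (subReg a) c.virtual

/-- A bound for the registers that a program mentions. -/
def Cmd.regBound : Cmd → ℕ
  | .skip => 0
  | .const d _ => d + 1
  | .op _ d a b => d + a + b + 1
  | .load d a => d + a + 1
  | .store a b => a + b + 1
  | .coin d => d + 1
  | .seq c₁ c₂ => c₁.regBound + c₂.regBound
  | .ite a c₁ c₂ => a + 1 + c₁.regBound + c₂.regBound
  | .while a c => a + 1 + c.regBound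

/-- Set the first `R` registers of the subroutine to zero. -/
def zeroRegs : ℕ → Cmd
  | 0 => .skip
  | R + 1 => .seq (zeroRegs R) (.const (subReg R) 0)

/-- Run the program `c` as a subroutine. -/
def callC (c : Cmd) : Cmd := .seq (zeroRegs c.regBound) c.virtual

/-- The configuration `S` of the calling program implements the configuration `s` of the
subroutine. -/
structure SubRep (E : Env) (ctr V R : ℕ) (S : State) (σ : Store) (s : State) : Prop where
  rep : Rep E ctr S (σ.setA .vm s.mem)
  reg : ∀ j < R, S.reg (subReg j) = s.reg j
  regV : ∀ j, s.reg j ≤ V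
  memV : ∀ i, s.mem i ≤ V

theorem SubRep.setReg {E : Env} {ctr V R : ℕ} {S S' : State} {σ : Store} {s : State}
    (h : SubRep E ctr V R S σ s) {d x : ℕ} (hx : x ≤ V) (hm : S'.mem = S.mem) (hp : S'.pos = S.pos)
    (hr : ∀ r, r % 4 = 1 ∨ r % 4 = 2 → S'.reg r = S.reg r) (hd : S'.reg (subReg d) = x)
    (hj : ∀ j, j ≠ d → S'.reg (subReg j) = S.reg (subReg j)) :
    SubRep E ctr V R S' σ (s.setReg d x) where
  rep := h.rep.congr hm hp hr
  reg j hjR := by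
    by_cases hjd : j = d
    · simp [hjd, hd]
    · simp [hjd, hj j hjd, h.reg j hjR]
  regV j := by
    simp only [State.setReg_reg]; split_ifs
    · exact hx
    · exact h.regV j
  memV := h.memV

theorem subReg_inj {i j : ℕ} : subReg i = subReg j ↔ i = j := by unfold subReg; omega

theorem runs_moveC {W : ℕ} {coins : ℕ → Bool} {z d b : ℕ} (s : State) (hz : z ≠ b)
    (hb : s.reg b < W) : Runs W coins (moveC z d b) s 2 ((s.setReg z 0).setReg d (s.reg b)) := by
  have h := Runs.seq (Runs.const (W := W) (coins := coins) s z 0 (by omega))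
    (Runs.op (s.setReg z 0) .add d b z (by simpa [BinOp.eval, hz.symm] using hb))
  simpa [moveC, BinOp.eval, hz.symm] using h

/-- Step by step simulation with constant overhead. The expensive instructions are memory accesses,
which take at most `2 + 13 + 2` or `2 + 2 + 13` steps. Every value that the subroutine produces is
below `W ≤ V + 1`, so `V` bounds its registers and its memory throughout, and `V ≤ B` makes them fit
into the arrays of the caller. -/
theorem runs_virtual {E : Env} {V W : ℕ} (hV : V ≤ E.B) (hWV : W ≤ V + 1) {c : Cmd}
    {s s' : State} {t : ℕ} (h : Runs W (fun _ => false) c s t s') (R : ℕ) (hR : c.regBound ≤ R)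
    (ctr : ℕ) (σ : Store) (S : State) (hS : SubRep E ctr V R S σ s) :
    ∃ t' ≤ 30 * t, ∃ S', Runs E.W E.coins c.virtual S t' S' ∧ SubRep E ctr V R S' σ s' := by
  have small : ∀ {x}, x ≤ V → x < E.W := fun h => E.small_of_le_B (h.trans hV)
  induction h generalizing S with
  | skip s => exact ⟨1, by norm_num, S, Runs.skip _, hS⟩
  | const s d k hk =>
    refine ⟨1, by norm_num, _, Runs.const _ _ _ (small (by omega)),
      hS.setReg (by omega) rfl rfl ?_ (by simp) fun j hj => by simp [subReg_inj, hj]⟩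
    intro r hr
    have : ¬ r = subReg d := by unfold subReg; omega
    simp [this]
  | op s o d a b hk =>
    have ha : S.reg (subReg a) = s.reg a := hS.reg a (by simp only [Cmd.regBound] at hR; omega)
    have hb : S.reg (subReg b) = s.reg b := hS.reg b (by simp only [Cmd.regBound] at hR; omega)
    refine ⟨1, by norm_num, _, Runs.op _ _ _ _ _ (by rw [ha, hb]; exact small (by omega)),
      hS.setReg (by omega) rfl rfl ?_ (by simp [ha, hb]) fun j hj => by simp [subReg_inj, hj]⟩
    intro r hr
    have : ¬ r = subReg d := by unfold subReg; omega
    simp [this]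
  | coin s d =>
    refine ⟨1, by norm_num, _, Runs.const _ _ _ (small (Nat.zero_le _)), ?_⟩
    have := hS.setReg (S' := S.setReg (subReg d) 0) (d := d) (x := 0) (Nat.zero_le _) rfl rfl ?_
      (by simp) fun j hj => by simp [subReg_inj, hj]
    · exact ⟨this.rep, this.reg, this.regV, this.memV⟩
    · intro r hr
      have : ¬ r = subReg d := by unfold subReg; omega
      simp [this]
  | load s d a =>
    have ha : S.reg (subReg a) = s.reg a := hS.reg a (by simp only [Cmd.regBound] at hR; omega)
    have n4 : ∀ j, subReg j ≠ 4 ∧ subReg j ≠ 0 := by unfold subReg; omega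
    have r₁ := runs_moveC (W := E.W) (coins := E.coins) (z := 4) (d := 0) S (n4 a).1.symm
      (small (by rw [ha]; exact hS.regV a))
    have q₁ : TempEq 0 S ((S.setReg 4 0).setReg 0 (S.reg (subReg a))) := by
      refine ⟨rfl, rfl, fun r hr => ?_⟩
      have : ¬ r = 4 := by omega
      have : ¬ r = 0 := by omega
      simp [*]
    obtain ⟨t₂, ht₂, S₂, r₂, v₂, q₂⟩ := runs_readC .vm (k := 0) (hS.rep.tempEq q₁) (by
      simp only [mul_zero, State.setReg_reg, if_true, ha]
      exact ((hS.regV a).trans hV).trans (E.B_le (by norm_num)))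
    have v₂' : S₂.reg 0 = s.mem (s.reg a) := by simpa [ha] using v₂
    have q := q₁.trans q₂
    refine ⟨_, ?_, _, Runs.seq r₁ (Runs.seq r₂ (runs_moveC (z := 4) S₂ (by norm_num) ?_)),
      hS.setReg ?_ ?_ ?_ ?_ ?_ ?_⟩
    · norm_num; omega
    · rw [v₂']; exact small (hS.memV _)
    · exact hS.memV _
    · simp [q.mem]
    · simp [q.pos]
    · intro r hr
      have : ¬ r = subReg d := by unfold subReg; omega
      have : ¬ r = 4 := by omega
      have := q.reg r (by omega)
      simp [*]
    · simp [v₂']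
    · intro j hj
      have := q.reg (subReg j) (by unfold subReg; omega)
      simp [subReg_inj, hj, n4, this]
  | store s a b =>
    have ha : S.reg (subReg a) = s.reg a := hS.reg a (by simp only [Cmd.regBound] at hR; omega)
    have hb : S.reg (subReg b) = s.reg b := hS.reg b (by simp only [Cmd.regBound] at hR; omega)
    have n4 : ∀ j, subReg j ≠ 4 ∧ subReg j ≠ 0 ∧ subReg j ≠ 8 := by unfold subReg; omega
    have r₁ := runs_moveC (W := E.W) (coins := E.coins) (z := 4) (d := 0) S (n4 a).1.symm
      (small (by rw [ha]; exact hS.regV a))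
    have eb : ((S.setReg 4 0).setReg 0 (S.reg (subReg a))).reg (subReg b) = s.reg b := by
      simp [n4, hb]
    have r₂ := runs_moveC (W := E.W) (coins := E.coins) (z := 8) (d := 4)
      ((S.setReg 4 0).setReg 0 (S.reg (subReg a))) (n4 b).2.2.symm
      (small (by rw [eb]; exact hS.regV b))
    rw [eb, ha] at r₂
    rw [ha] at r₁
    set S₂ := (((S.setReg 4 0).setReg 0 (s.reg a)).setReg 8 0).setReg 4 (s.reg b) with hS₂
    have q₂ : TempEq 0 S S₂ := by
      refine ⟨rfl, rfl, fun r hr => ?_⟩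
      have : ¬ r = 4 := by omega
      have : ¬ r = 0 := by omega
      have : ¬ r = 8 := by omega
      simp [S₂, *]
    have e0 : S₂.reg 0 = s.reg a := by simp [S₂]
    have e4 : S₂.reg 4 = s.reg b := by simp [S₂]
    obtain ⟨t₃, ht₃, S₃, r₃, h₃, g₃⟩ := runs_writeC .vm (hS.rep.tempEq q₂)
      (by rw [e0]; exact ((hS.regV a).trans hV).trans (E.B_le (by norm_num)))
      (by rw [e4]; exact (hS.regV b).trans hV) (by simp)
    refine ⟨_, ?_, S₃, Runs.seq r₁ (Runs.seq r₂ r₃), ?_, ?_, hS.regV, ?_⟩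
    · omega
    · have : (σ.setA .vm s.mem).setA .vm (Function.update ((σ.setA .vm s.mem).a .vm) (S₂.reg 0)
          (S₂.reg 4)) = σ.setA .vm (s.setMem (s.reg a) (s.reg b)).mem := by
        rw [e0, e4]; simp [Store.setA, State.setMem]
      rw [← this]; exact h₃
    · intro j hj
      rw [g₃ _ (by unfold subReg; omega), q₂.reg _ (by unfold subReg; omega), hS.reg j hj]; rfl
    · exact update_le hS.memV (hS.regV b)
  | seq h₁ h₂ ih₁ ih₂ =>
    simp only [Cmd.regBound] at hR
    obtain ⟨t₁, ht₁, S₁, r₁, g₁⟩ := ih₁ (by omega) S hS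
    obtain ⟨t₂, ht₂, S₂, r₂, g₂⟩ := ih₂ (by omega) S₁ g₁
    exact ⟨_, by omega, S₂, Runs.seq r₁ r₂, g₂⟩
  | ite_true ha h ih =>
    simp only [Cmd.regBound] at hR
    obtain ⟨t₁, ht₁, S₁, r₁, g₁⟩ := ih (by omega) S hS
    exact ⟨_, by omega, S₁, Runs.ite_true (by rw [hS.reg _ (by omega)]; exact ha) r₁, g₁⟩
  | ite_false ha h ih =>
    simp only [Cmd.regBound] at hR
    obtain ⟨t₁, ht₁, S₁, r₁, g₁⟩ := ih (by omega) S hS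
    exact ⟨_, by omega, S₁, Runs.ite_false (by rw [hS.reg _ (by omega)]; exact ha) r₁, g₁⟩
  | while_done ha =>
    simp only [Cmd.regBound] at hR
    exact ⟨1, by norm_num, S, Runs.while_done (by rw [hS.reg _ (by omega)]; exact ha), hS⟩
  | while_step ha h₁ h₂ ih₁ ih₂ =>
    have hR' := hR
    simp only [Cmd.regBound] at hR'
    obtain ⟨t₁, ht₁, S₁, r₁, g₁⟩ := ih₁ (by omega) S hS
    obtain ⟨t₂, ht₂, S₂, r₂, g₂⟩ := ih₂ hR S₁ g₁
    exact ⟨_, by omega, S₂,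
      Runs.while_step (by rw [hS.reg _ (by omega)]; exact ha) r₁ r₂, g₂⟩

theorem runs_zeroRegs {W : ℕ} (hW : 0 < W) (coins : ℕ → Bool) (R : ℕ) (s : State) :
    ∃ s', Runs W coins (zeroRegs R) s (R + 1) s' ∧ s'.mem = s.mem ∧ s'.pos = s.pos ∧
      (∀ j < R, s'.reg (subReg j) = 0) ∧ ∀ r, r % 4 ≠ 3 → s'.reg r = s.reg r := by
  induction R with
  | zero => exact ⟨s, Runs.skip s, rfl, rfl, by simp, by simp⟩
  | succ R ih =>
    obtain ⟨s', r, hm, hp, hz, hr⟩ := ih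
    refine ⟨_, Runs.seq r (Runs.const _ _ _ hW), hm, hp, fun j hj => ?_, fun k hk => ?_⟩
    · simp only [State.setReg_reg, subReg_inj]
      split_ifs
      · rfl
      · exact hz j (by omega)
    · have : ¬ k = subReg R := by unfold subReg; omega
      simp [this, hr k hk]

theorem Tri.callC {E : Env} {σ : Store} {c : Cmd} {V W t : ℕ} {Q : Store → Prop} {s' : State}
    {input : List ℕ} (hV : V ≤ E.B) (hWV : W ≤ V + 1) (hi : ∀ i, input.getD i 0 ≤ V)
    (h : Runs W (fun _ => false) c (init input) t s')
    (hvm : σ.a .vm = fun i => input.getD i 0) (hQ : Q (σ.setA .vm s'.mem)) :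
    Tri E (callC c) σ (30 * t + c.regBound + 1) Q := by
  intro ctr S hS hb
  obtain ⟨S₁, r₁, hm, hp, hz, hr⟩ := runs_zeroRegs (E.small (Nat.zero_le _)) E.coins c.regBound S
  have e : σ.setA .vm (init input).mem = σ := by
    cases σ; simp only [Store.setA] at hvm ⊢; simp only [init, ← hvm]; simp
  obtain ⟨t', ht', S₂, r₂, g⟩ := runs_virtual hV hWV h c.regBound le_rfl ctr σ S₁
    ⟨by rw [e]; exact hS.congr hm hp fun r h => hr r (by omega), fun j hj => by rw [hz j hj]; rfl,
      fun j => Nat.zero_le _, hi⟩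
  exact ⟨_, by omega, S₂, ctr, _, Runs.seq r₁ r₂, by omega, g.rep, hQ⟩

end WordRAM


namespace WordRAM

/-! ### Matrix multiplication as a subroutine -/

/-- The program `c` multiplies `n × n` matrices over `𝔽₂` in at most `T n` steps on words of
`κ log₂ (n + 2)` bits, if all coin tosses show `0`. -/
def MatMulBy (c : Cmd) (κ : ℕ) (T : ℕ → ℕ) : Prop :=
  ∀ (n : ℕ) (A B : Matrix (Fin n) (Fin n) (ZMod 2)), ∃ t ≤ T n, ∃ s' : State,
    Runs (wordBound κ n) (fun _ => false) c (init (n :: (matBits A ++ matBits B))) t s' ∧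
    ∀ i j : Fin n, s'.mem (i * n + j) = ((A * B) i j).val

theorem bits_getD {n : ℕ} (v : Fin n → ZMod 2) (i : ℕ) :
    (bits v).getD i 0 = if h : i < n then (v ⟨i, h⟩).val else 0 := by
  unfold bits
  by_cases h : i < n
  · simp [h, List.getD_eq_getElem?_getD]
  · simp [h, List.getD_eq_getElem?_getD]

theorem bits_length {n : ℕ} (v : Fin n → ZMod 2) : (bits v).length = n := by simp [bits]

theorem matBits_eq {k n : ℕ} (A : Matrix (Fin k) (Fin n) (ZMod 2)) :
    matBits A = bits fun q : Fin (k * n) => A q.divNat q.modNat := by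
  unfold matBits bits
  rw [List.ofFn_mul]
  congr 2
  funext i
  congr 1
  funext j
  congr 2
  · ext; simp [Fin.divNat, Nat.add_div_of_dvd_right, Nat.div_eq_of_lt j.2, j.pos]
  · ext; simp [Fin.modNat, Nat.mod_eq_of_lt j.2]

theorem matBits_getD {k n : ℕ} (A : Matrix (Fin k) (Fin n) (ZMod 2)) (i : ℕ) :
    (matBits A).getD i 0 = if h : i < k * n then
      (A (Fin.divNat ⟨i, h⟩) (Fin.modNat ⟨i, h⟩)).val else 0 := by
  rw [matBits_eq, bits_getD]

theorem matBits_length {k n : ℕ} (A : Matrix (Fin k) (Fin n) (ZMod 2)) :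
    (matBits A).length = k * n := by rw [matBits_eq, bits_length]

theorem getD_append' (l₁ l₂ : List ℕ) (i : ℕ) :
    (l₁ ++ l₂).getD i 0 = if i < l₁.length then l₁.getD i 0 else l₂.getD (i - l₁.length) 0 := by
  split_ifs with h
  · exact List.getD_append _ _ _ _ h
  · exact List.getD_append_right _ _ _ _ (not_lt.1 h)

theorem val_natCast_two (a : ℕ) : ((a : ZMod 2)).val = a % 2 := ZMod.val_natCast 2 a

/-- Multiplication of two `w × w` matrices that have been written to the virtual memory. -/
theorem Tri.matMul {E : Env} {σ : Store} {c : Cmd} {κ w : ℕ} {T : ℕ → ℕ} {Q : Store → Prop}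
    (hc : MatMulBy c κ T) (hB : (w + 2) ^ (κ + 1) ≤ E.B) (X Y : ℕ → ℕ)
    (h0 : σ.a .vm 0 = w) (hX : ∀ q < w * w, σ.a .vm (1 + q) = X q % 2)
    (hY : ∀ q < w * w, σ.a .vm (1 + w * w + q) = Y q % 2)
    (hz : ∀ q, 1 + 2 * (w * w) ≤ q → σ.a .vm q = 0)
    (hQ : ∀ h : ℕ → ℕ, (∀ i < w, ∀ j < w, (h (i * w + j) : ZMod 2) =
      ∑ k ∈ Finset.range w, (X (i * w + k) : ZMod 2) * Y (k * w + j)) → Q (σ.setA .vm h)) :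
    Tri E (WordRAM.callC c) σ (30 * T w + c.regBound + 1) Q := by
  obtain ⟨t, ht, s', hr, hs⟩ := hc w (.of fun i j => (X (i * w + j) : ZMod 2))
    (.of fun i j => (Y (i * w + j) : ZMod 2))
  have hp : (w + 2) ^ (κ + 1) = (w + 2) ^ κ * w + 2 * (w + 2) ^ κ := by ring
  have h1 : 1 ≤ (w + 2) ^ κ := Nat.one_le_pow _ _ (by omega)
  have h2 : w ≤ (w + 2) ^ κ * w := Nat.le_mul_of_pos_left _ (by omega)
  have hvm : σ.a .vm = fun i => (w :: (matBits (.of fun i j : Fin w => (X (i * w + j) : ZMod 2)) ++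
      matBits (.of fun i j : Fin w => (Y (i * w + j) : ZMod 2)))).getD i 0 := by
    funext i
    rcases i with _ | i
    · simpa using h0
    · rw [List.getD_cons_succ, getD_append', matBits_getD, matBits_getD, matBits_length]
      split_ifs with h3 h4
      · simp only [Matrix.of_apply, val_natCast_two, Fin.coe_divNat, Fin.coe_modNat]
        rw [add_comm, hX i h3, Nat.div_add_mod']
      · simp only [Matrix.of_apply, val_natCast_two, Fin.coe_divNat, Fin.coe_modNat]
        rw [Nat.div_add_mod', ← hY _ h4]; congr 1; omega
      · exact hz _ (by omega)
  -- The exponent `κ + 1` instead of `κ` makes the bound cover the size `w` itself, an input word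
  -- that may exceed the word bound if `κ = 0`.
  refine (callC (V := (w + 2) ^ (κ + 1)) hB ?_ ?_ hr hvm (hQ _ ?_)).time (by omega)
  · unfold wordBound; omega
  · intro i
    rw [← congrFun hvm i]
    rcases Nat.eq_zero_or_pos i with rfl | hi
    · omega
    · by_cases h3 : i < 1 + w * w
      · have := hX (i - 1) (by omega)
        rw [show 1 + (i - 1) = i by omega] at this
        omega
      · by_cases h4 : i < 1 + 2 * (w * w)
        · have := hY (i - (1 + w * w)) (by omega)
          rw [show 1 + w * w + (i - (1 + w * w)) = i by omega] at this
          omega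
        · rw [hz i (by omega)]; omega
  · intro i hi j hj
    have := hs ⟨i, hi⟩ ⟨j, hj⟩
    simp only at this
    rw [this, ZMod.natCast_zmod_val, Matrix.mul_apply, ← Fin.sum_univ_eq_sum_range
      (fun k => (X (i * w + k) : ZMod 2) * Y (k * w + j))]
    rfl

end WordRAM


namespace WordRAM

/-! ### Block multiplication -/

/-- The value of a variable, as an expression. -/
prefix:max "¢" => Expr.var

/-- The stores agree except on some variables and arrays. -/
structure Same (xs : List Var) (αs : List Arr) (σ σ' : Store) : Prop where
  v : ∀ x, x ∉ xs → σ'.v x = σ.v x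
  a : ∀ α, α ∉ αs → σ'.a α = σ.a α
  pos : σ'.pos = σ.pos

theorem Same.refl (xs : List Var) (αs : List Arr) (σ : Store) : Same xs αs σ σ :=
  ⟨fun _ _ => rfl, fun _ _ => rfl, rfl⟩

theorem Same.trans {xs ys zs : List Var} {αs βs γs : List Arr} {σ₁ σ₂ σ₃ : Store}
    (h₁ : Same xs αs σ₁ σ₂) (h₂ : Same ys βs σ₂ σ₃) (hx : xs ⊆ zs := by simp)
    (hy : ys ⊆ zs := by simp) (hα : αs ⊆ γs := by simp) (hβ : βs ⊆ γs := by simp) :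
    Same zs γs σ₁ σ₃ :=
  ⟨fun x h => (h₂.v x fun h' => h (hy h')).trans (h₁.v x fun h' => h (hx h')),
    fun x h => (h₂.a x fun h' => h (hβ h')).trans (h₁.a x fun h' => h (hα h')),
    h₂.pos.trans h₁.pos⟩

theorem Same.setV {xs : List Var} {αs : List Arr} {σ σ' : Store} (h : Same xs αs σ σ') {x : Var}
    (hx : x ∈ xs) (k : ℕ) : Same xs αs σ (σ'.setV x k) :=
  ⟨fun y hy => by
    have : y ≠ x := fun e => hy (e ▸ hx)
    simp [this, h.v y hy], h.a, h.pos⟩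

theorem Same.setA {xs : List Var} {αs : List Arr} {σ σ' : Store} (h : Same xs αs σ σ') {α : Arr}
    (hα : α ∈ αs) (f : ℕ → ℕ) : Same xs αs σ (σ'.setA α f) :=
  ⟨h.v, fun y hy => by
    have : y ≠ α := fun e => hy (e ▸ hα)
    simp [this, h.a y hy], h.pos⟩

theorem cast_mod_two (a : ℕ) : ((a % 2 : ℕ) : ZMod 2) = a := ZMod.natCast_mod a 2

theorem Env.mod_two_le (E : Env) (a : ℕ) : a % 2 ≤ E.B := by have := E.hB; omega

/-- The number of steps for one block product of `w × w` blocks. -/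
def blkTime (c : Cmd) (T : ℕ → ℕ) (w : ℕ) : ℕ := 30 * T w + c.regBound + 40 * cst * (w * w + 1)

/-- Add the product of the blocks `(ia, ib)` of `px` and `(ib, ic)` of `py` to `acc`. -/
def blkC (c : Cmd) : Cmd :=
  .seq clearVM (.seq (storeA .vm 0 ¢.w)
    (.seq (scatter .q (¢.w * ¢.w) .vm (1 + ¢.q)
      (.rd .px ((¢.ia * ¢.w + ¢.q / ¢.w) * ¢.N + (¢.ib * ¢.w + ¢.q % ¢.w)) % 2))
    (.seq (scatter .q (¢.w * ¢.w) .vm (1 + ¢.w * ¢.w + ¢.q)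
      (.rd .py ((¢.ib * ¢.w + ¢.q / ¢.w) * ¢.N + (¢.ic * ¢.w + ¢.q % ¢.w)) % 2))
    (.seq (callC c) (scatter .q (¢.w * ¢.w) .acc ¢.q ((.rd .acc ¢.q + .rd .vm ¢.q) % 2))))))

/-- The block product of `px` with `ra × rb` blocks and `py` with `rb × rc` blocks. -/
def mulC (c : Cmd) : Cmd :=
  forC .t (¢.ra * ¢.rc) (.seq (assign .ia (¢.t / ¢.rc)) (.seq (assign .ic (¢.t % ¢.rc))
    (.seq (scatter .q (¢.w * ¢.w) .acc ¢.q 0) (.seq (forC .ib ¢.rb (blkC c))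
      (scatter .q (¢.w * ¢.w) .pz ((¢.ia * ¢.w + ¢.q / ¢.w) * ¢.N + (¢.ic * ¢.w + ¢.q % ¢.w))
        (.rd .acc ¢.q % 2))))))

theorem div_mod_block {w i j : ℕ} (hj : j < w) : (i * w + j) / w = i ∧ (i * w + j) % w = j := by
  have hw : 0 < w := by omega
  constructor
  · rw [mul_comm, Nat.mul_add_div hw, Nat.div_eq_of_lt hj, add_zero]
  · rw [mul_comm, Nat.mul_add_mod, Nat.mod_eq_of_lt hj]

/-- The virtual memory is laid out as the input format demands: the size in cell 0, the left block
from cell 1 on, the right block from cell `1 + w * w` on, and zeros behind. This is why it must be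
cleared before each call. -/
theorem Tri.blk {E : Env} {σ : Store} {c : Cmd} {κ w : ℕ} {T : ℕ → ℕ} {Q : Store → Prop}
    (hc : MatMulBy c κ T) (hB : (w + 2) ^ (κ + 1) ≤ E.B) (hw : σ.v .w = w) (hwB : w * w ≤ E.B)
    (hQ : ∀ σ', Same [.q] [.vm, .acc] σ σ' → (∀ i < w, ∀ j < w, (σ'.a .acc (i * w + j) : ZMod 2) =
      σ.a .acc (i * w + j) + ∑ k ∈ Finset.range w,
        (σ.a .px ((σ.v .ia * w + i) * σ.v .N + (σ.v .ib * w + k)) : ZMod 2) *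
        σ.a .py ((σ.v .ib * w + k) * σ.v .N + (σ.v .ic * w + j))) → Q σ') :
    Tri E (blkC c) σ (30 * T w + c.regBound + 12 * cst * (w * w + 1)) Q := by
  refine bdd fun hv _ => ?_
  have hwle : w ≤ E.B := hw ▸ hv .w
  refine (seq (clearVM (seq (storeA (by simp) (by simp) (by simp) (by simp [hw, hwle])
    (seq (scatter (w * w) (fun q => 1 + q) (fun q => σ.a .px ((σ.v .ia * w + q / w) * σ.v .N +
        (σ.v .ib * w + q % w)) % 2)
      (by simp) (by simp) (by simp) hwB (by simp) (by simp [hw]) (by simp)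
      (by simp) (by simp [hw]) (fun _ _ => E.mod_two_le _) fun f₁ h₁ h₁' =>
    seq (scatter (w * w) (fun q => 1 + w * w + q) (fun q => σ.a .py ((σ.v .ib * w + q / w) * σ.v .N +
        (σ.v .ic * w + q % w)) % 2)
      (by simp) (by simp) (by simp) hwB (by simp) (by simp [hw]) (by simp)
      (by simp [hw]) (by simp [hw]) (fun _ _ => E.mod_two_le _) fun f₂ h₂ h₂' =>
    seq (Tri.matMul hc hB (fun q => σ.a .px ((σ.v .ia * w + q / w) * σ.v .N +
        (σ.v .ib * w + q % w))) (fun q => σ.a .py ((σ.v .ib * w + q / w) * σ.v .N +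
        (σ.v .ic * w + q % w))) ?_ ?_ ?_ ?_ fun f₃ h₃ =>
      scatter (w * w) id (fun q => (σ.a .acc q + f₃ q) % 2)
        (by simp) (by simp) (by simp) hwB (by simp) (by simp [hw]) (by simp) (by simp)
        ?_ (fun _ _ => E.mod_two_le _) fun f₄ h₄ _ => hQ _ ?_ ?_)))))))).time ?_
  · simp only [Store.setA_a, if_true]
    rw [h₂' 0 (by omega)]
    simp only [Store.setA_a, if_true]
    rw [h₁' 0 (by omega)]
    simp [hw]
  · intro q hq
    simp only [Store.setA_a, if_true]
    rw [h₂' _ (by omega)]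
    simp only [Store.setA_a, if_true]
    rw [h₁ q hq]
  · intro q hq
    simp only [Store.setA_a, if_true]
    rw [h₂ q hq]
  · intro q hq
    simp only [Store.setA_a, if_true]
    rw [h₂' _ (by omega)]
    simp only [Store.setA_a, if_true]
    rw [h₁' _ (by omega)]
    have : q ≠ 0 := by omega
    simp [this]
  · intro i hi h hh _
    simp only [id, Store.setA_a, Store.setV_a] at hh
    simp at hh
    simp [hh]
  · constructor
    · intro x hx
      simp at hx
      simp [hx]
    · intro x hx
      simp at hx
      simp [hx]
    · simp
  · intro i hi j hj
    have hij : i * w + j < w * w := by nlinarith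
    simp only [Store.setA_a, if_true]
    rw [← id_eq (i * w + j), h₄ _ hij, cast_mod_two]
    simp only [id]
    push_cast
    rw [h₃ i hi j hj]
    congr 1
    refine Finset.sum_congr rfl fun k hk => ?_
    have hk' := Finset.mem_range.1 hk
    rw [(div_mod_block hk').1, (div_mod_block hk').2, (div_mod_block hj).1, (div_mod_block hj).2]
  · unfold cst; ring_nf; omega

end WordRAM


namespace WordRAM

theorem index_inj {N r c r' c' : ℕ} (hc : c < N) (hc' : c' < N) :
    r * N + c = r' * N + c' ↔ r = r' ∧ c = c' := by
  constructor
  · intro h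
    have h1 := congrArg (· / N) h
    have h2 := congrArg (· % N) h
    simp only [(div_mod_block hc).1, (div_mod_block hc').1, (div_mod_block hc).2,
      (div_mod_block hc').2] at h1 h2
    exact ⟨h1, h2⟩
  · rintro ⟨rfl, rfl⟩; rfl

theorem div_lt_of_lt_mul' {q a b : ℕ} (h : q < a * b) : q / b < a :=
  Nat.div_lt_of_lt_mul (by rwa [mul_comm])

theorem mod_lt_of_lt_mul {q a b : ℕ} (h : q < a * b) : q % b < b :=
  Nat.mod_lt _ (Nat.pos_of_ne_zero fun h0 => by simp [h0] at h)

theorem index_lt {r c a b : ℕ} (hr : r < a) (hc : c < b) : r * b + c < a * b := by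
  have : (r + 1) * b ≤ a * b := Nat.mul_le_mul_right b hr
  rw [add_mul, one_mul] at this; omega

/-- Scattering a rectangle with rows of length `w` into an array with rows of length `N`. -/
theorem rect_inj {N w R a b : ℕ} (hb : b + w ≤ N) (i : ℕ) (hi : i < R * w) (j : ℕ) (hj : j < R * w)
    (h : (a + i / w) * N + (b + i % w) = (a + j / w) * N + (b + j % w)) : i = j := by
  have h1 := mod_lt_of_lt_mul hi
  have h2 := mod_lt_of_lt_mul hj
  obtain ⟨h3, h4⟩ := (index_inj (by omega) (by omega)).1 h
  rw [← Nat.div_add_mod' i w, ← Nat.div_add_mod' j w, show i / w = j / w by omega,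
    show i % w = j % w by omega]

theorem succ_mul_le {i a w : ℕ} (h : i < a) : i * w + w ≤ a * w := by
  rw [← Nat.succ_mul]; exact Nat.mul_le_mul_right w h

/-- The schoolbook product of block matrices. The blocks of the result are numbered row by row, and
the invariant of the outer loop is that the blocks with numbers below the counter are finished. The
inner loop accumulates the sum over the middle index, one block at a time. -/
theorem Tri.mul {E : Env} {σ : Store} {c : Cmd} {κ N w ra rb rc : ℕ} {T : ℕ → ℕ}
    {Q : Store → Prop} (hc : MatMulBy c κ T) (hB : (N + 2) ^ (κ + 1) ≤ E.B) (hNB : N * N ≤ E.B)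
    (hN : σ.v .N = N) (hw : σ.v .w = w) (hra : σ.v .ra = ra) (hrb : σ.v .rb = rb)
    (hrc : σ.v .rc = rc) (h1w : 1 ≤ w) (h1a : 1 ≤ ra) (h1b : 1 ≤ rb)
    (haN : ra * w ≤ N) (hbN : rb * w ≤ N) (hcN : rc * w ≤ N)
    (hQ : ∀ σ', Same [.t, .ia, .ic, .ib, .q] [.vm, .acc, .pz] σ σ' →
      (∀ r < ra * w, ∀ c < rc * w, (σ'.a .pz (r * N + c) : ZMod 2) =
        ∑ k ∈ Finset.range (rb * w), (σ.a .px (r * N + k) : ZMod 2) * σ.a .py (k * N + c)) →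
      Q σ') :
    Tri E (mulC c) σ (ra * rc * rb * blkTime c T w + 3 * cst) Q := by
  have hwN : w ≤ N := (Nat.le_mul_of_pos_left w h1a).trans haN
  have haN' : ra ≤ N := (Nat.le_mul_of_pos_right _ h1w).trans haN
  have hbN' : rb ≤ N := (Nat.le_mul_of_pos_right _ h1w).trans hbN
  have hcN' : rc ≤ N := (Nat.le_mul_of_pos_right _ h1w).trans hcN
  have hwwB : w * w ≤ E.B := (Nat.mul_le_mul hwN hwN).trans hNB
  have hwB : (w + 2) ^ (κ + 1) ≤ E.B := (Nat.pow_le_pow_left (by omega) _).trans hB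
  have hNB' : N ≤ E.B := (Nat.le_mul_self N).trans hNB
  refine (forC (m := ra * rc) (τ := (rb * (30 * T w + c.regBound + 12 * cst * (w * w + 1) + 2 * cst)
      + 2 * cst) + 6 * cst * (w * w + 1) + 2 * cst)
    (fun i σ' => σ'.v .t = i ∧ Same [.t, .ia, .ic, .ib, .q] [.vm, .acc, .pz] σ σ' ∧
      ∀ r < ra * w, ∀ c < rc * w, r / w * rc + c / w < i → (σ'.a .pz (r * N + c) : ZMod 2) =
        ∑ k ∈ Finset.range (rb * w), (σ.a .px (r * N + k) : ZMod 2) * σ.a .py (k * N + c))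
    (by simp) ((Nat.mul_le_mul haN' hcN').trans hNB) ?_ ?_ ?_ ?_).time ?_
  · rintro i hi σ' ⟨h1, h2, -⟩
    refine ⟨h1, ?_⟩
    simp [h2.v .ra (by decide), h2.v .rc (by decide), hra, hrc]
  · exact ⟨by simp, (Same.refl _ _ _).setV (by simp) _, by simp⟩
  · rintro i hi σ' ⟨ht, hS, hP⟩
    have eN : σ'.v .N = N := (hS.v .N (by decide)).trans hN
    have ew : σ'.v .w = w := (hS.v .w (by decide)).trans hw
    have eb : σ'.v .rb = rb := (hS.v .rb (by decide)).trans hrb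
    have ec : σ'.v .rc = rc := (hS.v .rc (by decide)).trans hrc
    have ex : σ'.a .px = σ.a .px := hS.a .px (by decide)
    have ey : σ'.a .py = σ.a .py := hS.a .py (by decide)
    have ha : i / rc < ra := div_lt_of_lt_mul' hi
    have hcc : i % rc < rc := mod_lt_of_lt_mul hi
    have haw : i / rc * w + w ≤ ra * w := succ_mul_le ha
    have hcw : i % rc * w + w ≤ rc * w := succ_mul_le hcc
    refine (seq (t₁ := cst) (t₂ := cst + ((w * w + 1) * (3 * cst) +
      ((rb * (30 * T w + c.regBound + 12 * cst * (w * w + 1) + 2 * cst) + 2 * cst) +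
      (w * w + 1) * (3 * cst)))) (assign (by simp) ?_ ?_)).time ?_
    rotate_left
    refine seq (assign (by simp) ?_ ?_)
    rotate_left
    refine seq (scatter (w * w) id (fun _ => 0)
      (by simp) (by simp) (by simp) hwwB (by simp) (by simp [ew]) (by simp) (by simp) (by simp)
      (by simp) fun f₀ hf₀ _ => ?_)
    -- After `j` rounds, `acc` holds the part of the sum over the first `j * w` middle indices.
    refine seq (forC (m := rb) (fun j σ'' => σ''.v .ib = j ∧
        σ''.v .ia = i / rc ∧ σ''.v .ic = i % rc ∧ σ''.v .t = i ∧
        Same [.t, .ia, .ic, .ib, .q] [.vm, .acc] σ' σ'' ∧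
        ∀ r < w, ∀ c < w, (σ''.a .acc (r * w + c) : ZMod 2) = ∑ k ∈ Finset.range (j * w),
          (σ.a .px ((i / rc * w + r) * N + k) : ZMod 2) * σ.a .py (k * N + (i % rc * w + c)))
      (by simp) (hbN'.trans hNB') ?_ ?_ ?_ fun σ₁ hσ₁ => ?_)
    rotate_left 3
    refine scatter (w * w)
        (fun q => (i / rc * w + q / w) * N + (i % rc * w + q % w)) (fun q => σ₁.a .acc q % 2)
        (by simp) (by simp) (by simp) hwwB (by simp) ?_ ?_ ?_ ?_ (fun _ _ => E.mod_two_le _)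
        fun f hf hf' => ?_
    rotate_right 3
    rotate_right 2
    · simp only [Expr.eval_div, Expr.eval_var, ht, ec]
      exact (Nat.div_le_self _ _).trans (hi.le.trans ((Nat.mul_le_mul haN' hcN').trans hNB))
    · simp only [Expr.eval_mod, Expr.eval_var, ht, ec, Store.setV_v]
      simp only [reduceCtorEq, if_false]
      exact (Nat.mod_le _ _).trans (hi.le.trans ((Nat.mul_le_mul haN' hcN').trans hNB))
    · rintro j hj σ'' ⟨h1, -, -, -, h2, -⟩
      exact ⟨h1, by simp [h2.v .rb, eb]⟩
    · refine ⟨by simp, by simp [ht, ec], by simp [ht, ec], by simp [ht], ?_, ?_⟩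
      · exact ((((((Same.refl _ _ _).setV (by simp) _).setV (by simp) _).setV (by simp) _).setA
          (by simp) _).setV (by simp) _)
      · intro r hr c' hc'
        have := hf₀ (r * w + c') (index_lt hr hc')
        simp only [id] at this
        simp [this]
    · rintro j hj σ'' ⟨h1, h2, h3, h4, h5, h6⟩
      have eN' : σ''.v .N = N := (h5.v .N (by decide)).trans eN
      refine blk hc hwB ((h5.v .w (by decide)).trans ew) hwwB fun σ₂ hσ₂ hp => ?_
      refine ⟨by simp [hσ₂.v .ib, h1], by simp, by simp [hσ₂.v .ia, h2], by simp [hσ₂.v .ic, h3],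
        by simp [hσ₂.v .t, h4], (h5.trans hσ₂).setV (by simp) _, ?_⟩
      intro r hr c' hc'
      simp only [Store.setV_a]
      rw [hp r hr c' hc', h6 r hr c' hc', Nat.add_one_mul, Finset.sum_range_add, h1, h2, h3, eN',
        h5.a .px (by decide), h5.a .py (by decide), ex, ey]
    · obtain ⟨h1, h2, h3, h4, h5, h6⟩ := hσ₁
      simp [h5.v .w, ew]
    · intro q hq q' hq' h
      exact rect_inj (R := w) (by omega) q hq q' hq' h
    · obtain ⟨h1, h2, h3, h4, h5, h6⟩ := hσ₁
      simp [h2, h3, h5.v .w, h5.v .N, ew, eN]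
    · simp
    · obtain ⟨h1, h2, h3, h4, h5, h6⟩ := hσ₁
      refine ⟨by simp [h4], by simp, ?_, ?_⟩
      · exact (((hS.trans h5).setV (by simp) _).setA (by simp) _).setV (by simp) _
      · intro r hr c' hc' hlt
        simp only [Store.setV_a, Store.setA_a, if_true]
        have hdr : r / w < ra := div_lt_of_lt_mul' hr
        have hdc : c' / w < rc := div_lt_of_lt_mul' hc'
        have hmr : r % w < w := Nat.mod_lt _ (by omega)
        have hmc : c' % w < w := Nat.mod_lt _ (by omega)
        have er := Nat.div_add_mod' r w
        have ecc := Nat.div_add_mod' c' w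
        -- An entry lies either in the block written just now or in an earlier block, which the last
        -- loop does not touch.
        by_cases hEq : r / w * rc + c' / w = i
        · have hd : i / rc = r / w ∧ i % rc = c' / w := by rw [← hEq]; exact div_mod_block hdc
          have := hf (r % w * w + c' % w) (index_lt hmr hmc)
          simp only [(div_mod_block hmc).1, (div_mod_block hmc).2, hd.1, hd.2, er, ecc] at this
          rw [this, cast_mod_two, h6 _ hmr _ hmc, hd.1, hd.2, er, ecc]
        · rw [hf' (r * N + c') ?_]
          · rw [h5.a .pz (by decide)]
            exact hP r hr c' hc' (by omega)
          · intro q hq h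
            have hq1 := div_lt_of_lt_mul' hq
            have hq2 := mod_lt_of_lt_mul hq
            obtain ⟨h7, h8⟩ := (index_inj (by omega) (by omega)).1 h
            apply hEq
            rw [← h7, ← h8, (div_mod_block hq1).1, (div_mod_block hq2).1]
            exact Nat.div_add_mod' i rc
    · ring_nf; omega
  · rintro σ' ⟨-, hS, hP⟩
    refine hQ σ' hS fun r hr c' hc' => hP r hr c' hc' ?_
    exact index_lt (div_lt_of_lt_mul' hr) (div_lt_of_lt_mul' hc')
  · have h2 : ra * rc ≤ ra * rc * rb := Nat.le_mul_of_pos_right _ h1b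
    have key : rb * (30 * T w + c.regBound + 12 * cst * (w * w + 1) + 2 * cst) + 2 * cst +
        6 * cst * (w * w + 1) + 2 * cst + 2 * cst ≤ rb * blkTime c T w := by
      have e : rb * blkTime c T w = rb * (30 * T w + c.regBound + 12 * cst * (w * w + 1) + 2 * cst)
          + rb * (28 * cst * (w * w) + 26 * cst) := by unfold blkTime; ring
      have h4 : 28 * cst * (w * w) + 26 * cst ≤ rb * (28 * cst * (w * w) + 26 * cst) :=
        Nat.le_mul_of_pos_left _ h1b
      rw [e]
      ring_nf at h4 ⊢
      omega
    calc _ ≤ ra * rc * (rb * blkTime c T w) + 2 * cst := by gcongr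
      _ ≤ _ := by rw [← mul_assoc]; omega

end WordRAM


/-! ### Generalized inverses by halving the columns -/

/-- Generalized inverses of `a` and of the residue of `b` yield a generalized inverse of `a + b`. -/
theorem ginv_combine {R : Type*} [Ring R] (h2 : ∀ x : R, x + x = 0) {a b g h y H : R}
    (ha : a * g * a = a) (hy : y = b + a * g * b) (hh : y * h * y = y) (hH : H = h + h * a * g) :
    (a * (g + g * b * H) + b * H) * (a + b) = a + b := by
  -- In characteristic two, `y = (1 + a g) b` is `b` reduced modulo the columns of `a`, and `H = h
  -- (1 + a g)`. Therefore `H a = 0` because `a g a = a`, and `y H b = y h y = y`. The product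
  -- splits accordingly into `a g a + y H a = a` and `a g b + y H b = b`.
  have e1 : a * (g + g * b * H) + b * H = a * g + y * H := by rw [hy]; noncomm_ring
  have e2 : y * H * a = 0 := by
    have : y * H * a = y * h * a + y * h * (a * g * a) := by rw [hH]; noncomm_ring
    rw [this, ha, h2]
  have e3 : y * H * b = y := by
    have : y * H * b = y * h * (b + a * g * b) := by rw [hH]; noncomm_ring
    rw [this, ← hy, hh]
  have e4 : a * g * b + y = b := by
    rw [hy, add_comm b, ← add_assoc, h2, zero_add]
  calc (a * (g + g * b * H) + b * H) * (a + b)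
      = a * g * a + y * H * a + (a * g * b + y * H * b) := by rw [e1]; noncomm_ring
    _ = a + b := by rw [ha, e2, e3, e4, add_zero]

namespace WordRAM

/-- The `N × N` matrix over `𝔽₂` that is stored row by row. -/
def mat (N : ℕ) (f : ℕ → ℕ) : Matrix (Fin N) (Fin N) (ZMod 2) :=
  .of fun r c => (f (r * N + c) : ZMod 2)

/-- The projection to the coordinates of the `i`-th block of length `w`. -/
def blockProj (N w i : ℕ) : Matrix (Fin N) (Fin N) (ZMod 2) :=
  Matrix.diagonal fun c => if (c : ℕ) / w = i then 1 else 0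

theorem mat_add_self {N : ℕ} (A : Matrix (Fin N) (Fin N) (ZMod 2)) : A + A = 0 := by
  ext i j; simp [CharTwo.add_self_eq_zero]

theorem blockProj_mul_self (N w i : ℕ) : blockProj N w i * blockProj N w i = blockProj N w i := by
  simp [blockProj, Matrix.diagonal_mul_diagonal]

theorem blockProj_mul_of_ne (N w : ℕ) {i j : ℕ} (h : i ≠ j) :
    blockProj N w i * blockProj N w j = 0 := by
  simp only [blockProj, Matrix.diagonal_mul_diagonal, mul_ite, mul_one, mul_zero]
  ext a b
  by_cases hab : a = b
  · subst hab
    simp only [Matrix.diagonal_apply_eq, Matrix.zero_apply]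
    split_ifs with h1 h2
    · exact absurd (h2.symm.trans h1) h
    · rfl
    · rfl
  · simp [hab]

theorem blockProj_double (N w i : ℕ) :
    blockProj N (2 * w) i = blockProj N w (2 * i) + blockProj N w (2 * i + 1) := by
  rw [blockProj, blockProj, blockProj, Matrix.diagonal_add]
  congr 1
  funext c
  have : (c : ℕ) / (2 * w) = c / w / 2 := by rw [mul_comm, Nat.div_div_eq_div_mul]
  rw [this]
  generalize (c : ℕ) / w = x
  rcases Nat.even_or_odd' x with ⟨k, rfl | rfl⟩
  · have h1 : ¬ 2 * k = 2 * i + 1 := by omega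
    have h2 : 2 * k / 2 = k := by omega
    simp only [h1, h2, if_false, add_zero]
    congr 1; simp
  · have h1 : ¬ 2 * k + 1 = 2 * i := by omega
    have h2 : (2 * k + 1) / 2 = k := by omega
    simp only [h1, h2, if_false, zero_add]
    congr 1; simp

theorem blockProj_zero (N : ℕ) : blockProj N N 0 = 1 := by
  rw [blockProj, ← Matrix.diagonal_one]
  congr 1
  funext c
  simp [Nat.div_eq_of_lt c.2]

theorem sum_fin_eq_range {N : ℕ} {M : Type*} [AddCommMonoid M] (f : ℕ → M) :
    ∑ k : Fin N, f k = ∑ k ∈ Finset.range N, f k := Fin.sum_univ_eq_sum_range f N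

theorem sum_block {N w i : ℕ} {M : Type*} [AddCommMonoid M] (hw : 0 < w) (hi : i * w + w ≤ N) (f : ℕ → M) :
    ∑ k ∈ Finset.range w, f (i * w + k) =
      ∑ k ∈ Finset.range N, if k / w = i then f k else 0 := by
  rw [← Finset.sum_filter]
  refine Finset.sum_bij (fun k _ => i * w + k) ?_ ?_ ?_ ?_
  · intro k hk
    have := Finset.mem_range.1 hk
    simp [(div_mod_block this).1]; omega
  · intro a _ b _ h; omega
  · intro b hb
    simp only [Finset.mem_filter, Finset.mem_range] at hb
    have := Nat.div_add_mod' b w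
    exact ⟨b % w, Finset.mem_range.2 (Nat.mod_lt _ hw), by rw [← hb.2]; exact this⟩
  · simp

/-- The dictionary between the program, which sums over one block of indices, and the algebra, which
inserts a diagonal projection between two full matrices. -/
theorem sum_blockProj {N w i : ℕ} (hw : 0 < w) (hi : i * w + w ≤ N)
    {A B : Matrix (Fin N) (Fin N) (ZMod 2)} {R C : Fin N} {F : ℕ → ZMod 2}
    (hF : ∀ k (hk : k < w), F k = A R ⟨i * w + k, by omega⟩ * B ⟨i * w + k, by omega⟩ C) :
    ∑ k ∈ Finset.range w, F k = (A * (blockProj N w i * B)) R C := by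
  let f : ℕ → ZMod 2 := fun k => if h : k < N then A R ⟨k, h⟩ * B ⟨k, h⟩ C else 0
  have e : ∑ k ∈ Finset.range w, F k = ∑ k ∈ Finset.range w, f (i * w + k) := by
    refine Finset.sum_congr rfl fun k hk => ?_
    have hk' := Finset.mem_range.1 hk
    have : i * w + k < N := by omega
    simp [f, hF k hk', this]
  rw [e, sum_block hw hi, ← sum_fin_eq_range, Matrix.mul_apply]
  refine Finset.sum_congr rfl fun k _ => ?_
  rw [blockProj, Matrix.diagonal_mul]
  split_ifs
  · simp [f]
  · simp

end WordRAM


/-! ### Block operations at a node of the recursion for generalized inverses. -/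

namespace WordRAM

/-- Set the block dimensions. -/
def dims (a b c : Expr) : Cmd := .seq (assign .ra a) (.seq (assign .rb b) (assign .rc c))

/-- Load the block of rows number `x` of `g`. -/
def loadG (α : Arr) (x : Var) : Cmd :=
  scatter .q (¢.w * ¢.N) α ¢.q (.rd .g (¢x * ¢.w * ¢.N + ¢.q) % 2)

/-- Load the block of columns number `x` of the parent level of `xa`. -/
def loadX (α : Arr) (x : Var) : Cmd :=
  scatter .q (¢.N * ¢.w) α (¢.q / ¢.w * ¢.N + ¢.q % ¢.w)
    (.rd .xa ((¢.lev + 1) * (¢.N * ¢.N) + (¢.q / ¢.w * ¢.N + (¢x * ¢.w + ¢.q % ¢.w))) % 2)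

/-- Load the first rows of `pz`. -/
def loadP (α : Arr) : Cmd := scatter .q (¢.w * ¢.N) α ¢.q (.rd .pz ¢.q % 2)

/-- Compute the block `(u, r)` of `G X`. -/
def blockGX (c : Cmd) : Cmd :=
  .seq (loadG .px .u) (.seq (loadX .py .r) (.seq (dims 1 (¢.N / ¢.w) 1) (mulC c)))

/-- Add `G X G` to `G`, for the block of rows `u` of the left factor and the block of rows `r` of
the right factor. -/
def combineC (c : Cmd) : Cmd :=
  .seq (blockGX c) (.seq (loadP .px) (.seq (loadG .py .r) (.seq (dims 1 1 (¢.N / ¢.w))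
    (.seq (mulC c) (scatter .q (¢.w * ¢.N) .g (¢.u * ¢.w * ¢.N + ¢.q)
        ((.rd .g (¢.u * ¢.w * ¢.N + ¢.q) + .rd .pz ¢.q) % 2))))))

/-- Store `X + X G X` one level below, for the block `u` of the rows of `G` and the block `r` of the
columns of the result. -/
def residueC (c : Cmd) : Cmd :=
  .seq (blockGX c) (.seq (loadP .py) (.seq (loadX .px .u) (.seq (dims (¢.N / ¢.w) 1 1)
    (.seq (mulC c) (scatter .q (¢.N * ¢.w) .xa
        (¢.lev * (¢.N * ¢.N) + (¢.q / ¢.w * ¢.N + (¢.r * ¢.w + ¢.q % ¢.w)))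
        ((.rd .xa ((¢.lev + 1) * (¢.N * ¢.N) + (¢.q / ¢.w * ¢.N + (¢.r * ¢.w + ¢.q % ¢.w))) +
          .rd .pz (¢.q / ¢.w * ¢.N + ¢.q % ¢.w)) % 2))))))

/-- The matrix at level `l` of `xa`. -/
def lvl (N : ℕ) (σ : Store) (l : ℕ) : Matrix (Fin N) (Fin N) (ZMod 2) :=
  mat N fun p => σ.a .xa (l * (N * N) + p)

/-- The variables and arrays that block multiplication uses. -/
abbrev mulVars : List Var := [.t, .ia, .ic, .ib, .q, .ra, .rb, .rc]

namespace Tri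

variable {E : Env} {σ : Store} {Q : Store → Prop} {N w : ℕ}

theorem dims {a b c : Expr} {x y z : ℕ} (ha : a.deg ≤ 90) (hb : b.deg ≤ 90) (hc : c.deg ≤ 90)
    (hx : a.eval σ = x) (hy : b.eval (σ.setV .ra x) = y)
    (hz : c.eval ((σ.setV .ra x).setV .rb y) = z) (hxB : x ≤ E.B) (hyB : y ≤ E.B) (hzB : z ≤ E.B)
    (h : Q (((σ.setV .ra x).setV .rb y).setV .rc z)) : Tri E (dims a b c) σ (3 * cst) Q := by
  subst hx hy hz
  exact (seq (assign ha hxB (seq (assign hb hyB (assign hc hzB h))))).time (by omega)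

theorem loadG {α : Arr} {x : Var} (hN : σ.v .N = N) (hw : σ.v .w = w) (hB : N * w ≤ E.B)
    (hα : α ≠ .io) (hαg : α ≠ .g) (hx : x ≠ .q)
    (h : ∀ h : ℕ → ℕ, (∀ r < w, ∀ c < N,
      (h (r * N + c) : ZMod 2) = σ.a .g ((σ.v x * w + r) * N + c)) →
      Q ((σ.setV .q (w * N)).setA α h)) :
    Tri E (loadG α x) σ ((N * w + 1) * (3 * cst)) Q := by
  refine (scatter (w * N) id (fun q => σ.a .g (σ.v x * w * N + q) % 2) (by simp) (by simp)
    (by simp) (by rwa [mul_comm]) hα (by simp [hN, hw]) (by simp) (by simp)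
    (by simp [hN, hw, hx, hαg.symm]) (fun _ _ => E.mod_two_le _) fun f hf _ => h f ?_).time
    (by rw [mul_comm w])
  intro r hr c hc
  have := hf (r * N + c) (index_lt hr hc)
  simp only [id] at this
  rw [this, cast_mod_two]
  congr 2; ring

theorem loadP {α : Arr} (hN : σ.v .N = N) (hw : σ.v .w = w) (hB : N * w ≤ E.B)
    (hα : α ≠ .io) (hαg : α ≠ .pz)
    (h : ∀ h : ℕ → ℕ, (∀ r < w, ∀ c < N, (h (r * N + c) : ZMod 2) = σ.a .pz (r * N + c)) →
      Q ((σ.setV .q (w * N)).setA α h)) :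
    Tri E (loadP α) σ ((N * w + 1) * (3 * cst)) Q := by
  refine (scatter (w * N) id (fun q => σ.a .pz q % 2) (by simp) (by simp)
    (by simp) (by rwa [mul_comm]) hα (by simp [hN, hw]) (by simp) (by simp)
    (by simp [hαg.symm]) (fun _ _ => E.mod_two_le _) fun f hf _ => h f ?_).time
    (by rw [mul_comm w])
  intro r hr c hc
  have := hf (r * N + c) (index_lt hr hc)
  simp only [id] at this
  rw [this, cast_mod_two]

theorem loadX {α : Arr} {x : Var} (hN : σ.v .N = N) (hw : σ.v .w = w) (hB : N * w ≤ E.B)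
    (hwN : w ≤ N) (hα : α ≠ .io) (hαg : α ≠ .xa) (hx : x ≠ .q)
    (h : ∀ h : ℕ → ℕ, (∀ r < N, ∀ c < w, (h (r * N + c) : ZMod 2) =
      σ.a .xa ((σ.v .lev + 1) * (N * N) + (r * N + (σ.v x * w + c)))) →
      Q ((σ.setV .q (N * w)).setA α h)) :
    Tri E (loadX α x) σ ((N * w + 1) * (3 * cst)) Q := by
  refine scatter (N * w) (fun q => q / w * N + q % w) (fun q => σ.a .xa ((σ.v .lev + 1) * (N * N) +
    (q / w * N + (σ.v x * w + q % w))) % 2) (by simp) (by simp)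
    (by simp) hB hα (by simp [hN, hw]) ?_ (by simp [hN, hw])
    (by simp [hN, hw, hx, hαg.symm]) (fun _ _ => E.mod_two_le _) fun f hf _ => h f ?_
  · intro i hi j hj hij
    exact rect_inj (a := 0) (b := 0) (R := N) (show 0 + w ≤ N by omega) i hi j hj
      (by simpa using hij)
  · intro r hr c hc
    have := hf (r * w + c) (index_lt hr hc)
    simp only [(div_mod_block hc).1, (div_mod_block hc).2] at this
    rw [this, cast_mod_two]

/-- The time for the operations at a node of the recursion with children of width `w`. -/
def _root_.WordRAM.opTime (c : Cmd) (T : ℕ → ℕ) (N w : ℕ) : ℕ :=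
  2 * (N / w * blkTime c T w) + 40 * cst * (N * w + 1)

variable {c : Cmd} {κ : ℕ} {T : ℕ → ℕ}

theorem _root_.WordRAM.dvd_facts {N w : ℕ} (h1w : 0 < w) (hdvd : w ∣ N) (hwN : w ≤ N) :
    N / w * w = N ∧ 1 ≤ N / w ∧ N / w ≤ N :=
  ⟨Nat.div_mul_cancel hdvd, (Nat.one_le_div_iff h1w).2 hwN, Nat.div_le_self _ _⟩

/-- Only one `w × w` block of `G X` is needed at a time. It is the product of a block row and a
block column, which costs `N / w` block products. -/
theorem blockGX (hc : MatMulBy c κ T) (hB : (N + 2) ^ (κ + 1) ≤ E.B) (hNB : N * N ≤ E.B)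
    (hN : σ.v .N = N) (hw : σ.v .w = w) (h1w : 0 < w) (hdvd : w ∣ N)
    (hu : σ.v .u * w + w ≤ N) (hr : σ.v .r * w + w ≤ N)
    (hQ : ∀ σ', Same mulVars [.vm, .acc, .pz, .px, .py] σ σ' →
      (∀ i (hi : i < w) j (hj : j < w), (σ'.a .pz (i * N + j) : ZMod 2) =
        (mat N (σ.a .g) * lvl N σ (σ.v .lev + 1)) ⟨σ.v .u * w + i, by omega⟩
          ⟨σ.v .r * w + j, by omega⟩) → Q σ') :
    Tri E (blockGX c) σ (N / w * blkTime c T w + 15 * cst * (N * w + 1)) Q := by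
  have hwN : w ≤ N := by omega
  obtain ⟨hbw, h1b, hbN⟩ := dvd_facts h1w hdvd hwN
  have hNB' : N ≤ E.B := (Nat.le_mul_self N).trans hNB
  have hNw : N * w ≤ E.B := (Nat.mul_le_mul_left N hwN).trans hNB
  have h1B : 1 ≤ E.B := by omega
  refine (seq (loadG hN hw hNw (by simp) (by simp) (by simp) fun f₁ hf₁ =>
    seq (t₂ := 3 * cst + (1 * 1 * (N / w) * blkTime c T w + 3 * cst))
      (loadX (N := N) (w := w) (by simp [hN]) (by simp [hw]) hNw hwN (by simp) (by simp) (by simp)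
      fun f₂ hf₂ => ?_))).time ?_
  · refine seq (dims (x := 1) (y := N / w) (z := 1) (by simp) (by simp) (by simp) (by simp)
      (by simp [hN, hw]) (by simp) h1B (hbN.trans hNB') h1B ?_)
    refine Tri.mul hc hB hNB (w := w) (ra := 1) (rb := N / w) (rc := 1) (by simp [hN])
      (by simp [hw]) (by simp) (by simp) (by simp) h1w le_rfl h1b (by simpa using hwN)
      hbw.le (by simpa using hwN) fun σ₁ hS₁ hp₁ => hQ _ ⟨fun x hx => ?_, fun x hx => ?_, ?_⟩ ?_
    · simp only [mulVars, List.mem_cons, not_or] at hx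
      simp [hS₁.v x, hx]
    · simp only [List.mem_cons, not_or] at hx
      simp [hS₁.a x, hx]
    · simp [hS₁.pos]
    · intro i hi j hj
      rw [hp₁ i (by simpa using hi) j (by simpa using hj), hbw, Matrix.mul_apply,
        ← sum_fin_eq_range]
      refine Finset.sum_congr rfl fun l _ => ?_
      have h1 := hf₁ i hi l l.2
      have h2 := hf₂ l l.2 j hj
      simp only [Store.setV_a, Store.setA_a, reduceCtorEq, if_false, if_true, Store.setA_v,
        Store.setV_v] at h2 ⊢
      rw [h1, h2]
      rfl
  · ring_nf; omega

/-- Both corrections in `ginv_combine` have this form: with `u` the second and `r` the first block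
it computes `h + h a g`, and with the roles exchanged `g + g b H`. Multiplying the small block of `G
X` first keeps the total at `2 * (N / w)` block products. -/
theorem combine (hc : MatMulBy c κ T) (hB : (N + 2) ^ (κ + 1) ≤ E.B) (hNB : N * N ≤ E.B)
    (hN : σ.v .N = N) (hw : σ.v .w = w) (h1w : 0 < w) (hdvd : w ∣ N)
    (hu : σ.v .u * w + w ≤ N) (hr : σ.v .r * w + w ≤ N)
    (hQ : ∀ σ', Same mulVars [.vm, .acc, .pz, .px, .py, .g] σ σ' →
      mat N (σ'.a .g) = mat N (σ.a .g) + blockProj N w (σ.v .u) * (mat N (σ.a .g) *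
        lvl N σ (σ.v .lev + 1)) * (blockProj N w (σ.v .r) * mat N (σ.a .g)) → Q σ') :
    Tri E (combineC c) σ (opTime c T N w) Q := by
  have hwN : w ≤ N := by omega
  obtain ⟨hbw, h1b, hbN⟩ := dvd_facts h1w hdvd hwN
  have hNB' : N ≤ E.B := (Nat.le_mul_self N).trans hNB
  have hNw : N * w ≤ E.B := (Nat.mul_le_mul_left N hwN).trans hNB
  have h1B : 1 ≤ E.B := by omega
  refine (seq (t₂ := (N * w + 1) * (3 * cst) + ((N * w + 1) * (3 * cst) + (3 * cst +
    ((1 * (N / w) * 1 * blkTime c T w + 3 * cst) + (w * N + 1) * (3 * cst)))))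
    (blockGX hc hB hNB hN hw h1w hdvd hu hr fun σ₁ hS₁ hp₁ => ?_)).time ?_
  · have e1 : ∀ x, x ∉ mulVars → σ₁.v x = σ.v x := hS₁.v
    refine seq (loadP (N := N) (w := w) ((e1 .N (by decide)).trans hN) ((e1 .w (by decide)).trans hw)
      hNw (by simp) (by simp) fun f₃ hf₃ => ?_)
    refine seq (loadG (N := N) (w := w) (by simp [hS₁.v .N, hN]) (by simp [hS₁.v .w, hw]) hNw
      (by simp) (by simp) (by simp) fun f₄ hf₄ => ?_)
    refine seq (dims (x := 1) (y := 1) (z := N / w) (by simp) (by simp) (by simp) (by simp)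
      (by simp) (by simp [hS₁.v .N, hS₁.v .w, hN, hw]) h1B h1B (hbN.trans hNB') ?_)
    refine seq (Tri.mul hc hB hNB (w := w) (ra := 1) (rb := 1) (rc := N / w) (by simp [hS₁.v .N, hN])
      (by simp [hS₁.v .w, hw]) (by simp) (by simp) (by simp) h1w le_rfl le_rfl (by simpa using hwN)
      (by simpa using hwN) hbw.le fun σ₂ hS₂ hp₂ => ?_)
    have e2 : ∀ x, x ∉ mulVars → σ₂.v x = σ.v x := by
      intro x hx
      have hx' := hx
      simp only [mulVars, List.mem_cons, not_or] at hx
      rw [hS₂.v x (by simp [hx])]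
      simp [e1 x hx', hx]
    have eg : σ₂.a .g = σ.a .g := by
      rw [hS₂.a .g (by decide)]
      simp [hS₁.a .g]
    refine scatter (w * N) (fun q => σ.v .u * w * N + q)
      (fun q => (σ.a .g (σ.v .u * w * N + q) + σ₂.a .pz q) % 2) (by simp) (by simp)
      (by simp) (by rwa [mul_comm]) (by simp) (by simp [e2 .N, e2 .w, hN, hw]) (by simp)
      (by simp [e2 .u, e2 .w, e2 .N, hN, hw]) ?_ (fun _ _ => E.mod_two_le _) fun f₅ hf₅ hf₅' => ?_
    · intro i hi h hh _
      simp only [eg] at hh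
      simp [e2 .u, e2 .w, e2 .N, hN, hw, hh]
    · refine hQ _ ⟨fun x hx => ?_, fun x hx => ?_, ?_⟩ ?_
      · have := e2 x hx
        simp only [mulVars, List.mem_cons, not_or] at hx
        simp [hx, this]
      · simp only [List.mem_cons, not_or] at hx
        simp [hx, hS₂.a x, hS₁.a x]
      · simp [hS₂.pos, hS₁.pos]
      · ext ⟨R, hR⟩ ⟨C, hC⟩
        have key : ∀ R' (hR' : R' < w), (σ₂.a .pz (R' * N + C) : ZMod 2) = ((mat N (σ.a .g) *
            lvl N σ (σ.v .lev + 1)) * (blockProj N w (σ.v .r) * mat N (σ.a .g)))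
              ⟨σ.v .u * w + R', by omega⟩ ⟨C, hC⟩ := by
          intro R' hR'
          rw [hp₂ R' (by simpa using hR') C (by rw [hbw]; exact hC), one_mul]
          refine sum_blockProj h1w hr fun k hk' => ?_
          have h3 := hf₃ R' hR' k (by omega)
          have h4 := hf₄ k hk' C hC
          simp [hS₁.a .g, hS₁.v .r] at h4
          simp only [Store.setV_a, Store.setA_a, reduceCtorEq, if_false, if_true]
          rw [h3, h4, hp₁ R' hR' k hk']
          rfl
        rw [Matrix.add_apply, mul_assoc, blockProj, Matrix.diagonal_mul]
        simp only [mat, Matrix.of_apply, Store.setA_a, if_true]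
        have hRw := Nat.div_add_mod' R w
        have hmw := Nat.mod_lt R h1w
        split_ifs with hif
        · have h5 := hf₅ (R % w * N + C) (index_lt hmw hC)
          have e : σ.v .u * w * N + (R % w * N + C) = R * N + C := by
            rw [← hif, ← add_assoc, ← add_mul, hRw]
          simp only [e] at h5
          rw [h5, cast_mod_two, Nat.cast_add, key _ hmw, one_mul]
          congr 2
          simp only [← hif, hRw]
          rfl
        · rw [hf₅' (R * N + C), eg, zero_mul, add_zero]
          intro q hq h
          apply hif
          have h1 : q / N < w := div_lt_of_lt_mul' hq
          have h2 := Nat.div_add_mod' q N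
          have h3 : (σ.v .u * w + q / N) * N + q % N = R * N + C := by rw [← h, add_mul]; omega
          obtain ⟨h4, -⟩ := (index_inj (Nat.mod_lt _ (by omega)) hC).1 h3
          rw [← h4]; exact (div_mod_block h1).1
  · unfold opTime; ring_nf; omega

/-- This yields the columns of `b + a g b` for the second recursive call. They go to the level
below, so that the matrix of the parent survives for the combination afterwards. -/
theorem residue (hc : MatMulBy c κ T) (hB : (N + 2) ^ (κ + 1) ≤ E.B) (hNB : N * N ≤ E.B)
    (hN : σ.v .N = N) (hw : σ.v .w = w) (h1w : 0 < w) (hdvd : w ∣ N)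
    (hu : σ.v .u * w + w ≤ N) (hr : σ.v .r * w + w ≤ N)
    (hQ : ∀ σ', Same mulVars [.vm, .acc, .pz, .px, .py, .xa] σ σ' →
      lvl N σ' (σ.v .lev) * blockProj N w (σ.v .r) =
        (lvl N σ (σ.v .lev + 1) + lvl N σ (σ.v .lev + 1) * (blockProj N w (σ.v .u) *
          (mat N (σ.a .g) * lvl N σ (σ.v .lev + 1)))) * blockProj N w (σ.v .r) →
      (∀ p, (σ.v .lev + 1) * (N * N) ≤ p → σ'.a .xa p = σ.a .xa p) → Q σ') :
    Tri E (residueC c) σ (opTime c T N w) Q := by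
  have hwN : w ≤ N := by omega
  obtain ⟨hbw, h1b, hbN⟩ := dvd_facts h1w hdvd hwN
  have hNB' : N ≤ E.B := (Nat.le_mul_self N).trans hNB
  have hNw : N * w ≤ E.B := (Nat.mul_le_mul_left N hwN).trans hNB
  have h1B : 1 ≤ E.B := by omega
  refine (seq (t₂ := (N * w + 1) * (3 * cst) + ((N * w + 1) * (3 * cst) + (3 * cst +
    ((N / w * 1 * 1 * blkTime c T w + 3 * cst) + (N * w + 1) * (3 * cst)))))
    (blockGX hc hB hNB hN hw h1w hdvd hu hr fun σ₁ hS₁ hp₁ => ?_)).time ?_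
  · have e1 : ∀ x, x ∉ mulVars → σ₁.v x = σ.v x := hS₁.v
    refine seq (loadP (N := N) (w := w) ((e1 .N (by decide)).trans hN) ((e1 .w (by decide)).trans hw)
      hNw (by simp) (by simp) fun f₃ hf₃ => ?_)
    refine seq (loadX (N := N) (w := w) (by simp [hS₁.v .N, hN]) (by simp [hS₁.v .w, hw]) hNw hwN
      (by simp) (by simp) (by simp) fun f₄ hf₄ => ?_)
    refine seq (dims (x := N / w) (y := 1) (z := 1) (by simp) (by simp) (by simp)
      (by simp [hS₁.v .N, hS₁.v .w, hN, hw]) (by simp) (by simp) (hbN.trans hNB') h1B h1B ?_)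
    refine seq (Tri.mul hc hB hNB (w := w) (ra := N / w) (rb := 1) (rc := 1) (by simp [hS₁.v .N, hN])
      (by simp [hS₁.v .w, hw]) (by simp) (by simp) (by simp) h1w h1b le_rfl hbw.le
      (by simpa using hwN) (by simpa using hwN) fun σ₂ hS₂ hp₂ => ?_)
    have e2 : ∀ x, x ∉ mulVars → σ₂.v x = σ.v x := by
      intro x hx
      have hx' := hx
      simp only [mulVars, List.mem_cons, not_or] at hx
      rw [hS₂.v x (by simp [hx])]
      simp [e1 x hx', hx]
    have eg : σ₂.a .xa = σ.a .xa := by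
      rw [hS₂.a .xa (by decide)]
      simp [hS₁.a .xa]
    have hlow : ∀ q < N * w, q / w * N + (σ.v .r * w + q % w) < N * N := fun q hq =>
      index_lt (div_lt_of_lt_mul' hq) (by have := mod_lt_of_lt_mul hq; omega)
    refine scatter (N * w) (fun q => σ.v .lev * (N * N) + (q / w * N + (σ.v .r * w + q % w)))
      (fun q => (σ.a .xa ((σ.v .lev + 1) * (N * N) + (q / w * N + (σ.v .r * w + q % w))) +
        σ₂.a .pz (q / w * N + q % w)) % 2) (by simp) (by simp)
      (by simp) hNw (by simp) (by simp [e2 .N, e2 .w, hN, hw]) ?_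
      (by simp [e2 .r, e2 .w, e2 .N, e2 .lev, hN, hw]) ?_ (fun _ _ => E.mod_two_le _)
      fun f₅ hf₅ hf₅' => ?_
    · intro i hi j hj hij
      exact rect_inj (a := 0) (b := σ.v .r * w) (R := N) hr i hi j hj
        (by simpa using hij)
    -- The loop writes below `(lev + 1) * (N * N)` and reads at or above it, so it always reads
    -- original entries of the parent level.
    · intro i hi h _ hh
      have := hh ((σ.v .lev + 1) * (N * N) + (i / w * N + (σ.v .r * w + i % w))) fun k hk => by
        have := hlow k hk
        rw [add_mul, one_mul]; omega
      simp only [eg] at this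
      simp [e2 .r, e2 .w, e2 .N, e2 .lev, hN, hw, this]
    · refine hQ _ ⟨fun x hx => ?_, fun x hx => ?_, ?_⟩ ?_ ?_
      · have := e2 x hx
        simp only [mulVars, List.mem_cons, not_or] at hx
        simp [hx, this]
      · simp only [List.mem_cons, not_or] at hx
        simp [hx, hS₂.a x, hS₁.a x]
      · simp [hS₂.pos, hS₁.pos]
      · ext ⟨R, hR⟩ ⟨C, hC⟩
        have key : ∀ C' (hC' : C' < w), (σ₂.a .pz (R * N + C') : ZMod 2) =
            (lvl N σ (σ.v .lev + 1) * (blockProj N w (σ.v .u) * (mat N (σ.a .g) *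
              lvl N σ (σ.v .lev + 1)))) ⟨R, hR⟩ ⟨σ.v .r * w + C', by omega⟩ := by
          intro C' hC'
          rw [hp₂ R (by rw [hbw]; exact hR) C' (by simpa using hC'), one_mul]
          refine sum_blockProj h1w hu fun k hk' => ?_
          have h3 := hf₃ k hk' C' (by omega)
          have h4 := hf₄ R hR k hk'
          simp [hS₁.a .xa, hS₁.v .u, hS₁.v .lev] at h4
          simp only [Store.setV_a, Store.setA_a, reduceCtorEq, if_false, if_true]
          rw [h3, h4, hp₁ k hk' C' hC']
          rfl
        rw [blockProj, Matrix.mul_diagonal, Matrix.mul_diagonal, Matrix.add_apply]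
        simp only
        have hCw := Nat.div_add_mod' C w
        have hmw := Nat.mod_lt C h1w
        split_ifs with hif
        · have h5 := hf₅ (R * w + C % w) (index_lt hR hmw)
          have e : σ.v .r * w + C % w = C := by rw [← hif, hCw]
          simp only [(div_mod_block hmw).1, (div_mod_block hmw).2, e] at h5
          rw [mul_one, mul_one]
          have h6 : (lvl N ((σ₂.setV .q (N * w)).setA .xa f₅) (σ.v .lev)) ⟨R, hR⟩ ⟨C, hC⟩ =
            (f₅ (σ.v .lev * (N * N) + (R * N + C)) : ZMod 2) := by simp [lvl, mat]
          rw [h6, h5, cast_mod_two, Nat.cast_add, key _ hmw]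
          simp only [e]
          rfl
        · simp
      · intro p hp
        simp only [Store.setA_a, if_true]
        rw [hf₅' p, eg]
        intro q hq
        have := hlow q hq
        rw [add_mul, one_mul] at hp
        omega
  · unfold opTime; ring_nf; omega

end Tri

end WordRAM


/-! ### Traversal of the binary tree of column blocks. -/

namespace WordRAM

/-- A generalized inverse of a single column: find a pivot. -/
def leafC : Cmd :=
  .seq (assign .piv ¢.N) (.seq (forC .r ¢.N
    (iteE (.rd .xa (¢.r * ¢.N + ¢.idx) % 2) (assign .piv ¢.r) .skip))
    (scatter .q ¢.N .g (¢.idx * ¢.N + ¢.q) (Expr.eq ¢.q ¢.piv)))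

/-- Go to the left child of the current node and copy its columns. -/
def descendC : Cmd :=
  .seq (assign .lev (¢.lev - 1)) (.seq (assign .w (¢.w / 2)) (.seq (assign .idx (2 * ¢.idx))
    (scatter .q (¢.N * ¢.w) .xa (¢.lev * (¢.N * ¢.N) + (¢.q / ¢.w * ¢.N + (¢.idx * ¢.w + ¢.q % ¢.w)))
      (.rd .xa ((¢.lev + 1) * (¢.N * ¢.N) + (¢.q / ¢.w * ¢.N + (¢.idx * ¢.w + ¢.q % ¢.w))) % 2))))

/-- Go from a left child to its sibling. -/
def crossC (c : Cmd) : Cmd :=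
  .seq (assign .u ¢.idx) (.seq (assign .r (¢.idx + 1)) (.seq (residueC c)
    (.seq (assign .idx (¢.idx + 1)) (assign .ph 1))))

/-- Go from a right child to its parent. -/
def ascendC (c : Cmd) : Cmd :=
  .seq (assign .u ¢.idx) (.seq (assign .r (¢.idx - 1)) (.seq (combineC c)
    (.seq (assign .u (¢.idx - 1)) (.seq (assign .r ¢.idx) (.seq (combineC c)
      (.seq (assign .lev (¢.lev + 1)) (.seq (assign .w (2 * ¢.w)) (assign .idx (¢.idx / 2)))))))))

/-- One step of the traversal of the tree of column blocks. -/
def ginvStep (c : Cmd) : Cmd :=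
  -- Phase 1 enters a node, phase 2 leaves a node whose block is done, and phase 0 stops. The parity
  -- of `idx` tells a left child from a right child, so no recursion stack is needed.
  iteE (Expr.eq ¢.ph 1)
    (iteE ¢.lev descendC (.seq leafC (assign .ph 2)))
    (iteE (Expr.eq ¢.lev ¢.kk) (assign .ph 0) (iteE (¢.idx % 2) (ascendC c) (crossC c)))

/-- Compute a generalized inverse of the matrix at level `kk` of `xa` in `g`. -/
def ginvC (c : Cmd) : Cmd :=
  .seq (assign .lev ¢.kk) (.seq (assign .idx 0) (.seq (assign .w ¢.N) (.seq (assign .ph 1)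
    (whileE ¢.ph (ginvStep c)))))

/-- The time for a node of the recursion. -/
def treeTime (c : Cmd) (T : ℕ → ℕ) (N : ℕ) : ℕ → ℕ
  | 0 => 20 * cst * (N + 1)
  -- A node performs one `residueC` and two `combineC`, each within `opTime`, besides its two
  -- recursive calls.
  | d + 1 => 2 * treeTime c T N d + 3 * opTime c T N (2 ^ d) + 40 * cst * (N * 2 ^ d + 1)

/-- The variables that the computation of a generalized inverse uses. -/
abbrev ginvVars : List Var :=
  [.t, .ia, .ic, .ib, .q, .ra, .rb, .rc, .u, .r, .piv, .lev, .idx, .ph, .w]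

/-- The arrays that the computation of a generalized inverse uses. -/
abbrev ginvArrs : List Arr := [.vm, .acc, .pz, .px, .py, .xa, .g]

/-- The traversal is at the node `i` of height `d`, in phase `p`. -/
structure NodeAt (N k d i p : ℕ) (σ : Store) : Prop where
  N : σ.v .N = N
  kk : σ.v .kk = k
  lev : σ.v .lev = d
  idx : σ.v .idx = i
  w : σ.v .w = 2 ^ d
  ph : σ.v .ph = p

namespace Tri

variable {E : Env} {σ : Store} {Q : Store → Prop} {N : ℕ}

/-- A nonzero column `x` with `x_p = 1` satisfies `x e_pᵀ x = x`, so the unit row vector at a pivot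
is a generalized inverse. The value `N` of `piv` means that the column is zero; the comparison with
`q` then fails everywhere and the row becomes zero. -/
theorem leaf {i : ℕ} (hN : σ.v .N = N) (hi : σ.v .idx = i) (hiN : i < N) (hNB : N ≤ E.B)
    (hQ : ∀ σ', Same [.piv, .r, .q] [.g] σ σ' →
      (1 - blockProj N 1 i) * mat N (σ'.a .g) = (1 - blockProj N 1 i) * mat N (σ.a .g) →
      lvl N σ 0 * blockProj N 1 i * mat N (σ'.a .g) * (lvl N σ 0 * blockProj N 1 i) =
        lvl N σ 0 * blockProj N 1 i → Q σ') :
    Tri E leafC σ (12 * cst * (N + 1)) Q := by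
  refine (seq (assign (by simp) (by simpa [hN] using hNB) (seq (t₁ := N * (2 * cst + 2 * cst) + 2 * cst)
    (t₂ := (N + 1) * (3 * cst)) (forC (m := N)
    (fun j σ' => σ'.v .r = j ∧ Same [.piv, .r] [] σ σ' ∧
      (σ'.v .piv = N ∧ (∀ k < j, (σ.a .xa (k * N + i)) % 2 = 0) ∨
        σ'.v .piv < N ∧ (σ.a .xa (σ'.v .piv * N + i)) % 2 = 1)) (by simp) hNB ?_ ?_ ?_ ?_)))).time ?_
  · rintro j _ σ' ⟨h1, h2, -⟩
    exact ⟨h1, by simp [h2.v .N, hN]⟩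
  · exact ⟨by simp, (((Same.refl _ _ _).setV (by simp) _).setV (by simp) _), by simp [hN]⟩
  · rintro j hj σ' ⟨h1, h2, h3⟩
    have e : (Expr.rd .xa (¢.r * ¢.N + ¢.idx) % 2).eval σ' = (σ.a .xa (j * N + i)) % 2 := by
      simp [h1, h2.v .N, h2.v .idx, h2.a .xa, hN, hi]
    refine (iteE (t := cst) (by simp) (fun he => ?_) fun he => ?_).time (by omega)
    · rw [e] at he
      refine assign (by simp) (by simp [h1]; omega) ⟨by simp [h1], by simp, (h2.setV (by simp) _).setV
        (by simp) _, Or.inr ?_⟩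
      simp [h1, hj]; omega
    · rw [e] at he
      refine (skip ⟨h1, by simp, h2.setV (by simp) _, ?_⟩).time (by unfold cst; omega)
      rcases h3 with ⟨h3, h4⟩ | ⟨h3, h4⟩
      · refine Or.inl ⟨by simp [h3], fun k hk => ?_⟩
        rcases Nat.lt_succ_iff_lt_or_eq.1 hk with hk | rfl
        · exact h4 k hk
        · exact he
      · exact Or.inr ⟨by simp [h3], by simp [h4]⟩
  · rintro σ' ⟨h1, h2, h3⟩
    refine scatter N (fun q => i * N + q) (fun q => if q = σ'.v .piv then 1 else 0) (by simp)
      (by simp) (by simp) hNB (by simp) (by simp [h2.v .N, hN]) (by simp)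
      (by simp [h2.v .N, h2.v .idx, hN, hi]) (by simp)
      (fun q hq => by have := E.hB; split_ifs <;> omega) fun f hf hf' => hQ _ ?_ ?_ ?_
    · exact ((h2.trans (Same.refl [.q] [.g] _) (zs := [.piv, .r, .q]) (γs := [.g])).setV
        (by simp) _).setA (by simp) _
    · ext ⟨R, hR⟩ ⟨C, hC⟩
      rw [← Matrix.diagonal_one, blockProj, Matrix.diagonal_sub, Matrix.diagonal_mul,
        Matrix.diagonal_mul]
      simp only [Nat.div_one, mat, Matrix.of_apply, Store.setA_a, if_true]
      split_ifs with h
      · simp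
      · rw [hf' (R * N + C), h2.a .g (by simp)]
        intro q hq hqe
        exact h ((index_inj hq hC).1 hqe).1.symm
    · have hP : ∀ l k : Fin N, (blockProj N 1 i * mat N (((σ'.setV .q N).setA .g f).a .g)) l k =
          if (l : ℕ) = i ∧ (k : ℕ) = σ'.v .piv then 1 else 0 := by
        intro l k
        rw [blockProj, Matrix.diagonal_mul]
        simp only [Nat.div_one, mat, Matrix.of_apply, Store.setA_a, if_true]
        by_cases h : (l : ℕ) = i
        · rw [h, hf k k.2]; simp
        · simp [h]
      rcases h3 with ⟨h3, h4⟩ | ⟨h3, h4⟩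
      · have : lvl N σ 0 * blockProj N 1 i = 0 := by
          ext ⟨R, hR⟩ ⟨C, hC⟩
          rw [blockProj, Matrix.mul_diagonal]
          simp only [Nat.div_one, lvl, mat, Matrix.of_apply, Matrix.zero_apply]
          split_ifs with h
          · subst h
            rw [mul_one, zero_mul, zero_add, ← cast_mod_two, h4 R hR, Nat.cast_zero]
          · simp
        rw [this]; simp
      · have e : lvl N σ 0 * (blockProj N 1 i * mat N (((σ'.setV .q N).setA .g f).a .g)) =
            Matrix.of fun R (k : Fin N) => if (k : ℕ) = σ'.v .piv then lvl N σ 0 R ⟨i, hiN⟩ else 0 := by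
          ext R k
          rw [Matrix.mul_apply, Finset.sum_eq_single ⟨i, hiN⟩]
          · rw [hP]; simp
          · intro l _ hl
            rw [hP, if_neg, mul_zero]
            rintro ⟨h, -⟩
            exact hl (Fin.ext h)
          · simp
        rw [mul_assoc (lvl N σ 0), e, ← mul_assoc]
        ext R C
        rw [blockProj, Matrix.mul_diagonal, Matrix.mul_diagonal]
        split_ifs with h
        · rw [Matrix.mul_apply, Finset.sum_eq_single ⟨σ'.v .piv, h3⟩]
          · have hC : C = ⟨i, hiN⟩ := Fin.ext (by simpa using h)
            have : lvl N σ 0 ⟨σ'.v .piv, h3⟩ ⟨i, hiN⟩ = 1 := by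
              simp only [lvl, mat, Matrix.of_apply, zero_mul, zero_add]
              rw [← cast_mod_two, h4, Nat.cast_one]
            simp [hC, this]
          · intro l _ hl
            have : ¬ (l : ℕ) = σ'.v .piv := fun h => hl (Fin.ext h)
            simp [this]
          · simp
        · simp
  · ring_nf; omega

theorem descend {k d i : ℕ} (h : NodeAt N k (d + 1) i 1 σ) (hi : (i + 1) * 2 ^ (d + 1) ≤ N)
    (hNB : N * N ≤ E.B)
    (hQ : ∀ σ', NodeAt N k d (2 * i) 1 σ' → Same [.lev, .w, .idx, .q] [.xa] σ σ' →
      lvl N σ' d * blockProj N (2 ^ d) (2 * i) = lvl N σ (d + 1) * blockProj N (2 ^ d) (2 * i) →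
      (∀ p, (d + 1) * (N * N) ≤ p → σ'.a .xa p = σ.a .xa p) → Q σ') :
    Tri E descendC σ (10 * cst * (N * 2 ^ d + 1)) Q := by
  have hp : 2 ^ (d + 1) = 2 * 2 ^ d := by ring
  have h0 : 0 < 2 ^ d := by positivity
  have hb : 2 * i * 2 ^ d + 2 ^ d ≤ N := by
    calc 2 * i * 2 ^ d + 2 ^ d ≤ (i + 1) * 2 ^ (d + 1) := by rw [hp]; ring_nf; omega
      _ ≤ N := hi
  have hwN : 2 ^ d ≤ N := by omega
  have hNw : N * 2 ^ d ≤ E.B := (Nat.mul_le_mul_left N hwN).trans hNB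
  have hNB' : N ≤ E.B := (Nat.le_mul_self N).trans hNB
  refine bdd fun hv _ => ?_
  have hlev := hv .lev
  rw [h.lev] at hlev
  have h2i : 2 * i ≤ N := by
    calc 2 * i ≤ 2 * i * 2 ^ d := Nat.le_mul_of_pos_right _ h0
      _ ≤ N := by omega
  have hlow : ∀ q < N * 2 ^ d, q / 2 ^ d * N + (2 * i * 2 ^ d + q % 2 ^ d) < N * N := fun q hq =>
    index_lt (div_lt_of_lt_mul' hq) (by have := mod_lt_of_lt_mul hq; omega)
  refine (seq (t₁ := cst) (t₂ := cst + (cst + (N * 2 ^ d + 1) * (3 * cst))) (assign (by simp)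
    (by simp [h.lev]; omega) (seq (assign (by simp) (by simp [h.w, hp]; omega)
    (seq (assign (by simp) (by simp [h.idx]; omega) ?_)))))).time ?_
  · have e : ((((σ.setV .lev ((¢.lev - 1).eval σ)).setV .w ((¢.w / 2).eval (σ.setV .lev
        ((¢.lev - 1).eval σ)))).setV .idx ((2 * ¢.idx).eval ((σ.setV .lev
        ((¢.lev - 1).eval σ)).setV .w ((¢.w / 2).eval (σ.setV .lev
        ((¢.lev - 1).eval σ)))))) = ((σ.setV .lev d).setV .w (2 ^ d)).setV .idx (2 * i)) := by
      simp [h.lev, h.w, h.idx, hp]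
    rw [e]
    refine scatter (N * 2 ^ d)
      (fun q => d * (N * N) + (q / 2 ^ d * N + (2 * i * 2 ^ d + q % 2 ^ d)))
      (fun q => (σ.a .xa ((d + 1) * (N * N) + (q / 2 ^ d * N + (2 * i * 2 ^ d + q % 2 ^ d)))) % 2)
      (by simp) (by simp) (by simp) hNw (by simp) (by simp [h.N]) ?_ (by simp [h.N]) ?_
      (fun _ _ => E.mod_two_le _) fun f hf hf' => hQ _ ?_ ?_ ?_ ?_
    · intro a ha b hb' hab
      exact rect_inj (a := 0) (b := 2 * i * 2 ^ d) (R := N) hb a ha b hb' (by simpa using hab)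
    · intro a ha f _ hf
      have := hf ((d + 1) * (N * N) + (a / 2 ^ d * N + (2 * i * 2 ^ d + a % 2 ^ d)))
        fun b hb' => by
          have := hlow b hb'
          rw [add_mul, one_mul]; omega
      simp [h.N, this]
    · constructor <;> simp [h.N, h.kk, h.ph]
    · exact (((((Same.refl _ _ _).setV (by simp) _).setV (by simp) _).setV (by simp) _).setV
        (by simp) _).setA (by simp) _
    · ext ⟨R, hR⟩ ⟨C, hC⟩
      rw [blockProj, Matrix.mul_diagonal, Matrix.mul_diagonal]
      simp only
      split_ifs with hif
      · have hCw := Nat.div_add_mod' C (2 ^ d)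
        have hmw := Nat.mod_lt C h0
        have h5 := hf (R * 2 ^ d + C % 2 ^ d) (index_lt hR hmw)
        have e : 2 * i * 2 ^ d + C % 2 ^ d = C := by rw [← hif, hCw]
        simp only [(div_mod_block hmw).1, (div_mod_block hmw).2, e] at h5
        rw [mul_one, mul_one]
        simp only [lvl, mat, Matrix.of_apply, Store.setA_a, if_true]
        rw [h5, cast_mod_two]
      · simp
    · intro p hp'
      simp only [Store.setA_a, if_true]
      rw [hf' p]
      · rfl
      intro q hq
      have := hlow q hq
      rw [add_mul, one_mul] at hp'
      omega
  · ring_nf; omega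

end Tri

end WordRAM


/-! ### The algebra of one recursion step, and its implementation. -/

/-- The step of the recursion for generalized inverses: the rows that `E₁` and `E₂` select hold
generalized inverses of `X E₁` and of the residue of `X E₂`. -/
theorem ginv_step {R : Type*} [Ring R] (h2 : ∀ x : R, x + x = 0) {E₁ E₂ G₀ G₂ G₄ G₅ G X : R}
    (h11 : E₁ * E₁ = E₁) (h22 : E₂ * E₂ = E₂) (h12 : E₁ * E₂ = 0) (h21 : E₂ * E₁ = 0)
    (hf₂ : (1 - E₁) * G₂ = (1 - E₁) * G₀) (hg₂ : X * E₁ * G₂ * (X * E₁) = X * E₁)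
    (hf₄ : (1 - E₂) * G₄ = (1 - E₂) * G₂)
    (hg₄ : (X + X * (E₁ * (G₂ * X))) * E₂ * G₄ * ((X + X * (E₁ * (G₂ * X))) * E₂) =
      (X + X * (E₁ * (G₂ * X))) * E₂)
    (hG : G = G₄ + E₂ * (G₄ * X) * (E₁ * G₄)) (hG₅ : G₅ = G + E₁ * (G * X) * (E₂ * G)) :
    (1 - (E₁ + E₂)) * G₅ = (1 - (E₁ + E₂)) * G₀ ∧
      X * (E₁ + E₂) * G₅ * (X * (E₁ + E₂)) = X * (E₁ + E₂) := by
  have c1 : (1 - (E₁ + E₂)) * E₁ = 0 := by rw [sub_mul, add_mul, h11, h21]; simp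
  have c2 : (1 - (E₁ + E₂)) * E₂ = 0 := by rw [sub_mul, add_mul, h22, h12]; simp
  have c3 : (1 - E₁) * (1 - E₂) = 1 - (E₁ + E₂) := by
    rw [sub_mul, one_mul, mul_sub, h12, mul_one, sub_zero]; abel
  have c4 : (1 - E₂) * (1 - E₁) = 1 - (E₁ + E₂) := by
    rw [sub_mul, one_mul, mul_sub, h21, mul_one, sub_zero]; abel
  have m11 : ∀ Z, E₁ * (E₁ * Z) = E₁ * Z := fun Z => by rw [← mul_assoc, h11]
  have m22 : ∀ Z, E₂ * (E₂ * Z) = E₂ * Z := fun Z => by rw [← mul_assoc, h22]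
  have m12 : ∀ Z, E₁ * (E₂ * Z) = 0 := fun Z => by rw [← mul_assoc, h12, zero_mul]
  have m21 : ∀ Z, E₂ * (E₁ * Z) = 0 := fun Z => by rw [← mul_assoc, h21, zero_mul]
  have d1 : E₁ * (1 - E₂) = E₁ := by rw [mul_sub, h12]; simp
  -- The second recursive call changes only the rows selected by `E₂`, so the inverse found by the
  -- first call is still in place.
  have e1 : E₁ * G₄ = E₁ * G₂ := by rw [← d1, mul_assoc, hf₄, ← mul_assoc]
  have e2 : E₁ * G = E₁ * G₂ := by
    rw [hG, mul_add, mul_assoc E₂, m12, e1, add_zero]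
  have e3 : E₂ * G₅ = E₂ * G := by
    rw [hG₅, mul_add, mul_assoc E₁, m21, add_zero]
  have e4 : E₁ * G₅ = E₁ * G₂ + E₁ * G₂ * (X * E₂) * (E₂ * G) := by
    rw [hG₅, mul_add, mul_assoc E₁, m11, ← e2]
    simp only [mul_assoc, m22]
  constructor
  · rw [hG₅, hG]
    calc _ = (1 - (E₁ + E₂)) * G₄ + (1 - (E₁ + E₂)) * E₂ * (G₄ * X * (E₁ * G₄)) +
          (1 - (E₁ + E₂)) * E₁ * ((G₄ + E₂ * (G₄ * X) * (E₁ * G₄)) * X *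
            (E₂ * (G₄ + E₂ * (G₄ * X) * (E₁ * G₄)))) := by
          simp only [mul_add, mul_assoc]
      _ = (1 - (E₁ + E₂)) * G₀ := by
          rw [c1, c2, zero_mul, zero_mul, add_zero, add_zero, ← c3, mul_assoc, hf₄, ← mul_assoc, c3,
            ← c4, mul_assoc, hf₂, ← mul_assoc]
  · have ag : X * E₁ * (E₁ * G₂) = X * E₁ * G₂ := by simp only [mul_assoc, m11]
    -- By `e3` and `e4`, the new rows `E₂ G₅` and `E₁ G₅` are exactly `H` and `g + g b H` for `a = X
    -- E₁` and `b = X E₂`.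
    have key := ginv_combine h2 (a := X * E₁) (b := X * E₂) (g := E₁ * G₂) (h := E₂ * G₄)
      (H := E₂ * G) (y := (X + X * (E₁ * (G₂ * X))) * E₂) (by rw [ag, hg₂])
      (by rw [ag, add_mul]; simp only [mul_assoc])
      (by rw [← mul_assoc (_ * E₂) E₂ G₄, mul_assoc _ E₂ E₂, h22, hg₄])
      (by rw [hG, mul_add, e1]; simp only [mul_assoc, m22, m11])
    rw [← mul_add] at key
    rw [← e3] at key e4
    rw [← e4] at key
    calc _ = (X * E₁ * (E₁ * G₅) + X * E₂ * (E₂ * G₅)) * (X * (E₁ + E₂)) := by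
          simp only [mul_assoc, m11, m22, mul_add, add_mul]
      _ = _ := key

namespace WordRAM

theorem Same.mono {xs ys : List Var} {αs βs : List Arr} {σ σ' : Store} (h : Same xs αs σ σ')
    (hx : xs ⊆ ys := by simp) (hα : αs ⊆ βs := by simp) : Same ys βs σ σ' :=
  ⟨fun x hy => h.v x fun h' => hy (hx h'), fun x hy => h.a x fun h' => hy (hα h'), h.pos⟩

namespace Tri

variable {E : Env} {σ : Store} {Q : Store → Prop} {N k d i κ : ℕ} {c : Cmd} {T : ℕ → ℕ}

/-- At this point the left block of `g` holds an inverse of `X E₁`. The lower level receives the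
residue of `X E₂`, and the traversal enters the right child as if the residue were its own matrix.
-/
theorem cross (hc : MatMulBy c κ T) (hB : (N + 2) ^ (κ + 1) ≤ E.B) (hNB : N * N ≤ E.B)
    (h : NodeAt N k d (2 * i) 2 σ) (hdvd : 2 ^ d ∣ N) (hi : (i + 1) * 2 ^ (d + 1) ≤ N)
    (hQ : ∀ σ', NodeAt N k d (2 * i + 1) 1 σ' → Same ginvVars ginvArrs σ σ' →
      σ'.a .g = σ.a .g →
      lvl N σ' d * blockProj N (2 ^ d) (2 * i + 1) = (lvl N σ (d + 1) + lvl N σ (d + 1) *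
        (blockProj N (2 ^ d) (2 * i) * (mat N (σ.a .g) * lvl N σ (d + 1)))) *
          blockProj N (2 ^ d) (2 * i + 1) →
      (∀ p, (d + 1) * (N * N) ≤ p → σ'.a .xa p = σ.a .xa p) → Q σ') :
    Tri E (crossC c) σ (opTime c T N (2 ^ d) + 4 * cst) Q := by
  have hp : 2 ^ (d + 1) = 2 * 2 ^ d := by ring
  have h0 : 0 < 2 ^ d := by positivity
  have hb : (2 * i + 1) * 2 ^ d + 2 ^ d ≤ N := by
    calc (2 * i + 1) * 2 ^ d + 2 ^ d = (i + 1) * 2 ^ (d + 1) := by rw [hp]; ring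
      _ ≤ N := hi
  have hb' : 2 * i * 2 ^ d + 2 ^ d ≤ N := by rw [add_mul] at hb; omega
  have h2i : 2 * i + 1 ≤ N := by
    calc 2 * i + 1 ≤ (2 * i + 1) * 2 ^ d := Nat.le_mul_of_pos_right _ h0
      _ ≤ N := by omega
  have hNB' : N ≤ E.B := (Nat.le_mul_self N).trans hNB
  have h1B : 1 ≤ E.B := by omega
  refine (seq (t₁ := cst) (t₂ := cst + (opTime c T N (2 ^ d) + (cst + cst))) (assign (by simp)
    (by simp [h.idx]; omega) (seq (assign (by simp) (by simp [h.idx]; omega) ?_)))).time (by omega)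
  refine seq (residue (w := 2 ^ d) hc hB hNB (by simp [h.N]) (by simp [h.w]) h0 hdvd
    (by simpa [h.idx] using hb') (by simpa [h.idx] using hb) fun σ₁ hS hX hp => ?_)
  have e1 : ∀ x, x ∉ ginvVars → σ₁.v x = σ.v x := by
    intro x hx
    simp only [ginvVars, List.mem_cons, not_or] at hx
    rw [hS.v x (by simp [hx])]
    simp [hx]
  have eidx : σ₁.v .idx = 2 * i := by rw [hS.v .idx (by simp)]; simp [h.idx]
  refine seq (assign (by simp) (by simp [eidx]; omega) (assign (by simp) (by simpa using h1B)
    (hQ _ ?_ ?_ ?_ ?_ ?_)))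
  · constructor
    · simp [e1 .N, h.N]
    · simp [e1 .kk, h.kk]
    · simp [hS.v .lev, h.lev]
    · simp [eidx]
    · simp [hS.v .w, h.w]
    · simp
  · refine Same.setV (Same.setV ?_ (by simp) _) (by simp) _
    exact ⟨e1, fun α hα => by
      simp only [ginvArrs, List.mem_cons, not_or] at hα
      rw [hS.a α (by simp [hα])]; rfl, hS.pos⟩
  · simp [hS.a .g]
  · simpa [h.idx, h.lev, lvl] using hX
  · simpa [h.lev] using hp

/-- The rows of the right child are corrected first, because the correction of the left rows uses
the final `H`. The matrix at the parent level is read twice and not modified. -/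
theorem ascend (hc : MatMulBy c κ T) (hB : (N + 2) ^ (κ + 1) ≤ E.B) (hNB : N * N ≤ E.B)
    (h : NodeAt N k d (2 * i + 1) 2 σ) (hdvd : 2 ^ d ∣ N) (hi : (i + 1) * 2 ^ (d + 1) ≤ N)
    (hQ : ∀ σ', NodeAt N k (d + 1) i 2 σ' → Same ginvVars ginvArrs σ σ' → σ'.a .xa = σ.a .xa →
      ∀ G, G = mat N (σ.a .g) + blockProj N (2 ^ d) (2 * i + 1) * (mat N (σ.a .g) *
        lvl N σ (d + 1)) * (blockProj N (2 ^ d) (2 * i) * mat N (σ.a .g)) →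
      mat N (σ'.a .g) = G + blockProj N (2 ^ d) (2 * i) * (G * lvl N σ (d + 1)) *
        (blockProj N (2 ^ d) (2 * i + 1) * G) → Q σ') :
    Tri E (ascendC c) σ (2 * opTime c T N (2 ^ d) + 7 * cst) Q := by
  have hp : 2 ^ (d + 1) = 2 * 2 ^ d := by ring
  have h0 : 0 < 2 ^ d := by positivity
  have hb : (2 * i + 1) * 2 ^ d + 2 ^ d ≤ N := by
    calc (2 * i + 1) * 2 ^ d + 2 ^ d = (i + 1) * 2 ^ (d + 1) := by rw [hp]; ring
      _ ≤ N := hi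
  have hb' : 2 * i * 2 ^ d + 2 ^ d ≤ N := by rw [add_mul] at hb; omega
  have h2d : 2 * 2 ^ d ≤ N := by
    rw [← hp]; exact (Nat.le_mul_of_pos_left _ (Nat.succ_pos i)).trans hi
  have h2i : 2 * i + 1 ≤ N := by
    calc 2 * i + 1 ≤ (2 * i + 1) * 2 ^ d := Nat.le_mul_of_pos_right _ h0
      _ ≤ N := by omega
  have hdN : d + 1 ≤ N := by
    have : d < 2 ^ d := Nat.lt_two_pow_self
    omega
  have hNB' : N ≤ E.B := (Nat.le_mul_self N).trans hNB
  refine (seq (t₁ := cst) (t₂ := cst + (opTime c T N (2 ^ d) + (cst + (cst +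
    (opTime c T N (2 ^ d) + (cst + (cst + cst))))))) (assign (by simp)
    (by simp [h.idx]; omega) (seq (assign (by simp) (by simp [h.idx]; omega) ?_)))).time (by omega)
  refine seq (combine (w := 2 ^ d) hc hB hNB (by simp [h.N]) (by simp [h.w]) h0 hdvd
    (by simpa [h.idx] using hb) (by simpa [h.idx] using hb') fun σ₁ hS hG => ?_)
  have e1 : ∀ x, x ∉ mulVars → x ≠ .u → x ≠ .r → σ₁.v x = σ.v x := by
    intro x hx h1 h2
    rw [hS.v x hx]; simp [h1, h2]
  have ea : ∀ x, x ∉ ginvArrs ∨ x = .xa → σ₁.a x = σ.a x := by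
    intro x hx
    simp only [ginvArrs, List.mem_cons, not_or] at hx
    rcases hx with hx | rfl
    · rw [hS.a x (by simp [hx])]; rfl
    · rw [hS.a .xa (by simp)]; rfl
  refine seq (assign (by simp) (by simp [e1 .idx, h.idx]; omega) (seq (assign (by simp)
    (by simp [e1 .idx, h.idx]; omega) ?_)))
  refine seq (combine (w := 2 ^ d) hc hB hNB (by simp [e1 .N, h.N]) (by simp [e1 .w, h.w]) h0 hdvd
    (by simpa [e1 .idx, h.idx] using hb') (by simpa [e1 .idx, h.idx] using hb)
    fun σ₂ hS₂ hG₂ => ?_)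
  have e2 : ∀ x, x ∉ mulVars → x ≠ .u → x ≠ .r → σ₂.v x = σ.v x := by
    intro x hx h1 h2
    rw [hS₂.v x hx]; simp [h1, h2, e1 x hx]
  have ea2 : ∀ x, x ∉ ginvArrs ∨ x = .xa → σ₂.a x = σ.a x := by
    intro x hx
    rw [← ea x hx]
    simp only [ginvArrs, List.mem_cons, not_or] at hx
    rcases hx with hx | rfl
    · rw [hS₂.a x (by simp [hx])]; rfl
    · rw [hS₂.a .xa (by simp)]; rfl
  refine seq (assign (by simp) (by simp [e2 .lev, h.lev]; omega) (seq (assign (by simp)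
    (by simp [e2 .w, h.w]; omega) (assign (by simp) (by simp [e2 .idx, h.idx]; omega)
    (hQ _ ?_ ?_ ?_ _ rfl ?_)))))
  · constructor
    · simp [e2 .N, h.N]
    · simp [e2 .kk, h.kk]
    · simp [e2 .lev, h.lev]
    · simp [e2 .idx, h.idx]; omega
    · simp [e2 .w, h.w, hp]
    · simp [e2 .ph, h.ph]
  · refine Same.setV (Same.setV (Same.setV ?_ (by simp) _) (by simp) _) (by simp) _
    exact ⟨fun x hx => by
      simp only [ginvVars, List.mem_cons, not_or] at hx
      exact e2 x (by simp [hx]) hx.2.2.2.2.2.2.2.2.1 hx.2.2.2.2.2.2.2.2.2.1,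
      fun x hx => ea2 x (Or.inl hx), by rw [hS₂.pos]; exact hS.pos⟩
  · simp [ea2 .xa]
  · have hx1 : σ₁.a .xa = σ.a .xa := ea _ (Or.inr rfl)
    simp [h.idx, h.lev, lvl] at hG
    simp [e1 .idx, e1 .lev, h.idx, h.lev, lvl, hx1] at hG₂
    simp only [Store.setV_a]
    rw [hG₂, hG]
    rfl

/-- The program traverses the subtree at a node and computes a generalized inverse of its block. -/
theorem tree (hc : MatMulBy c κ T) (hB : (N + 2) ^ (κ + 1) ≤ E.B) (hNB : N * N ≤ E.B)
    (hN : N = 2 ^ k) (d : ℕ) : ∀ (_ : d ≤ k) (i : ℕ) (σ : Store) (t : ℕ) (Q : Store → Prop),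
      NodeAt N k d i 1 σ → (i + 1) * 2 ^ d ≤ N →
      (∀ σ', NodeAt N k d i 2 σ' → Same ginvVars ginvArrs σ σ' →
        (∀ p, d * (N * N) ≤ p → σ'.a .xa p = σ.a .xa p) →
        (1 - blockProj N (2 ^ d) i) * mat N (σ'.a .g) =
          (1 - blockProj N (2 ^ d) i) * mat N (σ.a .g) →
        lvl N σ d * blockProj N (2 ^ d) i * mat N (σ'.a .g) * (lvl N σ d * blockProj N (2 ^ d) i) =
          lvl N σ d * blockProj N (2 ^ d) i → Tri E (whileE ¢.ph (ginvStep c)) σ' t Q) →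
      Tri E (whileE ¢.ph (ginvStep c)) σ (t + treeTime c T N d) Q := by
  -- The statement is in continuation form: a subtree occupies only a segment of one long loop, so
  -- the hypothesis speaks about the rest of the loop started at the same node in phase 2. The
  -- remaining conditions say what recursion needs: higher levels of `xa` and rows of `g` outside
  -- the block are unchanged.
  induction d with
  | zero =>
    intro hd i σ t Q h hi hQ
    have hNB' : N ≤ E.B := (Nat.le_mul_self N).trans hNB
    refine (while_step (t₁ := 12 * cst * (N + 1) + cst + cst + cst) (t₂ := t) (by simp)
      (by simp [h.ph]) (iteE (by simp) (fun _ => iteE (by simp) (fun h' => by simp [h.lev] at h')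
      fun _ => seq (leaf h.N h.idx (by simpa using hi) hNB' fun σ₁ hS h1 h2 => ?_))
      fun h' => by simp [h.ph] at h')).time ?_
    · have e1 : ∀ x, x ∉ [Var.piv, Var.r, Var.q] → σ₁.v x = σ.v x := hS.v
      refine assign (by simp) (by have := E.hB; simp; omega) (hQ _ ?_ ?_ ?_ ?_ ?_)
      · constructor <;> simp [e1 .N, e1 .kk, e1 .lev, e1 .idx, e1 .w, h.N, h.kk, h.lev, h.idx, h.w]
      · exact hS.mono.setV (by simp) _
      · intro p _
        simp [hS.a .xa]
      · simpa using h1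
      · simpa using h2
    · simp only [treeTime]; ring_nf; omega
  | succ d ih =>
    intro hd i σ t Q h hi hQ
    have hp : 2 ^ (d + 1) = 2 * 2 ^ d := by ring
    have h0 : 0 < 2 ^ d := by positivity
    have hdvd : 2 ^ d ∣ N := by rw [hN]; exact pow_dvd_pow 2 (by omega)
    have hi1 : (2 * i + 1) * 2 ^ d ≤ N := by rw [hp] at hi; nlinarith
    have hi2 : (2 * i + 1 + 1) * 2 ^ d ≤ N := by
      rw [hp] at hi
      calc _ = (i + 1) * (2 * 2 ^ d) := by ring
        _ ≤ N := hi
    refine (while_step (t₁ := 10 * cst * (N * 2 ^ d + 1) + cst + cst) (t₂ := t + cst +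
      (2 * opTime c T N (2 ^ d) + 7 * cst + cst + cst + cst) + treeTime c T N d +
      (opTime c T N (2 ^ d) + 4 * cst + cst + cst + cst) + cst + treeTime c T N d) (by simp)
      (by simp [h.ph]) (iteE (by simp) (fun _ => iteE (by simp) (fun _ => descend h hi hNB
      fun σ₁ hn₁ hS₁ hX₁ hp₁ => ?_) fun h' => by simp [h.lev] at h')
      fun h' => by simp [h.ph] at h')).time ?_
    · refine ih (by omega) (2 * i) σ₁ _ Q hn₁ hi1 fun σ₂ hn₂ hS₂ hp₂ hf₂ hg₂ => ?_
      refine (while_step (t₁ := opTime c T N (2 ^ d) + 4 * cst + cst + cst + cst)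
        (t₂ := t + cst + (2 * opTime c T N (2 ^ d) + 7 * cst + cst + cst + cst) +
          treeTime c T N d) (by simp) (by simp [hn₂.ph]) (iteE (by simp)
        (fun h' => by simp [hn₂.ph] at h') fun _ => iteE (by simp)
        (fun h' => by simp [hn₂.lev, hn₂.kk] at h'; omega) fun _ => iteE (by simp)
        (fun h' => by simp [hn₂.idx] at h') fun _ => cross hc hB hNB hn₂ hdvd hi
        fun σ₃ hn₃ hS₃ hg₃ hX₃ hp₃ => ?_)).time (by omega)
      refine ih (by omega) (2 * i + 1) σ₃ _ Q hn₃ hi2 fun σ₄ hn₄ hS₄ hp₄ hf₄ hg₄ => ?_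
      refine (while_step (t₁ := 2 * opTime c T N (2 ^ d) + 7 * cst + cst + cst + cst)
        (t₂ := t) (by simp) (by simp [hn₄.ph]) (iteE (by simp)
        (fun h' => by simp [hn₄.ph] at h') fun _ => iteE (by simp)
        (fun h' => by simp [hn₄.lev, hn₄.kk] at h'; omega) fun _ => iteE (by simp)
        (fun _ => ascend hc hB hNB hn₄ hdvd hi fun σ₅ hn₅ hS₅ hx₅ G hG hG₅ => ?_)
        (fun h' => by simp [hn₄.idx] at h'))).time (by omega)
      have hdd : d * (N * N) ≤ (d + 1) * (N * N) := Nat.mul_le_mul_right _ (by omega)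
      have hx4 : ∀ p, (d + 1) * (N * N) ≤ p → σ₄.a .xa p = σ.a .xa p := fun p hp => by
        rw [hp₄ p (by omega), hp₃ p hp, hp₂ p (by omega), hp₁ p hp]
      have hl4 : lvl N σ₄ (d + 1) = lvl N σ (d + 1) := by
        ext R C; simp only [lvl, mat, Matrix.of_apply]; rw [hx4 _ (by omega)]
      have hl2 : lvl N σ₂ (d + 1) = lvl N σ (d + 1) := by
        ext R C; simp only [lvl, mat, Matrix.of_apply]; rw [hp₂ _ (by omega), hp₁ _ (by omega)]
      rw [hl4] at hG hG₅
      rw [hl2] at hX₃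
      rw [hg₃] at hf₄
      rw [hX₁] at hg₂
      rw [hX₃] at hg₄
      have hg1 : σ₁.a .g = σ.a .g := hS₁.a .g (by decide)
      rw [hg1] at hf₂
      refine hQ σ₅ hn₅ ?_ (fun p hp => by rw [hx₅, hx4 p hp]) ?_ ?_
      · exact ((((hS₁.mono (ys := ginvVars) (βs := ginvArrs)).trans hS₂ (zs := ginvVars)
          (γs := ginvArrs)).trans hS₃ (zs := ginvVars) (γs := ginvArrs)).trans hS₄
          (zs := ginvVars) (γs := ginvArrs)).trans hS₅ (zs := ginvVars) (γs := ginvArrs)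
      all_goals
        rw [hp, blockProj_double]
        -- From here on the projections and matrices are arbitrary elements of a ring in which `x +
        -- x = 0`.
        generalize hE1 : blockProj N (2 ^ d) (2 * i) = E1 at *
        generalize hE2 : blockProj N (2 ^ d) (2 * i + 1) = E2 at *
        have h11 : E1 * E1 = E1 := by rw [← hE1]; exact blockProj_mul_self _ _ _
        have h22 : E2 * E2 = E2 := by rw [← hE2]; exact blockProj_mul_self _ _ _
        have h12 : E1 * E2 = 0 := by rw [← hE1, ← hE2]; exact blockProj_mul_of_ne _ _ (by omega)
        have h21 : E2 * E1 = 0 := by rw [← hE1, ← hE2]; exact blockProj_mul_of_ne _ _ (by omega)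
        generalize hG0 : mat N (σ.a .g) = G0 at *
        generalize hG2 : mat N (σ₂.a .g) = G2 at *
        generalize hG4 : mat N (σ₄.a .g) = G4 at *
        generalize lvl N σ (d + 1) = X at *
        obtain ⟨ha, hb⟩ := ginv_step mat_add_self h11 h22 h12 h21 hf₂ hg₂ hf₄ hg₄ hG hG₅
      · exact ha
      · exact hb
    · simp only [treeTime]; ring_nf; omega

end Tri

end WordRAM


namespace WordRAM

namespace Tri

variable {E : Env} {σ : Store} {Q : Store → Prop} {N k κ : ℕ} {c : Cmd} {T : ℕ → ℕ}

/-- At the root the block is the whole matrix and its projection is the identity, so the invariant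
of the tree reads `X G X = X`. One more round of the loop recognizes the root and sets the phase to
0. -/
theorem ginv (hc : MatMulBy c κ T) (hB : (N + 2) ^ (κ + 1) ≤ E.B) (hNB : N * N ≤ E.B)
    (hN : N = 2 ^ k) (h : σ.v .N = N) (hk : σ.v .kk = k)
    (hQ : ∀ σ', Same ginvVars ginvArrs σ σ' →
      lvl N σ k * mat N (σ'.a .g) * lvl N σ k = lvl N σ k → Q σ') :
    Tri E (ginvC c) σ (treeTime c T N k + 9 * cst) Q := by
  have hNB' : N ≤ E.B := (Nat.le_mul_self N).trans hNB
  have hkN : k < N := hN ▸ Nat.lt_two_pow_self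
  have h1B := E.hB
  refine (seq (t₁ := cst) (t₂ := cst + (cst + (cst + (treeTime c T N k + 5 * cst))))
    (assign (by simp) (by simp [hk]; omega) ?_)).time (by omega)
  refine seq (assign (by simp) (by simp) ?_)
  refine seq (assign (by simp) (by simp [h]; omega) ?_)
  refine seq (assign (by simp) (by simp; omega) ?_)
  refine (tree (d := k) hc hB hNB hN le_rfl 0 _ (5 * cst) _ ?_ (by simp [hN])
    fun σ₁ hn hS _ _ hg => ?_).time (by omega)
  · constructor <;> simp [h, hk, hN]
  refine (while_step (t₁ := cst + cst + cst) (t₂ := cst) (by simp) (by simp [hn.ph])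
    (iteE (by simp) (fun h' => by simp [hn.ph] at h') fun _ => iteE (by simp)
    (fun _ => assign (by simp) (by simp) (while_done (by simp) (by simp) (hQ _ ?_ ?_)))
    fun h' => by simp [hn.lev, hn.kk] at h')).time (by omega)
  · have h1 : Same ginvVars ginvArrs σ σ₁ := ⟨fun x hx => by
      rw [hS.v x hx]
      simp only [ginvVars, List.mem_cons, not_or] at hx
      simp [hx], hS.a, hS.pos⟩
    exact h1.setV (by simp) _
  · rw [← hN, blockProj_zero, mul_one] at hg
    exact hg

end Tri
end WordRAM


namespace WordRAM

/-! ### Operations on whole matrices -/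

/-- Fill the `N × N` matrix `α` with the parities of the values of `e`, at the index `q`. -/
def fillC (α : Arr) (e : Expr) : Cmd := scatter .q (¢.N * ¢.N) α ¢.q (e % 2)

/-- Fill the top level of `xa`. -/
def fillX (α : Arr) : Cmd :=
  scatter .q (¢.N * ¢.N) .xa (¢.kk * (¢.N * ¢.N) + ¢.q) (.rd α ¢.q % 2)

/-- Multiply two matrices with entries given by expressions. -/
def mulF (c : Cmd) (e₁ e₂ : Expr) : Cmd :=
  .seq (fillC .px e₁) (.seq (fillC .py e₂) (.seq (assign .w ¢.N) (.seq (dims 1 1 1) (mulC c))))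

/-- The variables that the multiplication of matrices uses. -/
abbrev mulFVars : List Var := [.t, .ia, .ic, .ib, .q, .ra, .rb, .rc, .w]

/-- The arrays that the multiplication of matrices uses. -/
abbrev mulFArrs : List Arr := [.vm, .acc, .pz, .px, .py]

/-- The store, while the entry `(r, c)` of `α` is computed. -/
structure Entry (N : ℕ) (σ : Store) (α : Arr) (r c : Fin N) (σ' : Store) : Prop where
  same : Same [.q] [α] σ σ'
  div : σ'.v .q / N = r
  mod : σ'.v .q % N = c
  q : σ'.v .q = r * N + c
  N : σ'.v .N = N

namespace Tri

variable {E : Env} {σ : Store} {Q : Store → Prop} {N κ : ℕ} {c : Cmd} {T : ℕ → ℕ}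

/-- Correctness of entries is stated modulo 2, which is all that `mat` sees. The bound by 2 is
recorded separately because the output must consist of the bits themselves. -/
theorem fill {α : Arr} {e : Expr} (M : Matrix (Fin N) (Fin N) (ZMod 2)) (hN : σ.v .N = N)
    (hNB : N * N ≤ E.B) (hd : e.deg ≤ 80) (hα : α ≠ .io)
    (he : ∀ (r c : Fin N) (σ' : Store), Entry N σ α r c σ' → (e.eval σ' : ZMod 2) = M r c)
    (hQ : ∀ σ', Same [.q] [α] σ σ' → mat N (σ'.a α) = M →
      (∀ i < N * N, σ'.a α i < 2) → Q σ') :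
    Tri E (fillC α e) σ ((N * N + 1) * (3 * cst)) Q := by
  let g : ℕ → ℕ := fun q => if h : 0 < N then
    if h' : q / N < N then (M ⟨q / N, h'⟩ ⟨q % N, Nat.mod_lt _ h⟩).val else 0 else 0
  have hg : ∀ r c : Fin N, g (r * N + c) = (M r c).val := by
    intro r c
    have h0 : 0 < N := r.pos
    simp [g, h0, (div_mod_block c.2).1, (div_mod_block c.2).2]
  have hdec : ∀ i < N * N, ∃ r c : Fin N, i = r * N + c := by
    intro i hi
    have h0 : 0 < N := by by_contra h; simp [Nat.le_zero.1 (not_lt.1 h)] at hi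
    exact ⟨⟨i / N, Nat.div_lt_of_lt_mul hi⟩, ⟨i % N, Nat.mod_lt _ h0⟩, (Nat.div_add_mod' i N).symm⟩
  have hg2 : ∀ i < N * N, g i < 2 := by
    intro i hi
    obtain ⟨r, c, rfl⟩ := hdec i hi
    rw [hg]; exact ZMod.val_lt _
  refine scatter (N * N) id g (by simp) (by simp) (by simp; omega) hNB hα (by simp [hN]) (by simp)
    (by simp) (fun i hi h _ _ => ?_) (fun i hi => ?_) fun h h1 _ => hQ _ ?_ ?_ ?_
  · obtain ⟨r, c, rfl⟩ := hdec i hi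
    have := he r c ((σ.setV .q (r * N + c)).setA α h) ⟨((Same.refl _ _ _).setV (by simp) _).setA
      (by simp) _, by simp [(div_mod_block c.2).1], by simp [(div_mod_block c.2).2], by simp,
      by simp [hN]⟩
    rw [hg, ← this, Expr.eval_mod, Expr.eval_ofNat, ZMod.val_natCast]
  · have := hg2 i hi; have := E.hB; omega
  · exact ((Same.refl _ _ _).setV (by simp) _).setA (by simp) _
  · ext r c
    simp only [mat, Matrix.of_apply, Store.setA_a, if_true]
    have := h1 (r * N + c) (index_lt r.2 c.2)
    simp only [id] at this
    rw [this, hg]; simp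
  · intro i hi
    simp only [Store.setA_a, if_true]
    have := h1 i hi
    simp only [id] at this
    rw [this]; exact hg2 i hi

theorem fillX {α : Arr} {k : ℕ} (hN : σ.v .N = N) (hk : σ.v .kk = k) (hNB : N * N ≤ E.B)
    (hα : α ≠ .xa)
    (hQ : ∀ σ', Same [.q] [.xa] σ σ' → lvl N σ' k = mat N (σ.a α) → Q σ') :
    Tri E (fillX α) σ ((N * N + 1) * (3 * cst)) Q := by
  refine scatter (N * N) (fun q => k * (N * N) + q) (fun q => σ.a α q % 2) (by simp) (by simp)
    (by simp) hNB (by simp) (by simp [hN]) (by simp) (by simp [hN, hk]) (by simp [hα])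
    (fun _ _ => E.mod_two_le _) fun h h1 _ => hQ _ ?_ ?_
  · exact ((Same.refl _ _ _).setV (by simp) _).setA (by simp) _
  · ext r c
    simp only [lvl, mat, Matrix.of_apply, Store.setA_a, if_true]
    rw [h1 _ (index_lt r.2 c.2), cast_mod_two]

/-- A product of full matrices is the block product with a single block of width `N`. Both factors
are given by expressions, which covers transposes and sums without further programs. -/
theorem mulF (hc : MatMulBy c κ T) (hB : (N + 2) ^ (κ + 1) ≤ E.B) (hNB : N * N ≤ E.B)
    (h1N : 1 ≤ N) {e₁ e₂ : Expr} (M₁ M₂ : Matrix (Fin N) (Fin N) (ZMod 2)) (hN : σ.v .N = N)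
    (hd₁ : e₁.deg ≤ 80) (hd₂ : e₂.deg ≤ 80)
    (he₁ : ∀ (r c : Fin N) (σ' : Store), Entry N σ .px r c σ' → (e₁.eval σ' : ZMod 2) = M₁ r c)
    (he₂ : ∀ (r c : Fin N) (σ₁ σ' : Store), Same [.q] [.px] σ σ₁ → Entry N σ₁ .py r c σ' →
      (e₂.eval σ' : ZMod 2) = M₂ r c)
    (hQ : ∀ σ', Same mulFVars mulFArrs σ σ' → mat N (σ'.a .pz) = M₁ * M₂ → Q σ') :
    Tri E (mulF c e₁ e₂) σ (blkTime c T N + 20 * cst * (N * N + 1)) Q := by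
  have hNB' : N ≤ E.B := (Nat.le_mul_self N).trans hNB
  have h1B : 1 ≤ E.B := by omega
  refine (seq (t₂ := (N * N + 1) * (3 * cst) + (cst + (3 * cst +
    (1 * 1 * 1 * blkTime c T N + 3 * cst)))) (fill M₁ hN hNB hd₁ (by simp) he₁
    fun σ₁ hS₁ hp₁ _ => ?_)).time (by ring_nf; omega)
  refine seq (fill M₂ (by simp [hS₁.v .N, hN]) hNB hd₂ (by simp) (fun r c σ' => he₂ r c σ₁ σ' hS₁)
    fun σ₂ hS₂ hp₂ _ => ?_)
  have hN₂ : σ₂.v .N = N := by simp [hS₂.v .N, hS₁.v .N, hN]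
  refine seq (assign (by simp) (by simpa [hN₂] using hNB') ?_)
  refine seq (dims (x := 1) (y := 1) (z := 1) (by simp) (by simp) (by simp) (by simp)
      (by simp) (by simp) h1B h1B h1B ?_)
  refine Tri.mul hc hB hNB (w := N) (ra := 1) (rb := 1) (rc := 1) (by simp [hN₂])
      (by simp [hN₂]) (by simp) (by simp) (by simp) h1N le_rfl le_rfl (by simp)
      (by simp) (by simp) fun σ₃ hS₃ hp₃ => hQ _ ⟨fun x hx => ?_, fun x hx => ?_, ?_⟩ ?_
  · simp only [mulFVars, List.mem_cons, not_or] at hx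
    simp [hS₃.v x, hS₂.v x, hS₁.v x, hx]
  · simp only [List.mem_cons, not_or] at hx
    simp [hS₃.a x, hS₂.a x, hS₁.a x, hx]
  · simp [hS₃.pos, hS₂.pos, hS₁.pos]
  · ext r c
    rw [Matrix.mul_apply, ← hp₁, ← hp₂]
    simp only [mat, Matrix.of_apply]
    rw [hp₃ r (by simp) c (by simp), one_mul, ← sum_fin_eq_range]
    simp [hS₂.a .px]

end Tri

end WordRAM


namespace WordRAM

/-! ### The sampling algorithm -/

/-- The row of the current entry. -/
abbrev row : Expr := ¢.q / ¢.N
/-- The column of the current entry. -/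
abbrev col : Expr := ¢.q % ¢.N
/-- The position of the transposed entry. -/
abbrev tr : Expr := col * ¢.N + row

/-- Compute the right hand sides `bm` of the equations for the measurement outcomes. -/
def rhsC (c : Cmd) : Cmd :=
  .seq (mulF c (.rd .dm ¢.q) (.rd .cm tr))
  (.seq (fillC .uu (Expr.lt col row * (.rd .pz ¢.q + .rd .pv row * .rd .pv col) +
    Expr.eq row col * (.rd .sv row + .rd .pz ¢.q)))
  (.seq (fillX .cm) (.seq (ginvC c) (.seq (mulF c (.rd .cm ¢.q) (.rd .g ¢.q))
  (.seq (fillC .km (.rd .pz ¢.q + Expr.eq row col))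
  (.seq (mulF c (.rd .km ¢.q) (.rd .uu ¢.q)) (.seq (mulF c (.rd .pz ¢.q) (.rd .km tr))
  (.seq (fillC .wd (.rd .pz ¢.q)) (.seq (mulF c (.rd .dm ¢.q) (Expr.eq (.rd .post row) 1))
  (fillC .bm (.rd .wd (row * ¢.N + row) + .rd .pz ¢.q)))))))))))

/-- The coefficients of the equations for the measurement outcomes. -/
def coeffC : Cmd :=
  fillC .am (Expr.lt col ¢.n * (Expr.eq (.rd .post col) 2 * .rd .dm ¢.q) +
    (1 - Expr.lt col ¢.n) * .rd .cm (row * ¢.N + (col - ¢.n)))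

/-- Compare `pz` and `bm`. -/
def flagC : Cmd :=
  .seq (assign .flag 1) (forC .t (¢.N * ¢.N)
    (assign .flag (¢.flag * Expr.eq (.rd .pz ¢.t % 2) (.rd .bm ¢.t % 2))))

/-- Write the output. -/
def outC : Cmd :=
  .seq (storeA .io 0 ¢.flag) (forC .t ¢.n (storeA .io (¢.t + 1) (.rd .gb (¢.t * ¢.N))))

/-- Prepare the solution of the equations. -/
def prepC (c : Cmd) : Cmd := .seq coeffC (.seq (fillX .am) (ginvC c))

/-- Compute and output a random solution of the equations. -/
def drawC (c : Cmd) : Cmd :=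
  .seq (mulF c (.rd .g ¢.q) (.rd .bm ¢.q)) (.seq (mulF c (.rd .am ¢.q) (.rd .pz ¢.q)) (.seq flagC
  (.seq (mulF c (.rd .am ¢.q) (.rd .rnd row))
  (.seq (mulF c (.rd .g ¢.q) (.rd .bm ¢.q + .rd .pz ¢.q))
  (.seq (fillC .gb (.rd .pz ¢.q + .rd .rnd row)) outC)))))

/-- The matrix of the quadratic form that describes the signs of the products of the generators. -/
def formMat {N : ℕ} (C D : Matrix (Fin N) (Fin N) (ZMod 2)) (p s : Fin N → ZMod 2) :
    Matrix (Fin N) (Fin N) (ZMod 2) :=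
  -- Off the diagonal stands the sign from moving `Z^(D_i)` past `X^(C_j)`, and `p i * p j` from
  -- `i^(p i) i^(p j)`, whose exponents are only added modulo 2. On the diagonal stand the sign bit
  -- and the order of `X` and `Z` within one generator.
  Matrix.of fun i j => if j < i then (D * C.transpose) i j + p i * p j
    else if i = j then s i + (D * C.transpose) i j else 0

/-- The right hand side of the equations that describe the support of a stabilizer state. -/
def offset {N : ℕ} (C D : Matrix (Fin N) (Fin N) (ZMod 2)) (p s : Fin N → ZMod 2)
    (G : Matrix (Fin N) (Fin N) (ZMod 2)) (r : Fin N) : ZMod 2 :=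
  -- If `C G C = C`, row `r` of `1 + C G` is an exponent vector whose product of generators is
  -- diagonal; its sign is the value of the quadratic form at that row.
  ((1 + C * G) * formMat C D p s * (1 + C * G).transpose) r r

/-- The variables of the sampling algorithm, except the dimensions. -/
abbrev coreVars : List Var :=
  [.t, .ia, .ic, .ib, .q, .ra, .rb, .rc, .u, .r, .piv, .lev, .idx, .ph, .w, .flag]

/-- The arrays of the sampling algorithm, except its input and output. -/
abbrev coreArrs : List Arr :=
  [.vm, .acc, .pz, .px, .py, .xa, .g, .uu, .km, .wd, .bm, .am, .gb]

theorem apply_of_mat_eq {N : ℕ} {f : ℕ → ℕ} {M : Matrix (Fin N) (Fin N) (ZMod 2)} (h : mat N f = M)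
    (r c : Fin N) : (f (r * N + c) : ZMod 2) = M r c := h ▸ rfl

/-- The matrix all of whose columns are equal to `v`. -/
def cols {N : ℕ} (v : Fin N → ZMod 2) : Matrix (Fin N) (Fin N) (ZMod 2) := Matrix.of fun r _ => v r

/-- The vector stored in an array. -/
def vec (N : ℕ) (f : ℕ → ℕ) : Fin N → ZMod 2 := fun r => (f r : ZMod 2)

namespace Tri

variable {E : Env} {σ : Store} {Q : Store → Prop} {N κ k : ℕ} {c : Cmd} {T : ℕ → ℕ}

/-- The inverse `G` found by the program is not unique, so it is passed on together with its
defining equation. Vectors are stored as matrices with equal columns, so that the routine for matrix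
products also handles matrix-vector products; the order of the running time does not suffer. -/
theorem rhs (hc : MatMulBy c κ T) (hB : (N + 2) ^ (κ + 1) ≤ E.B) (hNB : N * N ≤ E.B)
    (hk : N = 2 ^ k) (hN : σ.v .N = N) (hkk : σ.v .kk = k)
    (hQ : ∀ σ', Same coreVars coreArrs σ σ' →
      ∀ C D G : Matrix (Fin N) (Fin N) (ZMod 2), C = mat N (σ.a .cm) → D = mat N (σ.a .dm) →
      C * G * C = C →
      mat N (σ'.a .bm) = cols (offset C D (vec N (σ.a .pv)) (vec N (σ.a .sv)) G) +
        D * cols (fun j => if σ.a .post j = 1 then 1 else 0) → Q σ') :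
    Tri E (rhsC c) σ (5 * blkTime c T N + treeTime c T N k + 130 * cst * (N * N + 1)) Q := by
  have h1N : 1 ≤ N := hk ▸ Nat.one_le_two_pow
  refine (seq (t₂ := (N * N + 1) * (3 * cst) + ((N * N + 1) * (3 * cst) +
    ((treeTime c T N k + 9 * cst) + ((blkTime c T N + 20 * cst * (N * N + 1)) +
    ((N * N + 1) * (3 * cst) + ((blkTime c T N + 20 * cst * (N * N + 1)) +
    ((blkTime c T N + 20 * cst * (N * N + 1)) + ((N * N + 1) * (3 * cst) +
    ((blkTime c T N + 20 * cst * (N * N + 1)) + ((N * N + 1) * (3 * cst)))))))))))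
    (mulF hc hB hNB h1N (mat N (σ.a .dm)) (mat N (σ.a .cm)).transpose hN (by simp) (by simp)
    (fun r c σ' h => by simp [h.q, h.same.a .dm, mat])
    (fun r c σ₁ σ' hS h => by simp [h.mod, h.div, h.N, h.same.a .cm, hS.a .cm, mat])
    fun σ₁ hS₁ hp₁ => ?_)).time (by ring_nf; omega)
  have hT₁ : Same coreVars coreArrs σ σ₁ := hS₁.mono
  refine seq (fill (formMat (mat N (σ.a .cm)) (mat N (σ.a .dm)) (vec N (σ.a .pv))
    (vec N (σ.a .sv))) (by simp [hT₁.v .N, hN]) hNB (by simp) (by simp)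
    (fun r c σ' h => ?_) fun σ₂ hS₂ hp₂ _ => ?_)
  · simp only [Expr.eval_add, Expr.eval_mul, Expr.eval_lt, Expr.eval_eq, Expr.eval_rd,
      Expr.eval_div, Expr.eval_mod, Expr.eval_var, h.N, h.q, (div_mod_block c.2).1, (div_mod_block c.2).2, h.same.a .pz (by simp),
      h.same.a .pv (by simp), h.same.a .sv (by simp), hT₁.a .pv (by simp), hT₁.a .sv (by simp),
      Nat.cast_add, Nat.cast_mul, Nat.cast_ite, Nat.cast_one, Nat.cast_zero,
      apply_of_mat_eq hp₁ r c, formMat, Matrix.of_apply, vec, Fin.lt_def, Fin.ext_iff]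
    by_cases h1 : (c : ℕ) < r
    · have h2 : ¬ (r : ℕ) = c := by omega
      simp [h1, h2]
    · simp [h1]
  have hT₂ : Same coreVars coreArrs σ σ₂ := hT₁.trans (hS₂.mono (ys := coreVars) (βs := coreArrs))
  refine seq (fillX (N := N) (k := k) (by simp [hT₂.v .N, hN]) (by simp [hT₂.v .kk, hkk]) hNB (by simp)
    fun σ₃ hS₃ hp₃ => ?_)
  have hT₃ : Same coreVars coreArrs σ σ₃ := hT₂.trans (hS₃.mono (ys := coreVars) (βs := coreArrs))
  refine seq (ginv hc hB hNB hk (by simp [hT₃.v .N, hN]) (by simp [hT₃.v .kk, hkk])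
    fun σ₄ hS₄ hp₄ => ?_)
  rw [hp₃, hT₂.a .cm (by simp)] at hp₄
  have hT₄ : Same coreVars coreArrs σ σ₄ := hT₃.trans (hS₄.mono (ys := coreVars) (βs := coreArrs))
  have hu₄ : σ₄.a .uu = σ₂.a .uu := by rw [hS₄.a .uu (by simp), hS₃.a .uu (by simp)]
  set C := mat N (σ.a .cm) with hC
  set D := mat N (σ.a .dm) with hD
  set G := mat N (σ₄.a .g) with hG
  refine seq (mulF hc hB hNB h1N C G (by simp [hT₄.v .N, hN]) (by simp) (by simp)
    (fun r c σ' h => by simp [h.q, h.same.a .cm, hT₄.a .cm, hC, mat])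
    (fun r c σ₁ σ' hS h => by simp [h.q, h.same.a .g, hS.a .g, hG, mat])
    fun σ₅ hS₅ hp₅ => ?_)
  have hT₅ : Same coreVars coreArrs σ σ₅ := hT₄.trans (hS₅.mono (ys := coreVars) (βs := coreArrs))
  refine seq (fill (1 + C * G) (by simp [hT₅.v .N, hN]) hNB (by simp) (by simp)
    (fun r c σ' h => ?_) fun σ₆ hS₆ hp₆ _ => ?_)
  · simp [(div_mod_block c.2).1, Nat.mod_eq_of_lt c.2, h.N, h.q, h.same.a .pz, apply_of_mat_eq hp₅ r c, Matrix.one_apply,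
      Fin.ext_iff]
    exact add_comm _ _
  have hT₆ : Same coreVars coreArrs σ σ₆ := hT₅.trans (hS₆.mono (ys := coreVars) (βs := coreArrs))
  have hu₆ : σ₆.a .uu = σ₂.a .uu := by rw [hS₆.a .uu (by simp), hS₅.a .uu (by simp), hu₄]
  set K := 1 + C * G with hK
  set U := formMat C D (vec N (σ.a .pv)) (vec N (σ.a .sv)) with hU
  refine seq (mulF hc hB hNB h1N K U (by simp [hT₆.v .N, hN]) (by simp) (by simp)
    (fun r c σ' h => by simp [h.q, h.same.a .km, apply_of_mat_eq hp₆])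
    (fun r c σ₁ σ' hS h => by simp [h.q, h.same.a .uu, hS.a .uu, hu₆, apply_of_mat_eq hp₂])
    fun σ₇ hS₇ hp₇ => ?_)
  have hT₇ : Same coreVars coreArrs σ σ₇ := hT₆.trans (hS₇.mono (ys := coreVars) (βs := coreArrs))
  have hk₇ : σ₇.a .km = σ₆.a .km := hS₇.a .km (by simp)
  refine seq (mulF hc hB hNB h1N (K * U) K.transpose (by simp [hT₇.v .N, hN]) (by simp) (by simp)
    (fun r c σ' h => by simp [h.q, h.same.a .pz, apply_of_mat_eq hp₇])
    (fun r c σ₁ σ' hS h => by simp [h.mod, h.div, h.N, h.same.a .km, hS.a .km, hk₇,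
      apply_of_mat_eq hp₆]) fun σ₈ hS₈ hp₈ => ?_)
  have hT₈ : Same coreVars coreArrs σ σ₈ := hT₇.trans (hS₈.mono (ys := coreVars) (βs := coreArrs))
  refine seq (fill (K * U * K.transpose) (by simp [hT₈.v .N, hN]) hNB (by simp) (by simp)
    (fun r c σ' h => by simp [h.q, h.same.a .pz, apply_of_mat_eq hp₈]) fun σ₉ hS₉ hp₉ _ => ?_)
  have hT₉ : Same coreVars coreArrs σ σ₉ := hT₈.trans (hS₉.mono (ys := coreVars) (βs := coreArrs))
  refine seq (mulF hc hB hNB h1N D (cols fun j => if σ.a .post j = 1 then 1 else 0)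
    (by simp [hT₉.v .N, hN]) (by simp) (by simp)
    (fun r c σ' h => by simp [h.q, h.same.a .dm, hT₉.a .dm, hD, mat])
    (fun r c σ₁ σ' hS h => by simp [cols, h.div, h.N, h.same.a .post, hS.a .post, hT₉.a .post])
    fun σ' hS hp => ?_)
  have hT : Same coreVars coreArrs σ σ' := hT₉.trans (hS.mono (ys := coreVars) (βs := coreArrs))
  refine fill (cols (offset C D (vec N (σ.a .pv)) (vec N (σ.a .sv)) G) +
    D * cols fun j => if σ.a .post j = 1 then 1 else 0) (by simp [hT.v .N, hN]) hNB (by simp) (by simp)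
    (fun r c τ h => ?_) fun τ hS' hp' _ => hQ τ ?_ C D G hC hD hp₄ hp'
  · simp [(div_mod_block c.2).1, h.N, h.q, h.same.a .wd, h.same.a .pz, hS.a .wd, apply_of_mat_eq hp₉,
      apply_of_mat_eq hp, Matrix.add_apply, cols, offset, hK, hU]
  · exact hT.trans (hS'.mono (ys := coreVars) (βs := coreArrs))

end Tri

end WordRAM


/-! ### The linear system for the outcomes and its random solution. -/

namespace WordRAM

/-- The coefficients of the equations for the outcomes and the auxiliary unknowns. -/
def coeff {N : ℕ} (n : ℕ) (C D : Matrix (Fin N) (Fin N) (ZMod 2)) (post : ℕ → ℕ) :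
    Matrix (Fin N) (Fin N) (ZMod 2) :=
  Matrix.of fun r c => if (c : ℕ) < n then if post c = 2 then D r c else 0
    else C r ⟨c - n, by omega⟩

namespace Tri

variable {E : Env} {σ : Store} {Q : Store → Prop} {N κ k n : ℕ} {c : Cmd} {T : ℕ → ℕ}

theorem coeff (hNB : N * N ≤ E.B) (hN : σ.v .N = N) (hn : σ.v .n = n)
    (hQ : ∀ σ', Same [.q] [.am] σ σ' →
      mat N (σ'.a .am) = coeff n (mat N (σ.a .cm)) (mat N (σ.a .dm)) (σ.a .post) → Q σ') :
    Tri E coeffC σ ((N * N + 1) * (3 * cst)) Q := by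
  refine fill _ hN hNB (by simp) (by simp) (fun r c σ' h => ?_) fun σ' hS hp _ => hQ σ' hS hp
  have e1 := (div_mod_block c.2 (i := r)).1
  have e2 := (div_mod_block c.2 (i := r)).2
  simp only [Expr.eval_add, Expr.eval_sub, Expr.eval_mul, Expr.eval_lt, Expr.eval_eq, Expr.eval_rd,
    Expr.eval_div, Expr.eval_mod, Expr.eval_var, Expr.eval_ofNat, h.N, h.q, e1, e2,
    h.same.v .n (by simp), hn, h.same.a .post (by simp), h.same.a .cm (by simp),
    h.same.a .dm (by simp), WordRAM.coeff, mat, Matrix.of_apply]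
  split_ifs <;> simp

theorem flag (hNB : N * N ≤ E.B) (hN : σ.v .N = N)
    (hQ : ∀ σ', Same [.t, .flag] [] σ σ' →
      σ'.v .flag = (if mat N (σ.a .pz) = mat N (σ.a .bm) then 1 else 0) → Q σ') :
    Tri E flagC σ (N * N * (3 * cst) + 3 * cst) Q := by
  have h1B : 1 ≤ E.B := by have := E.hB; omega
  have hmod : ∀ a b : ℕ, (a % 2 = b % 2) ↔ (a : ZMod 2) = b := fun a b =>
    (ZMod.natCast_eq_natCast_iff a b 2).symm
  refine (seq (t₁ := cst) (t₂ := N * N * (cst + 2 * cst) + 2 * cst) (assign (by simp)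
    (by simpa using h1B) (forC (m := N * N)
    (fun j σ' => σ'.v .t = j ∧ Same [.t, .flag] [] σ σ' ∧ σ'.v .flag =
      (if ∀ i < j, (σ.a .pz i : ZMod 2) = σ.a .bm i then 1 else 0)) (by simp) hNB ?_ ?_ ?_ ?_))).time
      (by ring_nf; omega)
  · rintro j _ σ' ⟨h1, h2, -⟩
    exact ⟨h1, by simp [h2.v .N, hN]⟩
  · exact ⟨by simp, ((Same.refl _ _ _).setV (by simp) _).setV (by simp) _, by simp⟩
  · rintro j hj σ' ⟨h1, h2, h3⟩
    have e : (¢Var.flag * Expr.eq (.rd .pz ¢.t % 2) (.rd .bm ¢.t % 2)).eval σ' =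
        if ∀ i < j + 1, (σ.a .pz i : ZMod 2) = σ.a .bm i then 1 else 0 := by
      simp only [Nat.forall_lt_succ_right, Expr.eval_mul, Expr.eval_eq, Expr.eval_mod,
        Expr.eval_rd, Expr.eval_var, Expr.eval_ofNat, h1, h3, h2.a .pz (by simp),
        h2.a .bm (by simp), hmod]
      split_ifs <;> simp_all
    refine assign (by simp) ?_ ⟨by simp [h1], by simp, (h2.setV (by simp) _).setV (by simp) _, ?_⟩
    · rw [e]; split_ifs <;> omega
    · rw [e]; simp
  · rintro σ' ⟨h1, h2, h3⟩
    refine hQ σ' h2 ?_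
    rw [h3]
    congr 1
    apply propext
    constructor
    · intro h
      ext r c
      exact h _ (index_lt r.2 c.2)
    · intro h i hi
      have h0 : 0 < N := by by_contra h; simp [Nat.le_zero.1 (not_lt.1 h)] at hi
      have := apply_of_mat_eq h ⟨i / N, Nat.div_lt_of_lt_mul hi⟩ ⟨i % N, Nat.mod_lt _ h0⟩
      simpa [mat, Nat.div_add_mod'] using this

theorem out (hNB : N * N ≤ E.B) (hN : σ.v .N = N) (hn : σ.v .n = n) (hnN : n ≤ N)
    (hL : n + 1 ≤ E.L) (hQ : ∀ σ', σ'.a .io 0 = σ.v .flag →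
      (∀ v < n, σ'.a .io (v + 1) = σ.a .gb (v * N)) → Q σ') :
    Tri E outC σ (n * (3 * cst) + 3 * cst) Q := by
  have hNB' : N ≤ E.B := (Nat.le_mul_self N).trans hNB
  refine bdd fun hv ha => ?_
  refine (seq (t₁ := cst) (t₂ := n * (cst + 2 * cst) + 2 * cst) (storeA (by simp) (by simp)
    (fun _ => by simp; omega) (by simpa using hv _) (forC (m := n)
    (fun j σ' => σ'.v .t = j ∧ σ'.v .N = N ∧ σ'.v .n = n ∧ σ'.a .gb = σ.a .gb ∧
      σ'.a .io 0 = σ.v .flag ∧ ∀ v < j, σ'.a .io (v + 1) = σ.a .gb (v * N))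
    (by simp) (by omega) ?_ ?_ ?_ ?_))).time (by ring_nf; omega)
  · rintro j _ σ' ⟨h1, -, h2, -⟩
    exact ⟨h1, by simp [h2]⟩
  · simp [hN, hn]
  · rintro j hj σ' ⟨h1, h2, h3, h4, h5, h6⟩
    refine storeA (by simp) (by simp) (fun _ => by simp [h1]; omega) (by simp [h4]; exact ha _ _)
      ⟨by simp [h1], by simp, by simp [h2], by simp [h3], by simp [h4], by simp [h1, h5], ?_⟩
    intro v hv'
    simp only [Store.setV_a, Store.setA_a, if_true, Expr.eval_add, Expr.eval_var, Expr.eval_ofNat,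
      h1, Expr.eval_rd, Expr.eval_mul, h2, h4]
    rcases Nat.lt_succ_iff_lt_or_eq.1 hv' with h | rfl
    · rw [Function.update_of_ne (by omega), h6 v h]
    · simp
  · rintro σ' ⟨-, -, -, -, h5, h6⟩
    exact hQ σ' h5 h6

/-- The generalized inverse of the coefficient matrix is computed before any coin is tossed. -/
theorem prep (hc : MatMulBy c κ T) (hB : (N + 2) ^ (κ + 1) ≤ E.B) (hNB : N * N ≤ E.B)
    (hk : N = 2 ^ k) (hN : σ.v .N = N) (hkk : σ.v .kk = k) (hn : σ.v .n = n)
    (hQ : ∀ σ' : Store, Same coreVars coreArrs σ σ' → σ'.a .bm = σ.a .bm →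
      ∀ A : Matrix (Fin N) (Fin N) (ZMod 2),
      A = WordRAM.coeff n (mat N (σ.a .cm)) (mat N (σ.a .dm)) (σ.a .post) →
      mat N (σ'.a .am) = A → A * mat N (σ'.a .g) * A = A → Q σ') :
    Tri E (prepC c) σ (treeTime c T N k + 20 * cst * (N * N + 1)) Q := by
  refine (seq (t₂ := (N * N + 1) * (3 * cst) + (treeTime c T N k + 9 * cst))
    (coeff hNB hN hn fun σ₁ hS₁ hp₁ => ?_)).time (by ring_nf; omega)
  have hT₁ : Same coreVars coreArrs σ σ₁ := hS₁.mono
  refine seq (fillX (N := N) (k := k) (by simp [hT₁.v .N, hN]) (by simp [hT₁.v .kk, hkk]) hNB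
    (by simp) fun σ₂ hS₂ hp₂ => ?_)
  have hT₂ : Same coreVars coreArrs σ σ₂ := hT₁.trans (hS₂.mono (ys := coreVars) (βs := coreArrs))
  refine ginv hc hB hNB hk (by simp [hT₂.v .N, hN]) (by simp [hT₂.v .kk, hkk])
    fun σ₃ hS₃ hp₃ => ?_
  rw [hp₂] at hp₃
  refine hQ σ₃ (hT₂.trans (hS₃.mono (ys := coreVars) (βs := coreArrs))) ?_ _ hp₁ ?_ hp₃
  · rw [hS₃.a .bm (by simp), hS₂.a .bm (by simp), hS₁.a .bm (by simp)]
  · rw [hS₃.a .am (by simp), hS₂.a .am (by simp)]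

/-- With `A G A = A`, the test `A G b = b` decides solvability, and `G (b + A ρ) + ρ` is the random
solution. Here `ρ` is the vector of coins; as all columns agree, column 0 is written to the output.
-/
theorem draw (hc : MatMulBy c κ T) (hB : (N + 2) ^ (κ + 1) ≤ E.B) (hNB : N * N ≤ E.B)
    (h1N : 1 ≤ N) (hN : σ.v .N = N) (hn : σ.v .n = n) (hnN : n ≤ N) (hL : n + 1 ≤ E.L)
    (hQ : ∀ σ' : Store, ∀ A b G : Matrix (Fin N) (Fin N) (ZMod 2),
      A = mat N (σ.a .am) → b = mat N (σ.a .bm) → G = mat N (σ.a .g) →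
      (σ'.a .io 0 = if A * (G * b) = b then 1 else 0) →
      (∀ v (hv : v < n), σ'.a .io (v + 1) = ((G * (b + A * cols (vec N (σ.a .rnd))) +
        cols (vec N (σ.a .rnd))) ⟨v, by omega⟩ ⟨0, by omega⟩).val) → Q σ') :
    Tri E (drawC c) σ (4 * blkTime c T N + 100 * cst * (N * N + 1)) Q := by
  have hNN : N ≤ N * N := Nat.le_mul_self N
  set R := cols (vec N (σ.a .rnd)) with hR
  generalize hA : mat N (σ.a .am) = A at *
  generalize hb : mat N (σ.a .bm) = b at *
  generalize hG : mat N (σ.a .g) = G at *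
  refine (seq (t₂ := (blkTime c T N + 20 * cst * (N * N + 1)) + ((N * N * (3 * cst) + 3 * cst) +
    ((blkTime c T N + 20 * cst * (N * N + 1)) + ((blkTime c T N + 20 * cst * (N * N + 1)) +
    ((N * N + 1) * (3 * cst) + (n * (3 * cst) + 3 * cst))))))
    (mulF hc hB hNB h1N G b hN (by simp) (by simp)
    (fun r c σ' h => by simp [h.q, h.same.a .g, apply_of_mat_eq hG])
    (fun r c σ₁ σ' hS h => by simp [h.q, h.same.a .bm, hS.a .bm, apply_of_mat_eq hb])
    fun σ₄ hS₄ hp₄ => ?_)).time ?_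
  swap
  · have : n * cst ≤ N * N * cst := Nat.mul_le_mul_right _ (hnN.trans hNN)
    ring_nf at this ⊢; omega
  have hT₄ : Same coreVars coreArrs σ σ₄ := hS₄.mono
  have ha₄ : mat N (σ₄.a .am) = A := by rw [hS₄.a .am (by simp), hA]
  refine seq (mulF hc hB hNB h1N A (G * b) (by simp [hT₄.v .N, hN]) (by simp) (by simp)
    (fun r c σ' h => by simp [h.q, h.same.a .am, apply_of_mat_eq ha₄])
    (fun r c σ₁ σ' hS h => by simp [h.q, h.same.a .pz, hS.a .pz, apply_of_mat_eq hp₄])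
    fun σ₅ hS₅ hp₅ => ?_)
  have hT₅ : Same coreVars coreArrs σ σ₅ := hT₄.trans (hS₅.mono (ys := coreVars) (βs := coreArrs))
  refine seq (flag hNB (by simp [hT₅.v .N, hN]) fun σ₆ hS₆ hp₆ => ?_)
  have hT₆ : Same coreVars coreArrs σ σ₆ := hT₅.trans (hS₆.mono (ys := coreVars) (βs := coreArrs))
  have ha₆ : mat N (σ₆.a .am) = A := by rw [hS₆.a .am (by simp), hS₅.a .am (by simp), ha₄]
  have hb₅ : mat N (σ₅.a .bm) = b := by rw [hS₅.a .bm (by simp), hS₄.a .bm (by simp), hb]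
  have hg₆ : mat N (σ₆.a .g) = G := by
    rw [hS₆.a .g (by simp), hS₅.a .g (by simp), hS₄.a .g (by simp), hG]
  rw [hp₅, hb₅] at hp₆
  refine seq (mulF hc hB hNB h1N A R (by simp [hT₆.v .N, hN]) (by simp) (by simp)
    (fun r c σ' h => by simp [h.q, h.same.a .am, apply_of_mat_eq ha₆])
    (fun r c σ₁ σ' hS h => by simp [h.div, h.N, h.same.a .rnd, hS.a .rnd, hT₆.a .rnd, hR, cols,
      vec]) fun σ₇ hS₇ hp₇ => ?_)
  have hT₇ : Same coreVars coreArrs σ σ₇ := hT₆.trans (hS₇.mono (ys := coreVars) (βs := coreArrs))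
  have hb₇ : mat N (σ₇.a .bm) = b := by rw [hS₇.a .bm (by simp), hS₆.a .bm (by simp), hb₅]
  have hg₇ : mat N (σ₇.a .g) = G := by rw [hS₇.a .g (by simp), hg₆]
  refine seq (mulF hc hB hNB h1N G (b + A * R) (by simp [hT₇.v .N, hN]) (by simp) (by simp)
    (fun r c σ' h => by simp [h.q, h.same.a .g, apply_of_mat_eq hg₇])
    (fun r c σ₁ σ' hS h => by simp [h.q, h.same.a .pz, hS.a .pz, h.same.a .bm, hS.a .bm,
      apply_of_mat_eq hp₇, apply_of_mat_eq hb₇]) fun σ₈ hS₈ hp₈ => ?_)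
  have hT₈ : Same coreVars coreArrs σ σ₈ := hT₇.trans (hS₈.mono (ys := coreVars) (βs := coreArrs))
  refine seq (fill (G * (b + A * R) + R) (by simp [hT₈.v .N, hN]) hNB (by simp) (by simp)
    (fun r c σ' h => by simp [(div_mod_block c.2).1, h.N, h.q, h.same.a .pz, h.same.a .rnd,
      hT₈.a .rnd, apply_of_mat_eq hp₈, hR, cols, vec]) fun σ₉ hS₉ hp₉ hlt => ?_)
  have hf : σ₉.v .flag = σ₆.v .flag := by
    rw [hS₉.v .flag (by simp), hS₈.v .flag (by simp), hS₇.v .flag (by simp)]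
  have hT₉ : Same coreVars coreArrs σ σ₉ := hT₈.trans (hS₉.mono (ys := coreVars) (βs := coreArrs))
  refine out hNB (by simp [hT₉.v .N, hN]) (by simp [hT₉.v .n, hn]) hnN hL fun σ' h1 h2 =>
    hQ σ' A b G rfl rfl rfl (by rw [h1, hf, hp₆]) fun v hv => ?_
  rw [h2 v hv, ← hp₉]
  have := hlt (v * N) (by rw [← add_zero (v * N)]; exact index_lt (by omega) (by omega))
  simp only [mat, Matrix.of_apply, add_zero]
  rw [ZMod.val_natCast, Nat.mod_eq_of_lt this]

end Tri

end WordRAM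


namespace WordRAM

/-! ### The complete program -/

/-- Toss the coins. -/
def coinsC : Cmd := forC .t ¢.N (.seq (coinV .q) (storeA .rnd ¢.t ¢.q))

/-- Compute the dimension `N`, which is a power of two. -/
def sizeC : Cmd :=
  .seq (assign .n (.rd .io 0)) (.seq (assign .N 1) (.seq (assign .kk 0)
    (whileE (Expr.lt ¢.N (2 * ¢.n)) (.seq (assign .N (2 * ¢.N)) (assign .kk (¢.kk + 1))))))

/-- Reserve the part of the memory that holds the input. -/
def reserveC : Cmd :=
  .seq (.load 4 0) (.seq (.const 0 1) (.seq (.op .add 4 4 0) (.seq (.op .mul 4 4 4)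
    (.seq (.const 0 8) (.op .mul 2 4 0)))))

/-- Fill a vector of length `N`. -/
def fillV (α : Arr) (e : Expr) : Cmd := scatter .q ¢.N α ¢.q e

/-- The program that samples measurement outcomes; `load` prepares the generators. -/
def sampleC (c load : Cmd) : Cmd :=
  .seq (.seq reserveC (.seq sizeC (.seq load (.seq (rhsC c) (prepC c))))) (.seq coinsC (drawC c))

/-- The initial store. -/
def Store.init (input : List ℕ) : Store :=
  ⟨fun _ => 0, fun α i => if α = .io then input.getD i 0 else 0, 0⟩

/-- The exponent of the dimension. -/
def lg (n : ℕ) : ℕ := Nat.clog 2 (2 * n)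

/-- The time of the complete program. -/
def sampleTime (c : Cmd) (T : ℕ → ℕ) (n : ℕ) : ℕ :=
  9 * blkTime c T (2 ^ lg n) + 2 * treeTime c T (2 ^ lg n) (lg n) +
    400 * cst * (2 ^ lg n * 2 ^ lg n + 1)

/-- The dimension has to be a power of two for the halving and at least `2 n` for the `n` outcomes
and the `n` auxiliary unknowns. The summand 1 is for `n = 0`, where the power is 1. -/
theorem lg_bounds (n : ℕ) : 2 * n ≤ 2 ^ lg n ∧ 2 ^ lg n ≤ 4 * n + 1 := by
  refine ⟨Nat.le_pow_clog (by norm_num) _, ?_⟩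
  rcases Nat.eq_zero_or_pos n with rfl | hn
  · simp [lg]
  · have h1 : 1 < 2 * n := by omega
    have := Nat.pow_pred_clog_lt_self (b := 2) (by norm_num) h1
    have h0 : 0 < Nat.clog 2 (2 * n) := Nat.clog_pos (by norm_num) h1
    rw [lg, ← Nat.succ_pred_eq_of_pos h0, pow_succ]
    omega

theorem runs_reserveC {W : ℕ} {coins : ℕ → Bool} (input : List ℕ) (n : ℕ)
    (hn : input.getD 0 0 = n) (hW : 8 * ((n + 1) * (n + 1)) < W) :
    ∃ s, Runs W coins reserveC (init input) 6 s ∧ s.mem = (init input).mem ∧ s.pos = 0 ∧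
      s.reg 2 = 8 * ((n + 1) * (n + 1)) ∧ ∀ r, r ≠ 0 → r ≠ 2 → r ≠ 4 → s.reg r = 0 := by
  have h1 : n + 1 ≤ (n + 1) * (n + 1) := Nat.le_mul_self _
  refine ⟨_, Runs.seq (Runs.load _ _ _) (Runs.seq (Runs.const _ _ _ ?_)
    (Runs.seq (Runs.op _ _ _ _ _ ?_) (Runs.seq (Runs.op _ _ _ _ _ ?_)
    (Runs.seq (Runs.const _ _ _ ?_) (Runs.op _ _ _ _ _ ?_))))), rfl, rfl, ?_, ?_⟩
  · omega
  · simp [-List.getD_eq_getElem?_getD, BinOp.eval, init, hn]; omega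
  · simp [-List.getD_eq_getElem?_getD, BinOp.eval, init, hn]; omega
  · omega
  · simp [-List.getD_eq_getElem?_getD, BinOp.eval, init, hn]; omega
  · simp [-List.getD_eq_getElem?_getD, BinOp.eval, init, hn]; ring
  · intro r h0 h2 h4
    simp [h0, h2, h4, init]

/-- Beyond the reserved region the memory is zero. All arrays start as zero, and with counter 0
every stamp is current, so the virtual memory reads as zero too. -/
theorem Rep.start {E : Env} {input : List ℕ} {s : State} (hm : s.mem = (init input).mem)
    (hp : s.pos = 0) (h2 : s.reg 2 = E.L) (hr : ∀ r, r ≠ 0 → r ≠ 2 → r ≠ 4 → s.reg r = 0)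
    (hlen : input.length ≤ E.L) (hb : ∀ i, input.getD i 0 ≤ E.B) :
    Rep E 0 s (Store.init input) := by
  have hz : ∀ i, E.L ≤ i → input.getD i 0 = 0 := fun i hi => by
    rw [List.getD_eq_default]; omega
  have hm' : ∀ i, s.mem i = input.getD i 0 := fun i => by rw [hm]; rfl
  refine ⟨fun x => ?_, fun i _ => ?_, fun i hi => ?_, fun α h1 h2 i => ?_, fun i => ?_,
    fun i => ?_, h2, ?_, hp, fun x => ?_, fun α i => ?_⟩
  · rw [hr] <;> first | rfl | (unfold Var.reg; omega)
  · simp only [Store.init, if_true, hm']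
  · simp only [Store.init, if_true, hz i hi]
  · simp only [Store.init, h1, if_false, hm']
    exact hz _ (by simp [Env.addr])
  · have h := hz (E.addr 0 i) (by simp [Env.addr])
    simp only [Store.init, reduceCtorEq, if_false, hm', h, ite_self]
  · rw [hm', hz _ (by simp [Env.addr])]
  · exact hr 6 (by norm_num) (by norm_num) (by norm_num)
  · simp [Store.init]
  · simp only [Store.init]
    split_ifs
    · exact hb i
    · exact Nat.zero_le _

namespace Tri

variable {E : Env} {σ : Store} {Q : Store → Prop} {N n : ℕ}

theorem coins (hNB : N ≤ E.B) (hN : σ.v .N = N)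
    (hQ : ∀ σ', (∀ x, x ≠ .t → x ≠ .q → σ'.v x = σ.v x) → (∀ α, α ≠ .rnd → σ'.a α = σ.a α) →
      (∀ i < N, σ'.a .rnd i = if E.coins (σ.pos + i) then 1 else 0) → Q σ') :
    Tri E coinsC σ (N * (4 * cst) + 2 * cst) Q := by
  have hc : 1 ≤ cst := by unfold cst; norm_num
  have hB := E.hB
  refine (forC (τ := 1 + cst) (fun j σ' => σ'.v .t = j ∧ σ'.pos = σ.pos + j ∧
    (∀ x, x ≠ .t → x ≠ .q → σ'.v x = σ.v x) ∧ (∀ α, α ≠ .rnd → σ'.a α = σ.a α) ∧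
      (∀ i < j, σ'.a .rnd i = if E.coins (σ.pos + i) then 1 else 0)) (by simp) hNB ?_ ?_ ?_
      ?_).time (by
        have : N * (1 + cst + 2 * cst) ≤ N * (4 * cst) := Nat.mul_le_mul_left _ (by omega)
        omega)
  · rintro j _ σ' ⟨h1, -, h2, -⟩
    exact ⟨h1, by simp [h2, hN]⟩
  · refine ⟨by simp, by simp, fun x h _ => by simp [h], by simp, by simp⟩
  · rintro j hj σ' ⟨h1, h2, h3, h4, h5⟩
    refine seq (coinV (storeA (by simp) (by simp) (by simp) ?_ ⟨?_, ?_, ?_, ?_, ?_, ?_⟩))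
    · simp [Store.toss]; split_ifs <;> omega
    · simp [Store.toss, h1]
    · simp
    · simp [Store.toss, h2]; ring
    · intro x hx hq; simp [Store.toss, hx, hq, h3]
    · intro α hα; simp [Store.toss, hα, h4]
    · intro i hi
      simp only [Store.toss, Store.setA_a, Store.setV_a, if_true, Expr.eval_var, Store.setV_v,
        reduceCtorEq, if_false, h1, h2]
      rcases Nat.lt_succ_iff_lt_or_eq.1 hi with h | rfl
      · rw [Function.update_of_ne (by omega)]; exact h5 i h
      · simp
  · rintro σ' ⟨-, -, h3, h4, h5⟩
    exact hQ σ' h3 h4 h5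

theorem size (hn : σ.a .io 0 = n) (hNB : 4 * n + 1 ≤ E.B)
    (hQ : Q (((σ.setV .n n).setV .N (2 ^ lg n)).setV .kk (lg n))) :
    Tri E sizeC σ (lg n * (3 * cst) + 4 * cst) Q := by
  have hB := E.hB
  have hlg := lg_bounds n
  have hlg' : lg n < 2 ^ lg n := Nat.lt_two_pow_self
  have key : ∀ m i, i + m = lg n → Tri E (whileE (Expr.lt ¢.N (2 * ¢.n)) (.seq
      (WordRAM.assign .N (2 * ¢.N)) (WordRAM.assign .kk (¢.kk + 1))))
      (((σ.setV .n n).setV .N (2 ^ i)).setV .kk i) (m * (3 * cst) + cst) Q := by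
    intro m
    induction m with
    | zero =>
      intro i hi
      obtain rfl : i = lg n := by omega
      exact (while_done (by simp) (by simp [hlg.1]) hQ).time (by omega)
    | succ m ih =>
      intro i hi
      have h2 : 2 ^ i < 2 * n := (Nat.lt_clog_iff_pow_lt (by norm_num)).1 (by rw [← lg]; omega)
      refine (while_step (t₁ := cst + cst) (t₂ := m * (3 * cst) + cst) (by simp) (by simp [h2])
        (seq (assign (by simp) (by simp; omega) (assign (by simp) (by simp; omega) ?_)))).time
        (by ring_nf; omega)
      have := ih (i + 1) (by omega)
      convert this using 1
      simp only [Store.setV, Expr.eval_add, Expr.eval_mul, Expr.eval_var, Expr.eval_ofNat]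
      congr 1
      funext x
      cases x <;> simp [pow_succ, mul_comm]
  refine (seq (t₁ := cst) (t₂ := cst + (cst + (lg n * (3 * cst) + cst))) (assign (by simp)
    (by simp [hn]; omega) (seq (assign (by simp) (by simp; omega) (seq (assign (by simp) (by simp)
    ?_)))))).time (by omega)
  have := key (lg n) 0 (by omega)
  simpa [hn] using this

theorem fillV {α : Arr} {e : Expr} (f : ℕ → ℕ) (hN : σ.v .N = N)
    (hNB : N ≤ E.B) (hd : e.deg ≤ 90) (hα : α ≠ .io) (hf : ∀ i < N, f i ≤ E.B)
    (he : ∀ i < N, ∀ σ' : Store, Same [.q] [α] σ σ' → σ'.v .q = i → e.eval σ' = f i)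
    (hQ : ∀ σ', Same [.q] [α] σ σ' → (∀ i < N, σ'.a α i = f i) → Q σ') :
    Tri E (fillV α e) σ ((N + 1) * (3 * cst)) Q :=
  scatter N id f (by simp) (by simp) hd hNB hα (by simp [hN]) (by simp) (by simp)
    (fun i hi _ _ _ => he i hi _ (((Same.refl _ _ _).setV (by simp) _).setA (by simp) _) (by simp))
    hf fun h h1 _ => hQ _ (((Same.refl _ _ _).setV (by simp) _).setA (by simp) _) fun i hi => by
      simpa using h1 i hi

end Tri

end WordRAM


namespace WordRAM

/-! ### Independence of the coins -/

/-- The program does not toss coins. -/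
def Cmd.NoCoin : Cmd → Prop
  | .coin _ => False
  | .seq c₁ c₂ => c₁.NoCoin ∧ c₂.NoCoin
  | .ite _ c₁ c₂ => c₁.NoCoin ∧ c₂.NoCoin
  | .while _ c => c.NoCoin
  | _ => True

/-- This lets the linear algebra be run once and then reused for all coin sequences, with the same
resulting matrices. -/
theorem Runs.of_noCoin {W : ℕ} {coins coins' : ℕ → Bool} {c : Cmd} {s s' : State} {t : ℕ}
    (h : Runs W coins c s t s') (hc : c.NoCoin) : Runs W coins' c s t s' := by
  induction h with
  | skip s => exact .skip s
  | const s d k h => exact .const s d k h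
  | op s o d a b h => exact .op s o d a b h
  | load s d a => exact .load s d a
  | store s a b => exact .store s a b
  | coin s d => exact hc.elim
  | seq _ _ ih₁ ih₂ => exact .seq (ih₁ hc.1) (ih₂ hc.2)
  | ite_true ha _ ih => exact .ite_true ha (ih hc.1)
  | ite_false ha _ ih => exact .ite_false ha (ih hc.2)
  | while_done ha => exact .while_done ha
  | while_step ha _ _ ih₁ ih₂ => exact .while_step ha (ih₁ hc) (ih₂ hc)

theorem noCoin_readC (α : Arr) (k : ℕ) : (readC α k).NoCoin := by
  unfold readC; split_ifs <;> simp [Cmd.NoCoin, addrC]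

theorem noCoin_writeC (α : Arr) : (writeC α).NoCoin := by
  unfold writeC; split_ifs <;> simp [Cmd.NoCoin, addrC]

theorem Expr.noCoin_comp (e : Expr) : ∀ k, (e.comp k).NoCoin := by
  induction e with
  | var x => intro k; simp [Expr.comp, Cmd.NoCoin]
  | lit m => intro k; simp [Expr.comp, Cmd.NoCoin]
  | bin o e₁ e₂ h₁ h₂ => intro k; simp [Expr.comp, Cmd.NoCoin, h₁, h₂]
  | rd α e h => intro k; simp [Expr.comp, Cmd.NoCoin, h, noCoin_readC]

theorem noCoin_assign (x : Var) (e : Expr) : (assign x e).NoCoin := by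
  simp [assign, Cmd.NoCoin, e.noCoin_comp]

theorem noCoin_storeA (α : Arr) (e₁ e₂ : Expr) : (storeA α e₁ e₂).NoCoin := by
  simp [storeA, Cmd.NoCoin, Expr.noCoin_comp, noCoin_writeC]

theorem noCoin_iteE (e : Expr) {c₁ c₂ : Cmd} (h₁ : c₁.NoCoin) (h₂ : c₂.NoCoin) :
    (iteE e c₁ c₂).NoCoin := ⟨e.noCoin_comp 0, h₁, h₂⟩

theorem noCoin_whileE (e : Expr) {c : Cmd} (h : c.NoCoin) : (whileE e c).NoCoin :=
  ⟨e.noCoin_comp 0, h, e.noCoin_comp 0⟩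

theorem noCoin_forC (x : Var) (e : Expr) {c : Cmd} (h : c.NoCoin) : (forC x e c).NoCoin :=
  ⟨noCoin_assign _ _, noCoin_whileE _ ⟨h, noCoin_assign _ _⟩⟩

theorem noCoin_scatter (x : Var) (len : Expr) (α : Arr) (ix e : Expr) :
    (scatter x len α ix e).NoCoin := noCoin_forC _ _ (noCoin_storeA _ _ _)

theorem noCoin_virtual (c : Cmd) : c.virtual.NoCoin := by
  induction c with
  | seq _ _ h₁ h₂ => exact ⟨h₁, h₂⟩
  | ite _ _ _ h₁ h₂ => exact ⟨h₁, h₂⟩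
  | load d a => simp [Cmd.virtual, Cmd.NoCoin, moveC, noCoin_readC]
  | store a b => simp [Cmd.virtual, Cmd.NoCoin, moveC, noCoin_writeC]
  | _ => trivial

theorem noCoin_callC (c : Cmd) : (callC c).NoCoin := by
  refine ⟨?_, noCoin_virtual c⟩
  induction c.regBound with
  | zero => trivial
  | succ R ih => exact ⟨ih, trivial⟩

theorem noCoin_fillC (α : Arr) (e : Expr) : (fillC α e).NoCoin := noCoin_scatter _ _ _ _ _

theorem noCoin_dims (a b c : Expr) : (dims a b c).NoCoin :=
  ⟨noCoin_assign _ _, noCoin_assign _ _, noCoin_assign _ _⟩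

theorem noCoin_mulC (c : Cmd) : (mulC c).NoCoin := by
  have h : (blkC c).NoCoin := by
    simp [blkC, Cmd.NoCoin, clearVM, noCoin_storeA, noCoin_scatter, noCoin_callC]
  refine noCoin_forC _ _ ?_
  simp [Cmd.NoCoin, noCoin_assign, noCoin_scatter, noCoin_forC _ _ h]

theorem noCoin_mulF (c : Cmd) (e₁ e₂ : Expr) : (mulF c e₁ e₂).NoCoin :=
  ⟨noCoin_fillC _ _, noCoin_fillC _ _, noCoin_assign _ _, noCoin_dims _ _ _, noCoin_mulC c⟩

theorem noCoin_ginvC (c : Cmd) : (ginvC c).NoCoin := by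
  have hg : (blockGX c).NoCoin := ⟨noCoin_scatter _ _ _ _ _, noCoin_scatter _ _ _ _ _,
    noCoin_dims _ _ _, noCoin_mulC c⟩
  have hc : (combineC c).NoCoin := ⟨hg, noCoin_scatter _ _ _ _ _, noCoin_scatter _ _ _ _ _,
    noCoin_dims _ _ _, noCoin_mulC c, noCoin_scatter _ _ _ _ _⟩
  have hr : (residueC c).NoCoin := ⟨hg, noCoin_scatter _ _ _ _ _, noCoin_scatter _ _ _ _ _,
    noCoin_dims _ _ _, noCoin_mulC c, noCoin_scatter _ _ _ _ _⟩
  refine ⟨noCoin_assign _ _, noCoin_assign _ _, noCoin_assign _ _, noCoin_assign _ _,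
    noCoin_whileE _ (noCoin_iteE _ (noCoin_iteE _ ?_ ?_) (noCoin_iteE _ (noCoin_assign _ _)
      (noCoin_iteE _ ?_ ?_)))⟩
  · simp [descendC, Cmd.NoCoin, noCoin_assign, noCoin_scatter]
  · refine ⟨⟨noCoin_assign _ _, noCoin_forC _ _ (noCoin_iteE _ (noCoin_assign _ _) trivial),
      noCoin_scatter _ _ _ _ _⟩, noCoin_assign _ _⟩
  · simp [ascendC, Cmd.NoCoin, noCoin_assign, hc]
  · simp [crossC, Cmd.NoCoin, noCoin_assign, hr]

theorem noCoin_rhsC (c : Cmd) : (rhsC c).NoCoin := by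
  simp [rhsC, Cmd.NoCoin, noCoin_mulF, noCoin_fillC, noCoin_ginvC, fillX, noCoin_scatter]

theorem noCoin_prepC (c : Cmd) : (prepC c).NoCoin := by
  simp [prepC, coeffC, Cmd.NoCoin, noCoin_fillC, noCoin_ginvC, fillX, noCoin_scatter]

theorem noCoin_sizeC : sizeC.NoCoin :=
  ⟨noCoin_assign _ _, noCoin_assign _ _, noCoin_assign _ _,
    noCoin_whileE _ ⟨noCoin_assign _ _, noCoin_assign _ _⟩⟩

/-! ### Correctness of the complete program -/

/-- Extend a matrix by zeros. -/
def pad (N : ℕ) {n : ℕ} (M : Matrix (Fin n) (Fin n) (ZMod 2)) : Matrix (Fin N) (Fin N) (ZMod 2) :=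
  Matrix.of fun r c => if h : (r : ℕ) < n ∧ (c : ℕ) < n then M ⟨r, h.1⟩ ⟨c, h.2⟩ else 0

/-- Extend a vector by zeros. -/
def padV (N : ℕ) {n : ℕ} (v : Fin n → ZMod 2) : Fin N → ZMod 2 :=
  fun i => if h : (i : ℕ) < n then v ⟨i, h⟩ else 0

/-- The coefficients of the equations for the outcomes and the auxiliary unknowns. -/
def solMat (N : ℕ) {n : ℕ} (C D : Matrix (Fin n) (Fin n) (ZMod 2)) (post : Fin n → ℕ) :
    Matrix (Fin N) (Fin N) (ZMod 2) :=
  Matrix.of fun r c => if h : (c : ℕ) < n then if post ⟨c, h⟩ = 2 then pad N D r c else 0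
    else pad N C r ⟨c - n, by omega⟩

/-- The right hand side of the equations for the outcomes and the auxiliary unknowns. -/
def solRhs (N : ℕ) {n : ℕ} (C D : Matrix (Fin n) (Fin n) (ZMod 2)) (p s : Fin n → ZMod 2)
    (post : Fin n → ℕ) (G : Matrix (Fin N) (Fin N) (ZMod 2)) : Fin N → ZMod 2 :=
  offset (pad N C) (pad N D) (padV N p) (padV N s) G +
    (pad N D).mulVec (padV N fun j => if post j = 1 then 1 else 0)

/-- The program `load` computes the generators of a stabilizer group and the postselected outcomes
from the input. -/
structure Loads (load : Cmd) (input : List ℕ) {n : ℕ} (C D : Matrix (Fin n) (Fin n) (ZMod 2))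
    (p s : Fin n → ZMod 2) (post : Fin n → ℕ) : Prop where
  noCoin : load.NoCoin
  tri : ∀ (E : Env) (σ : Store) (N : ℕ) (Q : Store → Prop), σ.v .n = n → σ.v .N = N → n ≤ N →
    N * N ≤ E.B → (σ.a .io = fun i => input.getD i 0) →
    (∀ σ', Same [.q] [.cm, .dm, .pv, .sv, .post] σ σ' → mat N (σ'.a .cm) = pad N C →
      mat N (σ'.a .dm) = pad N D → vec N (σ'.a .pv) = padV N p → vec N (σ'.a .sv) = padV N s →
      (∀ v : Fin n, σ'.a .post v = post v) → Q σ') →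
    Tri E load σ (20 * cst * (N * N + 1)) Q

theorem mul_cols {N : ℕ} (M : Matrix (Fin N) (Fin N) (ZMod 2)) (v : Fin N → ZMod 2) :
    M * cols v = cols (M.mulVec v) := by
  ext r c; simp [cols, Matrix.mul_apply, Matrix.mulVec, dotProduct]

theorem cols_add {N : ℕ} (v w : Fin N → ZMod 2) : cols v + cols w = cols (v + w) := rfl

theorem cols_inj {N : ℕ} {v w : Fin N → ZMod 2} : cols v = cols w ↔ v = w :=
  ⟨fun h => funext fun r => congrFun (congrFun h r) r, fun h => h ▸ rfl⟩

theorem pad_mulVec_congr {N n : ℕ} (M : Matrix (Fin n) (Fin n) (ZMod 2)) {v w : Fin N → ZMod 2}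
    (h : ∀ i : Fin N, (i : ℕ) < n → v i = w i) : (pad N M).mulVec v = (pad N M).mulVec w := by
  ext r
  simp only [Matrix.mulVec, dotProduct]
  refine Finset.sum_congr rfl fun i _ => ?_
  by_cases hi : (i : ℕ) < n
  · rw [h i hi]
  · simp [pad, hi]

/-- The representation does not mention the coin sequence, so the coins may be exchanged between the
two phases of the program. -/
theorem Rep.congr_env {E E' : Env} {ctr : ℕ} {s : State} {σ : Store} (h : Rep E ctr s σ)
    (hB : E'.B = E.B) (hL : E'.L = E.L) : Rep E' ctr s σ := by
  obtain ⟨B, L, W, c, h1, h2, h3⟩ := E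
  obtain ⟨B', L', W', c', h1', h2', h3'⟩ := E'
  obtain rfl : B' = B := hB
  obtain rfl : L' = L := hL
  exact ⟨h.reg, h.io_lt, h.io_ge, h.arr, h.vm, h.stamp, h.rl, h.rctr, h.pos, h.bv, h.ba⟩

/-- The order of the quantifiers is the point: `G` and `G'` are chosen before the coins. The
preparation tosses no coins and runs once with the coins of `E`; its final configuration is then
shared by all coin sequences. Without this, outputs for different coins could not be compared. -/
theorem runs_sampleC {c load : Cmd} {κ : ℕ} {T : ℕ → ℕ} (hc : MatMulBy c κ T) {input : List ℕ}
    {n : ℕ} {C D : Matrix (Fin n) (Fin n) (ZMod 2)} {p s : Fin n → ZMod 2} {post : Fin n → ℕ}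
    (hl : Loads load input C D p s post) (E : Env) (hL : E.L = 8 * ((n + 1) * (n + 1)))
    (hB : (2 ^ lg n + 2) ^ (κ + 1) ≤ E.B) (hT : sampleTime c T n ≤ E.B)
    (hn : input.getD 0 0 = n) (hlen : input.length ≤ 8 * ((n + 1) * (n + 1)))
    (hb : ∀ i, input.getD i 0 ≤ E.B) :
    ∃ G G' : Matrix (Fin (2 ^ lg n)) (Fin (2 ^ lg n)) (ZMod 2),
      pad _ C * G * pad _ C = pad _ C ∧
      solMat _ C D post * G' * solMat _ C D post = solMat _ C D post ∧
      ∀ coins : ℕ → Bool, ∃ t ≤ sampleTime c T n, ∃ s' : State,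
        Runs E.W coins (sampleC c load) (init input) t s' ∧
        (s'.mem 0 = if (solMat _ C D post).mulVec (G'.mulVec (solRhs _ C D p s post G)) =
          solRhs _ C D p s post G then 1 else 0) ∧
        ∀ (v : Fin n) (w : Fin (2 ^ lg n)), (w : ℕ) = v → s'.mem (v + 1) =
          ((G'.mulVec (solRhs _ C D p s post G + (solMat _ C D post).mulVec
            fun i => if coins i then 1 else 0)) w + if coins w then 1 else 0 : ZMod 2).val := by
  set N := 2 ^ lg n with hN
  set L := lg n with hLg
  have hnN : 2 * n ≤ N := (lg_bounds n).1
  have hN4 : N ≤ 4 * n + 1 := (lg_bounds n).2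
  have h1N : 1 ≤ N := Nat.one_le_two_pow
  have hNN : N ≤ N * N := Nat.le_mul_self N
  have hLN : L ≤ N := Nat.lt_two_pow_self.le
  have hc1 : 400 ≤ cst := by unfold cst; norm_num
  have hNB : 400 * cst * (N * N + 1) ≤ E.B := by
    refine le_trans ?_ hT
    simp only [sampleTime, ← hN, ← hLg]; omega
  have hNB' : N * N + 1 ≤ E.B := le_trans (Nat.le_mul_of_pos_left _ (by omega)) hNB
  have hn4 : 4 * n + 1 ≤ E.B := by
    refine le_trans ?_ hNB
    calc 4 * n + 1 ≤ 400 * (N * N + 1) := by omega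
      _ ≤ 400 * cst * (N * N + 1) := Nat.mul_le_mul_right _ (by omega)
  have hBW : E.B < E.W := lt_of_le_of_lt (Nat.le_self_pow (by norm_num) _) E.hW
  obtain ⟨s₀, hr₀, hm₀, hp₀, h2₀, hz₀⟩ := runs_reserveC (W := E.W) (coins := E.coins) input n hn
    (by have := E.hL; omega)
  have hRep : Rep E 0 s₀ (Store.init input) :=
    Rep.start hm₀ hp₀ (h2₀.trans hL.symm) hz₀ (hL ▸ hlen) hb
  have hT₁ : Tri E (.seq sizeC (.seq load (.seq (rhsC c) (prepC c)))) (Store.init input)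
      ((L * (3 * cst) + 4 * cst) + (20 * cst * (N * N + 1) +
        ((5 * blkTime c T N + treeTime c T N L + 130 * cst * (N * N + 1)) +
        (treeTime c T N L + 20 * cst * (N * N + 1))))) fun σ => σ.v .N = N ∧ σ.v .n = n ∧ σ.pos = 0 ∧
        ∃ G, pad N C * G * pad N C = pad N C ∧ mat N (σ.a .am) = solMat N C D post ∧
          mat N (σ.a .bm) = cols (solRhs N C D p s post G) ∧
          solMat N C D post * mat N (σ.a .g) * solMat N C D post = solMat N C D post := by
    refine Tri.seq (Tri.size (n := n) (by simpa [Store.init] using hn) hn4 (Tri.seq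
      (hl.tri E _ N _ (by simp) (by simp [hN, hLg]) (by omega) (by omega)
      (by simp [Store.init]) fun σ₁ hS₁ hcm hdm hpv hsv hpost => ?_)))
    refine Tri.seq (Tri.rhs (k := L) hc hB (by omega) hN (by simp [hS₁.v .N, hN, hLg])
      (by simp [hS₁.v .kk, hLg]) fun σ₂ hS₂ C' D' G hC hD hG hbm => ?_)
    rw [hcm] at hC
    rw [hdm] at hD
    subst hC hD
    refine Tri.prep (k := L) (n := n) hc hB (by omega) hN
      (by simp [hS₂.v .N, hS₁.v .N, hN, hLg]) (by simp [hS₂.v .kk, hS₁.v .kk, hLg])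
      (by simp [hS₂.v .n, hS₁.v .n]) fun σ₃ hS₃ hb₃ A hA ham hg => ?_
    have hA' : A = solMat N C D post := by
      rw [hA, hS₂.a .cm (by simp), hS₂.a .dm (by simp), hS₂.a .post (by simp), hcm, hdm]
      ext r c
      simp only [coeff, solMat, Matrix.of_apply]
      by_cases h : (c : ℕ) < n
      · simp only [h, if_true, dif_pos]
        rw [← hpost ⟨c, h⟩]
      · simp [h]
    rw [hA'] at ham hg
    refine ⟨by simp [hS₃.v .N, hS₂.v .N, hS₁.v .N, hN, hLg],
      by simp [hS₃.v .n, hS₂.v .n, hS₁.v .n],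
      by simp [hS₃.pos, hS₂.pos, hS₁.pos, Store.init], G, hG, ham, ?_, hg⟩
    rw [hb₃, hbm, mul_cols, cols_add, cols_inj, solRhs, hpv, hsv]
    congr 1
    refine pad_mulVec_congr _ fun i hi => ?_
    simp only [padV, hi, dif_pos]
    rw [← hpost ⟨i, hi⟩]
  obtain ⟨t₁, ht₁, s₁, ctr₁, σ₁, hr₁, hctr₁, hRep₁, hN₁, hn₁, hp₁, G, hG, hA, hb₁, hG'⟩ := hT₁ 0 s₀ hRep
    (by
      refine le_trans ?_ hT
      have : L * cst ≤ N * N * cst := Nat.mul_le_mul_right _ (hLN.trans hNN)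
      simp only [sampleTime, ← hN, ← hLg]; ring_nf at this ⊢; omega)
  refine ⟨G, mat N (σ₁.a .g), hG, hG', fun coins => ?_⟩
  have hnL : n + 1 < E.L := by rw [hL]; nlinarith
  have hrun : Runs E.W coins (.seq reserveC (.seq sizeC (.seq load (.seq (rhsC c) (prepC c)))))
      (init input) (6 + t₁) s₁ :=
    Runs.of_noCoin (Runs.seq hr₀ hr₁) ⟨⟨trivial, trivial, trivial, trivial, trivial, trivial⟩,
      noCoin_sizeC, hl.noCoin, noCoin_rhsC c, noCoin_prepC c⟩
  set A := solMat N C D post with hAdef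
  set b := solRhs N C D p s post G with hbdef
  -- The second phase runs in the same environment, but with arbitrary coins.
  let E' : Env := ⟨E.B, E.L, E.W, coins, E.hB, E.hL, E.hW⟩
  have hT₂ : Tri E' (.seq coinsC (drawC c)) σ₁ ((N * (4 * cst) + 2 * cst) +
      (4 * blkTime c T N + 100 * cst * (N * N + 1))) fun σ =>
      (σ.a .io 0 = if A.mulVec ((mat N (σ₁.a .g)).mulVec b) = b then 1 else 0) ∧
        ∀ (v : ℕ) (hv : v < n), σ.a .io (v + 1) = (((mat N (σ₁.a .g)).mulVec (b + A.mulVec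
            fun i => if coins i then 1 else 0)) ⟨v, by omega⟩ + if coins v then 1 else 0 : ZMod 2).val := by
    refine Tri.seq (Tri.coins (N := N) (show N ≤ E.B by omega) hN₁ fun σ₂ h1 h2 h3 => ?_)
    refine Tri.draw (n := n) hc hB (show N * N ≤ E.B by omega) h1N
      ((h1 _ (by simp) (by simp)).trans hN₁) ((h1 _ (by simp) (by simp)).trans hn₁) (by omega)
      hnL.le fun σ₃ A' b' G' hA' hb' hG₂ hf ho => ?_
    rw [h2 _ (by simp)] at hA' hb' hG₂
    rw [hA] at hA'
    rw [hb₁] at hb'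
    subst hA' hb' hG₂
    -- No coin was used in the first phase, so entry `i` of the random vector is coin number `i`.
    have hv : vec N (σ₂.a .rnd) = fun i : Fin N => if coins i then 1 else 0 := by
      funext i
      rw [vec, h3 i i.2, hp₁, zero_add]
      show ((if coins i then 1 else 0 : ℕ) : ZMod 2) = _
      split_ifs <;> simp
    simp only [mul_cols, cols_inj, cols_add, hv] at hf ho
    refine ⟨hf, fun v hv => ?_⟩
    rw [ho v hv]
    rfl
  obtain ⟨t₂, ht₂, s₂, ctr₂, σ₂, hr₂, -, hRep₂, hf, ho⟩ := hT₂ ctr₁ s₁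
    (hRep₁.congr_env rfl rfl) (by
      refine le_trans ?_ hT
      have h1 : L * cst ≤ N * N * cst := Nat.mul_le_mul_right _ (hLN.trans hNN)
      have h2 : N * cst ≤ N * N * cst := Nat.mul_le_mul_right _ hNN
      simp only [sampleTime, ← hN, ← hLg]; ring_nf at h1 h2 hctr₁ ⊢; omega)
  refine ⟨6 + t₁ + t₂, ?_, s₂, Runs.seq hrun hr₂, ?_, ?_⟩
  · have h1 : L * cst ≤ N * N * cst := Nat.mul_le_mul_right _ (hLN.trans hNN)
    have h2 : N * cst ≤ N * N * cst := Nat.mul_le_mul_right _ hNN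
    simp only [sampleTime, ← hN, ← hLg]; ring_nf at h1 h2 ht₁ ht₂ ⊢; omega
  · have h0 : 0 < E.L := by omega
    exact (hRep₂.io_lt 0 h0).trans hf
  · rintro v ⟨w, hw⟩ rfl
    have hv : (v : ℕ) + 1 < E.L := by have := v.2; omega
    exact (hRep₂.io_lt (v + 1) hv).trans (ho v v.2)

end WordRAM


namespace WordRAM

/-! ### Preparation of the generators -/

/-- Compute the generators and the postselected outcomes by the given expressions. -/
def loadC (ec ed ep es epost : Expr) : Cmd :=
  .seq (fillC .cm (Expr.lt row ¢.n * Expr.lt col ¢.n * ec))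
  (.seq (fillC .dm (Expr.lt row ¢.n * Expr.lt col ¢.n * ed))
  (.seq (fillV .pv (Expr.lt ¢.q ¢.n * ep % 2)) (.seq (fillV .sv (Expr.lt ¢.q ¢.n * es % 2))
    (fillV .post (Expr.lt ¢.q ¢.n * epost % 3)))))

/-- The store while an expression for the entry number `q` of an array is evaluated. -/
structure At (input : List ℕ) (n N q : ℕ) (σ : Store) : Prop where
  n : σ.v .n = n
  N : σ.v .N = N
  q : σ.v .q = q
  io : σ.a .io = fun i => input.getD i 0

/-- The comparisons with `n` multiply each expression by zero outside the `n × n` corner or the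
first `n` entries. Only the values inside have to be right; whatever is read elsewhere is discarded.
-/
theorem loads_loadC {input : List ℕ} {n : ℕ} {C D : Matrix (Fin n) (Fin n) (ZMod 2)}
    {p s : Fin n → ZMod 2} {post : Fin n → ℕ} {ec ed ep es epost : Expr} (hdc : ec.deg ≤ 60)
    (hdd : ed.deg ≤ 60) (hdp : ep.deg ≤ 60) (hds : es.deg ≤ 60) (hdo : epost.deg ≤ 60)
    (hc : ∀ (r c : Fin n) N σ, (c : ℕ) < N → At input n N (r * N + c) σ → (ec.eval σ : ZMod 2) = C r c)
    (hd : ∀ (r c : Fin n) N σ, (c : ℕ) < N → At input n N (r * N + c) σ → (ed.eval σ : ZMod 2) = D r c)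
    (hp : ∀ (r : Fin n) N σ, At input n N r σ → (ep.eval σ : ZMod 2) = p r)
    (hs : ∀ (r : Fin n) N σ, At input n N r σ → (es.eval σ : ZMod 2) = s r)
    (ho : ∀ (r : Fin n) N σ, At input n N r σ → epost.eval σ = post r)
    (hpost : ∀ r, post r < 3) :
    Loads (loadC ec ed ep es epost) input C D p s post := by
  refine ⟨?_, fun E σ N Q hn hN hnN hNB hio hQ => ?_⟩
  · simp [loadC, Cmd.NoCoin, noCoin_fillC, fillV, noCoin_scatter]
  have hNN : N ≤ N * N := Nat.le_mul_self N
  have hB := E.hB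
  have key : ∀ (M : Matrix (Fin n) (Fin n) (ZMod 2)) (e : Expr), (∀ (r c : Fin n) N σ, (c : ℕ) < N →
      At input n N (r * N + c) σ → (e.eval σ : ZMod 2) = M r c) → ∀ (r c : Fin N) (τ : Store),
      At input n N (r * N + c) τ →
      ((Expr.lt row ¢.n * Expr.lt col ¢.n * e).eval τ : ZMod 2) = pad N M r c := by
    intro M e he r c τ h
    simp only [Expr.eval_mul, Expr.eval_lt, Expr.eval_div, Expr.eval_mod, Expr.eval_var, h.q, h.N,
      h.n, (div_mod_block c.2).1, (div_mod_block c.2).2, pad, Matrix.of_apply]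
    by_cases h1 : (r : ℕ) < n
    · by_cases h2 : (c : ℕ) < n
      · simp [h1, h2, ← he ⟨r, h1⟩ ⟨c, h2⟩ N τ c.2 h]
      · simp [h2]
    · simp [h1]
  have keyV : ∀ (v : Fin n → ZMod 2) (e : Expr), (∀ (r : Fin n) N σ, At input n N r σ →
      (e.eval σ : ZMod 2) = v r) → ∀ i < N, ∀ τ : Store, At input n N i τ →
      (Expr.lt ¢.q ¢.n * e % 2).eval τ = if h : i < n then (v ⟨i, h⟩).val else 0 := by
    intro v e he i hi τ h
    simp only [Expr.eval_mul, Expr.eval_lt, Expr.eval_mod, Expr.eval_var, Expr.eval_ofNat, h.q, h.n]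
    by_cases h1 : i < n
    · simp only [h1, if_true, one_mul, dif_pos, ← he ⟨i, h1⟩ N τ h, ZMod.val_natCast]
    · simp [h1]
  have hlt : ∀ (v : Fin n → ZMod 2) (i : ℕ), (if h : i < n then (v ⟨i, h⟩).val else 0) ≤ E.B := by
    intro v i
    split_ifs with h
    · have := ZMod.val_lt (v ⟨i, h⟩); omega
    · omega
  refine (Tri.seq (t₂ := (N * N + 1) * (3 * cst) + ((N + 1) * (3 * cst) + ((N + 1) * (3 * cst) +
    (N + 1) * (3 * cst)))) (Tri.fill (pad N C) hN (by omega) (by simp; omega) (by simp)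
    (fun r c τ h => key C ec hc r c τ ⟨by rw [h.same.v .n (by simp), hn], h.N, h.q,
      by rw [h.same.a .io (by simp), hio]⟩) fun σ₁ hS₁ hp₁ _ => ?_)).time ?_
  swap
  · have : N * cst ≤ N * N * cst := Nat.mul_le_mul_right _ hNN
    ring_nf at this ⊢; omega
  refine Tri.seq (Tri.fill (pad N D) (by simp [hS₁.v .N, hN]) (by omega) (by simp; omega) (by simp)
    (fun r c τ h => key D ed hd r c τ ⟨by rw [h.same.v .n (by simp), hS₁.v .n (by simp), hn], h.N,
      h.q, by rw [h.same.a .io (by simp), hS₁.a .io (by simp), hio]⟩) fun σ₂ hS₂ hp₂ _ => ?_)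
  refine Tri.seq (Tri.fillV _ (by simp [hS₂.v .N, hS₁.v .N, hN]) (by omega) (by simp; omega)
    (by simp) (fun i _ => hlt p i) (fun i hi τ h hq => keyV p ep hp i hi τ
      ⟨by rw [h.v .n (by simp), hS₂.v .n (by simp), hS₁.v .n (by simp), hn],
      by rw [h.v .N (by simp), hS₂.v .N (by simp), hS₁.v .N (by simp), hN], hq,
      by rw [h.a .io (by simp), hS₂.a .io (by simp), hS₁.a .io (by simp), hio]⟩)
      fun σ₃ hS₃ hp₃ => ?_)
  refine Tri.seq (Tri.fillV _ (by simp [hS₃.v .N, hS₂.v .N, hS₁.v .N, hN]) (by omega)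
    (by simp; omega) (by simp) (fun i _ => hlt s i) (fun i hi τ h hq => keyV s es hs i hi τ
      ⟨by rw [h.v .n (by simp), hS₃.v .n (by simp), hS₂.v .n (by simp), hS₁.v .n (by simp), hn],
      by rw [h.v .N (by simp), hS₃.v .N (by simp), hS₂.v .N (by simp), hS₁.v .N (by simp), hN], hq,
      by rw [h.a .io (by simp), hS₃.a .io (by simp), hS₂.a .io (by simp), hS₁.a .io (by simp),
        hio]⟩) fun σ₄ hS₄ hp₄ => ?_)
  refine Tri.fillV (fun i => if h : i < n then post ⟨i, h⟩ else 0)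
    (by simp [hS₄.v .N, hS₃.v .N, hS₂.v .N, hS₁.v .N, hN]) (by omega)
    (by simp; omega) (by simp) (fun i _ => ?_) (fun i hi τ h hq => ?_) fun σ₅ hS₅ hp₅ =>
      hQ σ₅ ?_ ?_ ?_ ?_ ?_ ?_
  · split_ifs with h
    · have := hpost ⟨i, h⟩; omega
    · omega
  · have hat : At input n N i τ := ⟨by rw [h.v .n (by simp), hS₄.v .n (by simp),
      hS₃.v .n (by simp), hS₂.v .n (by simp), hS₁.v .n (by simp), hn],
      by rw [h.v .N (by simp), hS₄.v .N (by simp), hS₃.v .N (by simp), hS₂.v .N (by simp),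
        hS₁.v .N (by simp), hN], hq,
      by rw [h.a .io (by simp), hS₄.a .io (by simp), hS₃.a .io (by simp), hS₂.a .io (by simp),
        hS₁.a .io (by simp), hio]⟩
    simp only [Expr.eval_mul, Expr.eval_lt, Expr.eval_mod, Expr.eval_var, Expr.eval_ofNat, hq, hat.n]
    by_cases h1 : i < n
    · simp only [h1, if_true, one_mul, dif_pos, ho ⟨i, h1⟩ N τ hat]
      exact Nat.mod_eq_of_lt (hpost _)
    · simp [h1]
  · exact (((hS₁.mono (ys := [.q]) (βs := [.cm, .dm, .pv, .sv, .post])).trans hS₂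
      (zs := [.q]) (γs := [.cm, .dm, .pv, .sv, .post])).trans hS₃
      (zs := [.q]) (γs := [.cm, .dm, .pv, .sv, .post])).trans hS₄
      (zs := [.q]) (γs := [.cm, .dm, .pv, .sv, .post]) |>.trans hS₅
  · rw [hS₅.a .cm (by simp), hS₄.a .cm (by simp), hS₃.a .cm (by simp), hS₂.a .cm (by simp), hp₁]
  · rw [hS₅.a .dm (by simp), hS₄.a .dm (by simp), hS₃.a .dm (by simp), hp₂]
  · rw [hS₅.a .pv (by simp), hS₄.a .pv (by simp)]
    funext i
    simp only [vec, hp₃ i i.2, padV]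
    split_ifs <;> simp
  · rw [hS₅.a .sv (by simp)]
    funext i
    simp only [vec, hp₄ i i.2, padV]
    split_ifs <;> simp
  · intro v
    rw [hp₅ v (by omega)]
    simp

end WordRAM


/-! ### Reading the two input formats. -/

namespace StabSim

open WordRAM Qubit

/-- The word that describes the role of a qubit. -/
def postF {n : ℕ} {P : Finset (Fin n)} (m : {v // v ∈ P} → ZMod 2) (v : Fin n) : ℕ :=
  if h : v ∈ P then (m ⟨v, h⟩).val else 2

theorem postF_lt {n : ℕ} {P : Finset (Fin n)} (m : {v // v ∈ P} → ZMod 2) (v : Fin n) :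
    postF m v < 3 := by
  unfold postF
  split_ifs
  · exact (ZMod.val_lt _).trans (by norm_num)
  · norm_num

theorem matBits_getD_index {k n : ℕ} (A : Matrix (Fin k) (Fin n) (ZMod 2)) (i : Fin k) (j : Fin n) :
    (matBits A).getD (i * n + j) 0 = (A i j).val := by
  have h : (i : ℕ) * n + j < k * n := index_lt i.2 j.2
  rw [matBits_getD, dif_pos h]
  congr 2 <;> ext <;> simp [Fin.divNat, Fin.modNat, (div_mod_block j.2).1, Nat.mod_eq_of_lt j.2]

theorem getD_append_add (l₁ l₂ : List ℕ) {k : ℕ} (hk : l₁.length = k) (i : ℕ) :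
    (l₁ ++ l₂).getD (k + i) 0 = l₂.getD i 0 := by
  subst hk
  rw [getD_append', if_neg (by omega)]; congr 1; omega

theorem getD_append_lt (l₁ l₂ : List ℕ) {i : ℕ} (h : i < l₁.length) :
    (l₁ ++ l₂).getD i 0 = l₁.getD i 0 := by rw [getD_append', if_pos h]

theorem bits_getD_index {n : ℕ} (v : Fin n → ZMod 2) (i : Fin n) :
    (bits v).getD i 0 = (v i).val := by rw [bits_getD, dif_pos i.2]

theorem ofFn_getD {n : ℕ} (f : Fin n → ℕ) (i : Fin n) : (List.ofFn f).getD i 0 = f i := by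
  simp [List.getD_eq_getElem?_getD]

/-! ### Graph states -/

/-- The `X`-exponents of the stabilizers of a graph state after the change of basis. -/
def graphC {n : ℕ} (A : Matrix (Fin n) (Fin n) (ZMod 2)) (B : Fin n → Basis) :
    Matrix (Fin n) (Fin n) (ZMod 2) :=
  -- Up to phases, the basis change at an `X` vertex swaps `X` and `Z`; at a `Y` vertex it sends `X`
  -- to `X Z` and `Z` to `X`; at a `Z` vertex it is trivial. The generator of vertex `v` has `X` at
  -- `v` and `Z` at the neighbours.
  Matrix.of fun v u => if v = u then if (B v).code = 0 then 0 else 1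
    else if (B u).code = 2 then 0 else A v u

/-- The `Z`-exponents of the stabilizers of a graph state after the change of basis. -/
def graphD {n : ℕ} (A : Matrix (Fin n) (Fin n) (ZMod 2)) (B : Fin n → Basis) :
    Matrix (Fin n) (Fin n) (ZMod 2) :=
  Matrix.of fun v u => if v = u then if (B v).code = 2 then 0 else 1
    else if (B u).code = 2 then A v u else 0

/-- The phases of the stabilizers of a graph state after the change of basis. -/
def graphP {n : ℕ} (B : Fin n → Basis) (v : Fin n) : ZMod 2 := if (B v).code = 1 then 1 else 0

/-- The code of a basis. -/
def codeE (x : Expr) : Expr := .rd .io (1 + (¢.n * ¢.n + x))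
/-- The current entry of the adjacency matrix. -/
def adjE : Expr := .rd .io (1 + (row * ¢.n + col))

/-- Prepare the generators for a graph state. -/
def graphLoad : Cmd :=
  loadC (Expr.eq row col * Expr.lt 0 (codeE row) + adjE * Expr.lt (codeE col) 2)
    (Expr.eq row col * Expr.lt (codeE row) 2 + adjE * Expr.eq (codeE col) 2)
    (Expr.eq (codeE ¢.q) 1) 0 (.rd .io (1 + (¢.n * ¢.n + (¢.n + ¢.q))))

open Classical in
theorem loads_graphLoad {n : ℕ} (G : SimpleGraph (Fin n)) (B : Fin n → Basis)
    {P : Finset (Fin n)} (m : {v // v ∈ P} → ZMod 2) :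
    Loads graphLoad (graphInput G B m) (graphC (G.adjMatrix (ZMod 2)) B)
      (graphD (G.adjMatrix (ZMod 2)) B) (graphP B) 0 (postF m) := by
  have h1 : ∀ i, (graphInput G B m).getD (1 + i) 0 = (matBits (G.adjMatrix (ZMod 2)) ++
      ((List.ofFn fun v => (B v).code) ++ postWords m)).getD i 0 := fun i => by
    rw [graphInput, add_comm, List.getD_cons_succ, List.append_assoc]
  have hA : ∀ r c : Fin n, (graphInput G B m).getD (1 + (r * n + c)) 0 =
      (G.adjMatrix (ZMod 2) r c).val := fun r c => by
    rw [h1, getD_append_lt _ _ (by rw [matBits_length]; exact index_lt r.2 c.2),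
      matBits_getD_index]
  have hC : ∀ r : Fin n, (graphInput G B m).getD (1 + (n * n + r)) 0 = (B r).code := fun r => by
    rw [h1, getD_append_add _ _ (matBits_length _), getD_append_lt _ _ (by simp), ofFn_getD]
  have h3 : ∀ r : Fin n, (B r).code = 0 ∨ (B r).code = 1 ∨ (B r).code = 2 := fun r => by
    cases B r <;> decide
  have hP : ∀ r : Fin n, (graphInput G B m).getD (1 + (n * n + (n + r))) 0 = postF m r := fun r => by
    rw [h1, getD_append_add _ _ (matBits_length _), getD_append_add _ _ (by simp), postWords,
      ofFn_getD]
    rfl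
  refine loads_loadC (by simp [codeE, adjE]) (by simp [codeE, adjE]) (by simp [codeE]) (by simp)
    (by simp) (fun r c N σ hc h => ?_) (fun r c N σ hc h => ?_) (fun r N σ h => ?_)
    (fun r N σ h => ?_) (fun r N σ h => ?_) (postF_lt m)
  · simp only [codeE, adjE, Expr.eval_add, Expr.eval_lt, Expr.eval_mul, Expr.eval_eq, Expr.eval_div,
      Expr.eval_mod, Expr.eval_var, Expr.eval_rd, Expr.eval_ofNat, h.q, h.N, h.n, h.io,
      (div_mod_block hc).1, (div_mod_block hc).2, hA, hC, graphC, Matrix.of_apply, ← Fin.ext_iff]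
    by_cases hrc : r = c
    · subst hrc
      rcases h3 r with h' | h' | h' <;> simp [h']
    · rcases h3 c with h' | h' | h' <;> simp [h', hrc]
  · simp only [codeE, adjE, Expr.eval_add, Expr.eval_lt, Expr.eval_mul, Expr.eval_eq, Expr.eval_div,
      Expr.eval_mod, Expr.eval_var, Expr.eval_rd, Expr.eval_ofNat, h.q, h.N, h.n, h.io,
      (div_mod_block hc).1, (div_mod_block hc).2, hA, hC, graphD, Matrix.of_apply, ← Fin.ext_iff]
    by_cases hrc : r = c
    · subst hrc
      rcases h3 r with h' | h' | h' <;> simp [h']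
    · rcases h3 c with h' | h' | h' <;> simp [h', hrc]
  · simp only [codeE, Expr.eval_add, Expr.eval_mul, Expr.eval_eq, Expr.eval_var, Expr.eval_rd,
      Expr.eval_ofNat, h.q, h.n, h.io, hC, graphP]
    split_ifs <;> simp
  · simp
  · simp only [Expr.eval_add, Expr.eval_mul, Expr.eval_var, Expr.eval_rd,
      Expr.eval_ofNat, h.q, h.n, h.io, hP]

theorem graphInput_length {n : ℕ} (G : SimpleGraph (Fin n)) (B : Fin n → Basis)
    {P : Finset (Fin n)} (m : {v // v ∈ P} → ZMod 2) :
    (graphInput G B m).length = n * n + n + n + 1 := by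
  simp [graphInput, matBits_length, postWords, add_assoc]

theorem getD_le_of_forall {l : List ℕ} {b : ℕ} (h : ∀ x ∈ l, x ≤ b) (i : ℕ) : l.getD i 0 ≤ b := by
  by_cases hi : i < l.length
  · rw [List.getD_eq_getElem _ _ hi]; exact h _ (List.getElem_mem _)
  · rw [List.getD_eq_default _ _ (not_lt.1 hi)]; exact Nat.zero_le _

theorem le_two_of_mem_bits {n : ℕ} {v : Fin n → ZMod 2} {x : ℕ} (h : x ∈ bits v) : x ≤ 2 := by
  simp only [bits, List.mem_ofFn] at h
  obtain ⟨i, rfl⟩ := h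
  exact (ZMod.val_lt _).le

theorem le_two_of_mem_matBits {k n : ℕ} {A : Matrix (Fin k) (Fin n) (ZMod 2)} {x : ℕ}
    (h : x ∈ matBits A) : x ≤ 2 := by
  rw [matBits_eq] at h; exact le_two_of_mem_bits h

theorem le_two_of_mem_postWords {n : ℕ} {P : Finset (Fin n)} {m : {v // v ∈ P} → ZMod 2} {x : ℕ}
    (h : x ∈ postWords m) : x ≤ 2 := by
  simp only [postWords, List.mem_ofFn] at h
  obtain ⟨i, rfl⟩ := h
  exact Nat.lt_succ_iff.1 (postF_lt m i)

theorem graphInput_le {n : ℕ} (G : SimpleGraph (Fin n)) (B : Fin n → Basis)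
    {P : Finset (Fin n)} (m : {v // v ∈ P} → ZMod 2) (i : ℕ) :
    (graphInput G B m).getD i 0 ≤ n + 2 := by
  classical
  refine getD_le_of_forall (fun x hx => ?_) i
  simp only [graphInput, List.mem_cons, List.mem_append, List.mem_ofFn] at hx
  rcases hx with rfl | (h | ⟨v, rfl⟩) | h
  · omega
  · have := le_two_of_mem_matBits h; omega
  · have : (B v).code ≤ 2 := by cases B v <;> decide
    omega
  · have := le_two_of_mem_postWords h; omega

/-! ### Tableaux -/

/-- The matrix entry in row `n + row` and column `x` of a tableau. -/
def tabE (x : Expr) : Expr := .rd .io (1 + ((¢.n + row) * (¢.n + ¢.n) + x))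
/-- The number of entries of the matrix of a tableau. -/
def tabSize : Expr := (¢.n + ¢.n) * (¢.n + ¢.n)

/-- Prepare the generators for a tableau. -/
def tableauLoad : Cmd :=
  loadC (tabE col) (tabE (¢.n + col)) (.rd .io (1 + (tabSize + (¢.n + ¢.q))))
    (.rd .io (1 + (tabSize + ((¢.n + ¢.n) + (¢.n + ¢.q)))))
    (.rd .io (1 + (tabSize + ((¢.n + ¢.n) + ((¢.n + ¢.n) + ¢.q)))))

/-- Only the stabilizer rows matter, that is, rows `n` to `2 n - 1` and the second halves of the
phase and sign vectors. The destabilizer rows are skipped. -/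
theorem loads_tableauLoad {n : ℕ} (τ : Tableau n) {P : Finset (Fin n)}
    (m : {v // v ∈ P} → ZMod 2) :
    Loads tableauLoad (n :: (tableauBits τ ++ postWords m))
      (Matrix.of fun r c => τ.M (.inr r) (.inl c)) (Matrix.of fun r c => τ.M (.inr r) (.inr c))
      (fun r => τ.p (.inr r)) (fun r => τ.s (.inr r)) (postF m) := by
  set l := n :: (tableauBits τ ++ postWords m) with hl
  have h1 : ∀ i, l.getD (1 + i) 0 = (matBits (τ.M.reindex finSumFinEquiv finSumFinEquiv) ++
      (bits (fun i => τ.p (finSumFinEquiv.symm i)) ++ (bits (fun i => τ.s (finSumFinEquiv.symm i)) ++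
        postWords m))).getD i 0 := fun i => by
    rw [hl, add_comm, List.getD_cons_succ, tableauBits]
    simp only [List.append_assoc]
  have hM : ∀ r c : Fin (n + n), l.getD (1 + (r * (n + n) + c)) 0 =
      (τ.M (finSumFinEquiv.symm r) (finSumFinEquiv.symm c)).val := fun r c => by
    rw [h1, getD_append_lt _ _ (by rw [matBits_length]; exact index_lt r.2 c.2),
      matBits_getD_index]
    rfl
  have hMl : ∀ r c : Fin n, l.getD (1 + ((n + r) * (n + n) + c)) 0 = (τ.M (.inr r) (.inl c)).val :=
    fun r c => by
      have := hM (Fin.natAdd n r) (Fin.castAdd n c)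
      rwa [finSumFinEquiv_symm_apply_natAdd, finSumFinEquiv_symm_apply_castAdd] at this
  have hMr : ∀ r c : Fin n, l.getD (1 + ((n + r) * (n + n) + (n + c))) 0 =
      (τ.M (.inr r) (.inr c)).val := fun r c => by
    have := hM (Fin.natAdd n r) (Fin.natAdd n c)
    rwa [finSumFinEquiv_symm_apply_natAdd, finSumFinEquiv_symm_apply_natAdd] at this
  have hp : ∀ r : Fin n, l.getD (1 + ((n + n) * (n + n) + (n + r))) 0 = (τ.p (.inr r)).val :=
    fun r => by
      rw [h1, getD_append_add _ _ (matBits_length _), getD_append_lt _ _ (by simp [bits_length])]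
      have := bits_getD_index (fun i => τ.p (finSumFinEquiv.symm i)) (Fin.natAdd n r)
      rwa [finSumFinEquiv_symm_apply_natAdd] at this
  have hs : ∀ r : Fin n, l.getD (1 + ((n + n) * (n + n) + ((n + n) + (n + r)))) 0 =
      (τ.s (.inr r)).val := fun r => by
    rw [h1, getD_append_add _ _ (matBits_length _), getD_append_add _ _ (bits_length _),
      getD_append_lt _ _ (by simp [bits_length])]
    have := bits_getD_index (fun i => τ.s (finSumFinEquiv.symm i)) (Fin.natAdd n r)
    rwa [finSumFinEquiv_symm_apply_natAdd] at this
  have hP : ∀ r : Fin n, l.getD (1 + ((n + n) * (n + n) + ((n + n) + ((n + n) + r)))) 0 =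
      postF m r := fun r => by
    rw [h1, getD_append_add _ _ (matBits_length _), getD_append_add _ _ (bits_length _),
      getD_append_add _ _ (bits_length _), postWords, ofFn_getD]
    rfl
  refine loads_loadC (by simp [tabE]) (by simp [tabE]) (by simp [tabSize]) (by simp [tabSize])
    (by simp [tabSize]) (fun r c N σ hc h => ?_) (fun r c N σ hc h => ?_) (fun r N σ h => ?_)
    (fun r N σ h => ?_) (fun r N σ h => ?_) (postF_lt m)
  · simp only [tabE, Expr.eval_add, Expr.eval_mul, Expr.eval_div, Expr.eval_mod, Expr.eval_var,
      Expr.eval_rd, Expr.eval_ofNat, h.q, h.N, h.n, h.io, (div_mod_block hc).1,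
      (div_mod_block hc).2, hMl, Matrix.of_apply, ZMod.natCast_val, ZMod.cast_id', id]
  · simp only [tabE, Expr.eval_add, Expr.eval_mul, Expr.eval_div, Expr.eval_mod, Expr.eval_var,
      Expr.eval_rd, Expr.eval_ofNat, h.q, h.N, h.n, h.io, (div_mod_block hc).1,
      (div_mod_block hc).2, hMr, Matrix.of_apply, ZMod.natCast_val, ZMod.cast_id', id]
  · simp only [tabSize, Expr.eval_add, Expr.eval_mul, Expr.eval_var, Expr.eval_rd, Expr.eval_ofNat,
      h.q, h.n, h.io, hp, ZMod.natCast_val, ZMod.cast_id', id]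
  · simp only [tabSize, Expr.eval_add, Expr.eval_mul, Expr.eval_var, Expr.eval_rd, Expr.eval_ofNat,
      h.q, h.n, h.io, hs, ZMod.natCast_val, ZMod.cast_id', id]
  · simp only [tabSize, Expr.eval_add, Expr.eval_mul, Expr.eval_var, Expr.eval_rd, Expr.eval_ofNat,
      h.q, h.n, h.io, hP]

theorem tableauInput_length {n : ℕ} (τ : Tableau n) {P : Finset (Fin n)}
    (m : {v // v ∈ P} → ZMod 2) : (n :: (tableauBits τ ++ postWords m)).length =
      (n + n) * (n + n) + (n + n) + (n + n) + n + 1 := by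
  simp [tableauBits, matBits_length, bits_length, postWords, add_assoc]

theorem tableauInput_le {n : ℕ} (τ : Tableau n) {P : Finset (Fin n)}
    (m : {v // v ∈ P} → ZMod 2) (i : ℕ) :
    (n :: (tableauBits τ ++ postWords m)).getD i 0 ≤ n + 2 := by
  refine getD_le_of_forall (fun x hx => ?_) i
  simp only [tableauBits, List.mem_cons, List.mem_append] at hx
  rcases hx with rfl | ((h | h) | h) | h
  · omega
  · have := le_two_of_mem_matBits h; omega
  · have := le_two_of_mem_bits h; omega
  · have := le_two_of_mem_bits h; omega
  · have := le_two_of_mem_postWords h; omega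

end StabSim


namespace WordRAM

/-! ### The running time -/

variable {c : Cmd} {T : ℕ → ℕ} {ω a : ℝ}

/-- Splits off the quadratic part. The remaining ratio `2 ^ (ω - 2)` is the growth factor of the
cost of the tree levels; it is 1 exactly if `ω = 2`. -/
theorem two_pow_rpow (ω : ℝ) (e : ℕ) :
    (((2 ^ e : ℕ) : ℝ)) ^ ω = 4 ^ e * ((2 : ℝ) ^ (ω - 2)) ^ e := by
  rw [← mul_pow, show (4 : ℝ) = 2 ^ (2 : ℝ) by norm_num, ← Real.rpow_add (by norm_num),
    add_sub_cancel, Nat.cast_pow, Nat.cast_ofNat, ← Real.rpow_natCast, ← Real.rpow_mul (by norm_num),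
    mul_comm, Real.rpow_mul (by norm_num), Real.rpow_natCast]

theorem one_le_ratio (hω : 2 ≤ ω) : 1 ≤ (2 : ℝ) ^ (ω - 2) :=
  Real.one_le_rpow (by norm_num) (by linarith)

theorem blkTime_le (hω : 2 ≤ ω) (hT : ∀ n : ℕ, 1 ≤ n → (T n : ℝ) ≤ a * (n : ℝ) ^ ω) (e : ℕ) :
    (blkTime c T (2 ^ e) : ℝ) ≤
      (30 * a + c.regBound + 80 * cst) * (4 ^ e * ((2 : ℝ) ^ (ω - 2)) ^ e) := by
  have h1 := hT (2 ^ e) Nat.one_le_two_pow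
  rw [two_pow_rpow] at h1
  have h4 : (1 : ℝ) ≤ 4 ^ e := one_le_pow₀ (by norm_num)
  have hr : (1 : ℝ) ≤ ((2 : ℝ) ^ (ω - 2)) ^ e := one_le_pow₀ (one_le_ratio hω)
  set y := (4 : ℝ) ^ e * ((2 : ℝ) ^ (ω - 2)) ^ e with hy
  have hy4 : (4 : ℝ) ^ e ≤ y := le_mul_of_one_le_right (by positivity) hr
  have h2 : ((2 ^ e * 2 ^ e + 1 : ℕ) : ℝ) ≤ 2 * y := by
    have : ((2 ^ e * 2 ^ e : ℕ) : ℝ) = 4 ^ e := by push_cast; rw [← mul_pow]; norm_num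
    rw [Nat.cast_add, this, Nat.cast_one]; linarith
  have h3 : (c.regBound : ℝ) ≤ c.regBound * y := le_mul_of_one_le_right (by positivity) (by linarith)
  have h5 : (cst : ℝ) * ((2 ^ e * 2 ^ e + 1 : ℕ) : ℝ) ≤ cst * (2 * y) :=
    mul_le_mul_of_nonneg_left h2 (by positivity)
  calc (blkTime c T (2 ^ e) : ℝ)
      = 30 * T (2 ^ e) + c.regBound + 40 * (cst * ((2 ^ e * 2 ^ e + 1 : ℕ) : ℝ)) := by
        simp only [blkTime]; push_cast; ring
    _ ≤ 30 * (a * y) + c.regBound * y + 40 * (cst * (2 * y)) := by linarith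
    _ = _ := by ring

/-- Joining two blocks of width `2^e` costs a constant times `(2^k / 2^e) * 4^e * r^e = 2^k * 2^e *
r^e`, with `r = 2^(ω - 2)`. Doubling the width doubles the number of such nodes below, so every
level contributes `2^k * 2^d` times its own power of `r`. -/
theorem treeTime_le (hω : 2 ≤ ω) (hT : ∀ n : ℕ, 1 ≤ n → (T n : ℝ) ≤ a * (n : ℝ) ^ ω) (ha : 0 ≤ a)
    (k : ℕ) : ∀ d ≤ k, (treeTime c T (2 ^ k) d : ℝ) ≤
      (3 * (30 * a + c.regBound + 80 * cst) + 160 * cst) *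
        (2 ^ k * 2 ^ d * (1 + ∑ e ∈ Finset.range d, ((2 : ℝ) ^ (ω - 2)) ^ e)) := by
  set K := 30 * a + c.regBound + 80 * (cst : ℝ) with hK
  have hK0 : 0 ≤ K := by positivity
  have hc0 : (0 : ℝ) ≤ cst := by positivity
  have h2k : (1 : ℝ) ≤ 2 ^ k := one_le_pow₀ (by norm_num)
  intro d
  induction d with
  | zero =>
    intro _
    simp only [treeTime, Finset.range_zero, Finset.sum_empty, pow_zero, mul_one, add_zero]
    push_cast
    nlinarith [mul_nonneg hc0 (by linarith : (0 : ℝ) ≤ 2 ^ k - 1), mul_nonneg hK0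
      (by linarith : (0 : ℝ) ≤ 2 ^ k), mul_nonneg hc0 (by linarith : (0 : ℝ) ≤ 2 ^ k)]
  | succ d ih =>
    intro hd
    have h1 := ih (by omega)
    have hb := blkTime_le (c := c) hω hT d
    have hr : (1 : ℝ) ≤ ((2 : ℝ) ^ (ω - 2)) ^ d := one_le_pow₀ (one_le_ratio hω)
    set r := ((2 : ℝ) ^ (ω - 2)) ^ d with hrd
    set S := ∑ e ∈ Finset.range d, ((2 : ℝ) ^ (ω - 2)) ^ e with hS
    set y : ℝ := 2 ^ k * 2 ^ d with hy
    have h2d : (1 : ℝ) ≤ 2 ^ d := one_le_pow₀ (by norm_num)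
    have hy1 : 1 ≤ y := by nlinarith
    have hdiv : ((2 ^ k / 2 ^ d : ℕ) : ℝ) * 4 ^ d = y := by
      rw [Nat.pow_div (by omega) (by norm_num), hy, show (4 : ℝ) = 2 * 2 by norm_num, mul_pow,
        ← mul_assoc]
      congr 1
      push_cast
      rw [← pow_add]; congr 1; omega
    have hop : ((2 ^ k / 2 ^ d * blkTime c T (2 ^ d) : ℕ) : ℝ) ≤ K * (y * r) := by
      rw [Nat.cast_mul]
      calc ((2 ^ k / 2 ^ d : ℕ) : ℝ) * blkTime c T (2 ^ d)
          ≤ ((2 ^ k / 2 ^ d : ℕ) : ℝ) * (K * (4 ^ d * r)) :=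
            mul_le_mul_of_nonneg_left hb (by positivity)
        _ = K * (((2 ^ k / 2 ^ d : ℕ) : ℝ) * 4 ^ d * r) := by ring
        _ = _ := by rw [hdiv]
    have hyr : y ≤ y * r := le_mul_of_one_le_right (by linarith) hr
    have hm : ((2 ^ k * 2 ^ d + 1 : ℕ) : ℝ) ≤ 2 * (y * r) := by push_cast; rw [← hy]; linarith
    have hcm := mul_le_mul_of_nonneg_left hm hc0
    have e : (treeTime c T (2 ^ k) (d + 1) : ℝ) = 2 * treeTime c T (2 ^ k) d +
        6 * ((2 ^ k / 2 ^ d * blkTime c T (2 ^ d) : ℕ) : ℝ) +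
        160 * (cst * ((2 ^ k * 2 ^ d + 1 : ℕ) : ℝ)) := by
      simp only [treeTime, opTime]; push_cast; ring
    rw [e, Finset.sum_range_succ, ← hrd, ← hS, pow_succ]
    -- The constant is chosen so that twice the bound for `d`, plus the new terms `6 K` and `320
    -- cst`, is exactly the bound for `d + 1`.
    calc _ ≤ 2 * ((3 * K + 160 * cst) * (y * (1 + S))) + 6 * (K * (y * r)) +
          160 * (cst * (2 * (y * r))) := by linarith
      _ = _ := by rw [hy]; ring

theorem sampleTime_le (hω : 2 ≤ ω) (hT : ∀ n : ℕ, 1 ≤ n → (T n : ℝ) ≤ a * (n : ℝ) ^ ω) (ha : 0 ≤ a) :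
    ∃ K : ℝ, 0 ≤ K ∧ ∀ n : ℕ, (sampleTime c T n : ℝ) ≤ K * (4 ^ lg n *
      (((2 : ℝ) ^ (ω - 2)) ^ lg n + (1 + ∑ e ∈ Finset.range (lg n), ((2 : ℝ) ^ (ω - 2)) ^ e))) := by
  set K := 30 * a + c.regBound + 80 * (cst : ℝ) with hK
  have hK0 : 0 ≤ K := by positivity
  have hc0 : (0 : ℝ) ≤ cst := by positivity
  refine ⟨9 * K + 2 * (3 * K + 160 * cst) + 800 * cst, by positivity, fun n => ?_⟩
  have hb := blkTime_le (c := c) hω hT (lg n)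
  have ht := treeTime_le (c := c) hω hT ha (lg n) (lg n) le_rfl
  rw [← hK] at hb ht
  have hr : (1 : ℝ) ≤ ((2 : ℝ) ^ (ω - 2)) ^ lg n := one_le_pow₀ (one_le_ratio hω)
  set k := lg n
  set r := ((2 : ℝ) ^ (ω - 2)) ^ k
  have h4 : (1 : ℝ) ≤ 4 ^ k := one_le_pow₀ (by norm_num)
  have hS0 : 0 ≤ ∑ e ∈ Finset.range k, ((2 : ℝ) ^ (ω - 2)) ^ e := by positivity
  set S := ∑ e ∈ Finset.range k, ((2 : ℝ) ^ (ω - 2)) ^ e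
  have h22 : (2 : ℝ) ^ k * 2 ^ k = 4 ^ k := by rw [← mul_pow]; norm_num
  rw [h22] at ht
  have e : (sampleTime c T n : ℝ) = 9 * blkTime c T (2 ^ k) + 2 * treeTime c T (2 ^ k) k +
      400 * cst * (2 ^ k * 2 ^ k + 1) := by
    simp only [sampleTime]; push_cast; rfl
  rw [e, h22]
  have hy : (4 : ℝ) ^ k ≤ 4 ^ k * (r + (1 + S)) := le_mul_of_one_le_right (by positivity) (by linarith)
  have h1 : (4 : ℝ) ^ k * r ≤ 4 ^ k * (r + (1 + S)) :=
    mul_le_mul_of_nonneg_left (by linarith) (by positivity)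
  have h2 : (4 : ℝ) ^ k * (1 + S) ≤ 4 ^ k * (r + (1 + S)) :=
    mul_le_mul_of_nonneg_left (by linarith) (by positivity)
  set z := (4 : ℝ) ^ k * (r + (1 + S))
  have a1 := mul_le_mul_of_nonneg_left h1 hK0
  have a2 := mul_le_mul_of_nonneg_left h2 (by positivity : 0 ≤ 3 * K + 160 * (cst : ℝ))
  have a3 : (cst : ℝ) * (4 ^ k + 1) ≤ cst * (2 * z) :=
    mul_le_mul_of_nonneg_left (by linarith) hc0
  calc _ ≤ 9 * (K * z) + 2 * ((3 * K + 160 * cst) * z) + 400 * (cst * (2 * z)) := by linarith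
    _ = _ := by ring

theorem four_pow_lg_mul (ω : ℝ) (n : ℕ) :
    4 ^ lg n * ((2 : ℝ) ^ (ω - 2)) ^ lg n = ((2 ^ lg n : ℕ) : ℝ) ^ ω := (two_pow_rpow ω _).symm

/-- For `ω = 2` the sum has `lg n` equal terms and yields the logarithm. For `ω > 2` it is geometric
and dominated by its last term. The dimension is at most `5 n`, which costs a constant factor. -/
theorem isBigO_sampleTime (hω : 2 ≤ ω) (hT : ∀ n : ℕ, 1 ≤ n → (T n : ℝ) ≤ a * (n : ℝ) ^ ω)
    (ha : 0 ≤ a) : (fun n => (sampleTime c T n : ℝ)) =O[atTop] StabSim.timeBound ω := by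
  obtain ⟨K, hK, h⟩ := sampleTime_le (c := c) hω hT ha
  have hN : ∀ n : ℕ, 1 ≤ n → ((2 ^ lg n : ℕ) : ℝ) ≤ 5 * n := fun n hn => by
    have := (lg_bounds n).2
    exact_mod_cast (by omega : 2 ^ lg n ≤ 5 * n)
  rcases hω.eq_or_lt with rfl | hω'
  -- The factor 25 comes from `(5 n)^2`, and 6 from `2 + lg n ≤ 2 + 4 log n ≤ 6 log n`, which uses
  -- `log n ≥ 1` and `log 5 ≤ log n`.
  · refine IsBigO.of_bound (K * (25 * 6)) (eventually_atTop.2 ⟨5, fun n hn => ?_⟩)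
    have hn' : (5 : ℝ) ≤ n := by exact_mod_cast hn
    have hlog5 : Real.log 5 ≤ Real.log n := Real.log_le_log (by norm_num) hn'
    have hlog1 : 1 ≤ Real.log n := by
      rw [Real.le_log_iff_exp_le (by linarith)]
      linarith [Real.exp_one_lt_d9]
    have h5 := hN n (by omega)
    have hk : (lg n : ℝ) ≤ 4 * Real.log n := by
      have h1 := Real.log_le_log (by positivity) h5
      rw [Nat.cast_pow, Real.log_pow, Real.log_mul (by norm_num) (by linarith), Nat.cast_ofNat] at h1
      have := Real.log_two_gt_d9
      nlinarith [(Nat.cast_nonneg (lg n) : (0 : ℝ) ≤ lg n)]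
    have h4 : (4 : ℝ) ^ lg n ≤ 25 * (n : ℝ) ^ 2 := by
      have : (4 : ℝ) ^ lg n = ((2 ^ lg n : ℕ) : ℝ) ^ 2 := by
        push_cast; rw [← pow_mul, mul_comm, pow_mul]; norm_num
      rw [this]
      nlinarith [(Nat.cast_nonneg (2 ^ lg n) : (0 : ℝ) ≤ (2 ^ lg n : ℕ))]
    have h' := h n
    simp only [sub_self, Real.rpow_zero, one_pow, Finset.sum_const, Finset.card_range,
      nsmul_eq_mul, mul_one] at h'
    rw [StabSim.timeBound, if_pos rfl, Real.norm_of_nonneg (by positivity),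
      Real.norm_of_nonneg (by positivity)]
    refine h'.trans ?_
    rw [mul_assoc K]
    refine mul_le_mul_of_nonneg_left ?_ hK
    calc (4 : ℝ) ^ lg n * (1 + (1 + lg n)) ≤ 25 * (n : ℝ) ^ 2 * (6 * Real.log n) :=
          mul_le_mul h4 (by linarith) (by positivity) (by positivity)
      _ = _ := by ring
  · have hr : 1 < (2 : ℝ) ^ (ω - 2) := Real.one_lt_rpow (by norm_num) (by linarith)
    set r := (2 : ℝ) ^ (ω - 2) with hrdef
    refine IsBigO.of_bound (K * ((2 + 1 / (r - 1)) * 5 ^ ω)) (eventually_atTop.2 ⟨1, fun n hn => ?_⟩)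
    have h5 := hN n hn
    rw [StabSim.timeBound, if_neg hω'.ne', Real.norm_of_nonneg (by positivity),
      Real.norm_of_nonneg (by positivity)]
    refine (h n).trans ?_
    rw [mul_assoc K]
    refine mul_le_mul_of_nonneg_left ?_ hK
    have hr1 : 0 < r - 1 := by linarith
    have hrk : 1 ≤ r ^ lg n := one_le_pow₀ hr.le
    have hgeom : ∑ e ∈ Finset.range (lg n), r ^ e ≤ 1 / (r - 1) * r ^ lg n := by
      rw [geom_sum_eq hr.ne', div_eq_inv_mul, one_div]
      exact mul_le_mul_of_nonneg_left (by linarith) (by positivity)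
    calc 4 ^ lg n * (r ^ lg n + (1 + ∑ e ∈ Finset.range (lg n), r ^ e))
        ≤ 4 ^ lg n * ((2 + 1 / (r - 1)) * r ^ lg n) :=
          mul_le_mul_of_nonneg_left (by linarith) (by positivity)
      _ = (2 + 1 / (r - 1)) * (4 ^ lg n * r ^ lg n) := by ring
      _ = (2 + 1 / (r - 1)) * ((2 ^ lg n : ℕ) : ℝ) ^ ω := by rw [hrdef, four_pow_lg_mul]
      _ ≤ (2 + 1 / (r - 1)) * (5 * n) ^ ω := by
          refine mul_le_mul_of_nonneg_left (Real.rpow_le_rpow (by positivity) h5 (by linarith))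
            (by positivity)
      _ = _ := by rw [Real.mul_rpow (by norm_num) (by positivity)]; ring

/-- A polynomial bound valid for all `n`, small ones included, is needed because the running time
must fit into the bound `B` for the word size. A constant `C` is absorbed as `C ≤ 2 ^ ⌈C⌉ ≤ (n + 2)
^ ⌈C⌉`. -/
theorem exists_pow_bound {f : ℕ → ℕ} (hω : 2 ≤ ω)
    (hf : (fun n => (f n : ℝ)) =O[atTop] StabSim.timeBound ω) : ∃ M, ∀ n, f n ≤ (n + 2) ^ M := by
  have h1 : StabSim.timeBound ω =O[atTop] fun n : ℕ => ((n + 2 : ℕ) : ℝ) ^ (⌈ω⌉₊ + 1) := by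
    refine IsBigO.of_bound 1 (eventually_atTop.2 ⟨1, fun n hn => ?_⟩)
    have hn' : (1 : ℝ) ≤ n := by exact_mod_cast hn
    have hlog : 0 ≤ Real.log n := Real.log_nonneg hn'
    have hn2 : (n : ℝ) ≤ ((n + 2 : ℕ) : ℝ) := by push_cast; linarith
    rw [one_mul, Real.norm_of_nonneg (by unfold StabSim.timeBound; split_ifs <;> positivity),
      Real.norm_of_nonneg (by positivity), StabSim.timeBound]
    have hc2 : 2 ≤ ⌈ω⌉₊ := by exact_mod_cast hω.trans (Nat.le_ceil ω)
    split_ifs with h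
    · calc (n : ℝ) ^ 2 * Real.log n ≤ (n : ℝ) ^ 2 * n :=
            mul_le_mul_of_nonneg_left ((Real.log_le_sub_one_of_pos (by linarith)).trans
              (by linarith)) (by positivity)
        _ = (n : ℝ) ^ 3 := by ring
        _ ≤ (n : ℝ) ^ (⌈ω⌉₊ + 1) := pow_le_pow_right₀ hn' (by omega)
        _ ≤ _ := pow_le_pow_left₀ (by linarith) hn2 _
    · calc (n : ℝ) ^ ω ≤ (n : ℝ) ^ ((⌈ω⌉₊ + 1 : ℕ) : ℝ) :=
            Real.rpow_le_rpow_of_exponent_le hn' ((Nat.le_ceil ω).trans (by push_cast; linarith))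
        _ = (n : ℝ) ^ (⌈ω⌉₊ + 1) := Real.rpow_natCast _ _
        _ ≤ _ := pow_le_pow_left₀ (by linarith) hn2 _
  obtain ⟨C, hC, h⟩ := bound_of_isBigO_nat_atTop (hf.trans h1)
  refine ⟨⌈C⌉₊ + (⌈ω⌉₊ + 1), fun n => ?_⟩
  have h2 := h (x := n) (by positivity)
  rw [Real.norm_of_nonneg (by positivity), Real.norm_of_nonneg (by positivity)] at h2
  have h3 : C ≤ ((n + 2 : ℕ) : ℝ) ^ ⌈C⌉₊ := by
    refine (Nat.le_ceil C).trans ?_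
    exact_mod_cast (Nat.lt_two_pow_self).le.trans (Nat.pow_le_pow_left (by omega) _)
  have h4 : (f n : ℝ) ≤ ((n + 2 : ℕ) : ℝ) ^ (⌈C⌉₊ + (⌈ω⌉₊ + 1)) := by
    rw [pow_add]
    exact h2.trans (mul_le_mul_of_nonneg_right h3 (by positivity))
  exact_mod_cast h4

end WordRAM


namespace Qubit

open WordRAM

/-! ### Stabilized states -/

/-- The sign `(-1)^a`. -/
noncomputable def sgn (a : ZMod 2) : ℂ := (-1) ^ a.val

@[simp] theorem sgn_zero : sgn 0 = 1 := by simp [sgn]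

theorem sgn_one : sgn 1 = -1 := by simp [sgn, ZMod.val_one]

theorem zmod_two_cases (a : ZMod 2) : a = 0 ∨ a = 1 := by revert a; decide

theorem sgn_add (a b : ZMod 2) : sgn (a + b) = sgn a * sgn b := by
  rcases zmod_two_cases a with rfl | rfl <;> rcases zmod_two_cases b with rfl | rfl <;>
    simp [sgn_one, show (1 : ZMod 2) + 1 = 0 from by decide]

theorem sgn_ne_zero (a : ZMod 2) : sgn a ≠ 0 := by simp [sgn]

theorem norm_sgn (a : ZMod 2) : ‖sgn a‖ = 1 := by simp [sgn]

theorem sgn_sum {ι : Type*} (t : Finset ι) (f : ι → ZMod 2) :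
    sgn (∑ i ∈ t, f i) = ∏ i ∈ t, sgn (f i) := by
  classical
  induction t using Finset.induction_on with
  | empty => simp
  | insert a t ha ih => rw [Finset.sum_insert ha, Finset.prod_insert ha, sgn_add, ih]

theorem sgn_inj {a b : ZMod 2} (h : sgn a = sgn b) : a = b := by
  rcases zmod_two_cases a with rfl | rfl <;> rcases zmod_two_cases b with rfl | rfl <;>
    simp_all [sgn_one] <;> norm_num at h

/-- The carry of the addition modulo 2 contributes `i^2 = -1`. -/
theorem I_pow_val_mul (a b : ZMod 2) :
    Complex.I ^ a.val * Complex.I ^ b.val = sgn (a * b) * Complex.I ^ (a + b).val := by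
  rcases zmod_two_cases a with rfl | rfl <;> rcases zmod_two_cases b with rfl | rfl <;>
    simp [sgn_one, ZMod.val_one, show (1 : ZMod 2) + 1 = 0 from by decide]

variable {n N : ℕ}

theorem xz_apply (a b x y : Fin n → ZMod 2) :
    xz a b x y = if x = y + a then sgn (b ⬝ᵥ y) else 0 := by
  simp only [xz, tensor, xz1]
  split_ifs with h
  · subst h
    rw [dotProduct, sgn_sum]
    exact Finset.prod_congr rfl fun v _ => by simp [sgn]
  · obtain ⟨v, hv⟩ := Function.ne_iff.1 h
    exact Finset.prod_eq_zero (Finset.mem_univ v) (if_neg hv)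

theorem add_add_self (x a : Fin n → ZMod 2) : x + a + a = x := by
  funext i; simp [add_assoc, CharTwo.add_self_eq_zero]

theorem xz_mulVec (a b : Fin n → ZMod 2) (ψ : Vec n) (x : Fin n → ZMod 2) :
    (xz a b).mulVec ψ x = sgn (b ⬝ᵥ (x + a)) * ψ (x + a) := by
  rw [Matrix.mulVec, dotProduct, Finset.sum_eq_single (x + a)]
  · rw [xz_apply, if_pos (add_add_self x a).symm]
  · intro y _ hy
    rw [xz_apply, if_neg, zero_mul]
    rintro rfl
    exact hy (add_add_self y a).symm
  · simp

/-- The nonzero vector `ψ` is stabilized by `n` independent generators `i^p (-1)^s X^C Z^D`. -/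
structure Stabilizes (C D : Matrix (Fin n) (Fin n) (ZMod 2)) (p s : Fin n → ZMod 2) (ψ : Vec n) :
    Prop where
  ne : ψ ≠ 0
  fix : ∀ j x, Complex.I ^ (p j).val * sgn (s j) * (sgn (D j ⬝ᵥ (x + C j)) * ψ (x + C j)) = ψ x
  indep : ∀ l : Fin n → ZMod 2, Matrix.vecMul l C = 0 → Matrix.vecMul l D = 0 → l = 0

/-- The product of powers of `i` up to a sign. -/
theorem prod_I_pow (x : ℕ → ZMod 2) (k : ℕ) :
    ∏ j ∈ Finset.range k, Complex.I ^ (x j).val =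
      sgn (∑ j ∈ Finset.range k, ∑ i ∈ Finset.range j, x i * x j) *
        Complex.I ^ (∑ j ∈ Finset.range k, x j).val := by
  induction k with
  | zero => simp
  | succ k ih =>
    rw [Finset.prod_range_succ, ih, mul_assoc, I_pow_val_mul, Finset.sum_range_succ,
      Finset.sum_range_succ, sgn_add, Finset.sum_mul, mul_assoc]

/-- The action of the product of generators. -/
theorem prod_fix {ψ : Vec n} {c d : ℕ → Fin n → ZMod 2} {p s : ℕ → ZMod 2}
    (h : ∀ j x, Complex.I ^ (p j).val * sgn (s j) * (sgn (d j ⬝ᵥ (x + c j)) * ψ (x + c j)) = ψ x)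
    (l : ℕ → ZMod 2) (y : Fin n → ZMod 2) (k : ℕ) :
    ψ y = (∏ j ∈ Finset.range k, Complex.I ^ (l j * p j).val) *
      sgn (∑ j ∈ Finset.range k, l j * (s j + d j ⬝ᵥ (y + ∑ i ∈ Finset.range j, l i • c i + c j))) *
      ψ (y + ∑ i ∈ Finset.range k, l i • c i) := by
  induction k with
  | zero => simp
  | succ k ih =>
    rw [Finset.prod_range_succ, Finset.sum_range_succ, Finset.sum_range_succ, sgn_add]
    rcases zmod_two_cases (l k) with hk | hk
    · simpa [hk] using ih
    · rw [ih, ← h k (y + ∑ i ∈ Finset.range k, l i • c i)]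
      simp only [hk, one_mul, one_smul, sgn_add, add_assoc]
      ring

/-- When the translation part of the product vanishes, the product multiplies the amplitude at `y`
by a scalar, which must be 1 where `ψ y ≠ 0`. Comparing signs gives a linear condition on `y` whose
right hand side is the quadratic form of the exponents. -/
theorem eq_of_prod_fix {ψ : Vec n} {c d : ℕ → Fin n → ZMod 2} {p s : ℕ → ZMod 2}
    (h : ∀ j x, Complex.I ^ (p j).val * sgn (s j) * (sgn (d j ⬝ᵥ (x + c j)) * ψ (x + c j)) = ψ x)
    {l : ℕ → ZMod 2} {y : Fin n → ZMod 2} {k : ℕ} (hl : ∑ i ∈ Finset.range k, l i • c i = 0)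
    (hy : ψ y ≠ 0) : ∑ j ∈ Finset.range k, l j * (d j ⬝ᵥ y) = ∑ j ∈ Finset.range k, l j *
      (s j + d j ⬝ᵥ c j + ∑ i ∈ Finset.range j, l i * (d j ⬝ᵥ c i + p j * p i)) := by
  have h1 := prod_fix h l y k
  rw [hl, add_zero, prod_I_pow] at h1
  have h2 : sgn (∑ j ∈ Finset.range k, ∑ i ∈ Finset.range j, l i * p i * (l j * p j)) *
      Complex.I ^ (∑ j ∈ Finset.range k, l j * p j).val *
      sgn (∑ j ∈ Finset.range k, l j * (s j + d j ⬝ᵥ (y + ∑ i ∈ Finset.range j, l i • c i + c j))) = 1 :=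
    (mul_eq_right₀ hy).1 h1.symm
  rcases zmod_two_cases (∑ j ∈ Finset.range k, l j * p j) with hp | hp
  · rw [hp, ZMod.val_zero, pow_zero, mul_one, ← sgn_add, ← sgn_zero] at h2
    have h3 := sgn_inj h2
    rw [← Finset.sum_add_distrib] at h3
    rw [← sub_eq_zero, ← Finset.sum_sub_distrib, ← h3]
    refine Finset.sum_congr rfl fun j _ => ?_
    rw [CharTwo.sub_eq_add, ← mul_add, dotProduct_add, dotProduct_add, dotProduct_sum]
    simp only [dotProduct_smul, smul_eq_mul, mul_add, Finset.sum_add_distrib, Finset.mul_sum]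
    have e : ∀ i, l i * p i * (l j * p j) = l j * (l i * (p j * p i)) := fun i => by ring
    simp only [e]
    ring
  -- An odd total exponent would make the scalar `± i`, whose real part is not 1.
  · rw [hp] at h2
    exfalso
    generalize ∑ j ∈ Finset.range k, ∑ i ∈ Finset.range j, l i * p i * (l j * p j) = e1 at h2
    generalize ∑ j ∈ Finset.range k,
        l j * (s j + d j ⬝ᵥ (y + ∑ i ∈ Finset.range j, l i • c i + c j)) = e2 at h2
    have h3 := congrArg (fun z : ℂ => z.re) h2
    rcases zmod_two_cases e1 with rfl | rfl <;> rcases zmod_two_cases e2 with rfl | rfl <;>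
      simp [sgn_one, ZMod.val_one] at h3

end Qubit


/-! ### The support of a stabilizer state. -/

namespace Qubit

open WordRAM Matrix

variable {n N : ℕ}

theorem vec_add_self {ι : Type*} (v : ι → ZMod 2) : v + v = 0 :=
  funext fun _ => CharTwo.add_self_eq_zero _

theorem pad_mulVec_apply (hn : n ≤ N) (M : Matrix (Fin n) (Fin n) (ZMod 2)) (v : Fin N → ZMod 2)
    (r : Fin N) : (pad N M *ᵥ v) r =
      if h : (r : ℕ) < n then (M *ᵥ fun i => v (Fin.castLE hn i)) ⟨r, h⟩ else 0 := by
  split_ifs with h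
  · simp only [mulVec, dotProduct]
    symm
    refine Finset.sum_of_injOn (Fin.castLE hn) (Fin.castLE_injective hn).injOn (by simp) ?_ ?_
    · intro i _ hi
      have : ¬ (i : ℕ) < n := fun h' => hi ⟨⟨i, h'⟩, by simp⟩
      simp [pad, this]
    · intro i _
      simp [pad, h]
  · simp [mulVec, dotProduct, pad, h]

/-- The rows of a matrix, followed by zeros. -/
def extRow (M : Matrix (Fin n) (Fin n) (ZMod 2)) (j : ℕ) : Fin n → ZMod 2 :=
  if h : j < n then M ⟨j, h⟩ else 0

/-- The entries of a vector, followed by zeros. -/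
def extV (v : Fin n → ZMod 2) (j : ℕ) : ZMod 2 := if h : j < n then v ⟨j, h⟩ else 0

theorem extV_fin (v : Fin n → ZMod 2) (j : Fin n) : extV v j = v j := by simp [extV]

theorem pad_castLE (hn : n ≤ N) (M : Matrix (Fin n) (Fin n) (ZMod 2)) (r : Fin N) (v : Fin n) :
    pad N M r (Fin.castLE hn v) = extRow M r v := by
  by_cases h : (r : ℕ) < n <;> simp [pad, extRow, h]

theorem padV_castLE (hn : n ≤ N) (v : Fin n → ZMod 2) (i : Fin n) :
    padV N v (Fin.castLE hn i) = v i := by simp [padV]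

/-- A linear section of the map onto its range, extended to the whole space, is a generalized
inverse. It is needed only for `norm_eq`, where no algorithm supplies one. -/
theorem exists_ginv (C : Matrix (Fin n) (Fin n) (ZMod 2)) : ∃ G, C * G * C = C := by
  obtain ⟨s, hs⟩ := C.mulVecLin.rangeRestrict.exists_rightInverse_of_surjective
    C.mulVecLin.range_rangeRestrict
  obtain ⟨g, hg⟩ := s.exists_extend
  refine ⟨LinearMap.toMatrix' g, ext_of_mulVec_single fun i => ?_⟩
  rw [← mulVec_mulVec, ← mulVec_mulVec, LinearMap.toMatrix'_mulVec]
  have h1 : g (C *ᵥ Pi.single i 1) = s (C.mulVecLin.rangeRestrict (Pi.single i 1)) := by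
    rw [← hg]; rfl
  have h2 := congrArg Subtype.val
    (LinearMap.congr_fun hs (C.mulVecLin.rangeRestrict (Pi.single i 1)))
  rw [h1]
  exact h2

namespace Stabilizes

variable {C D : Matrix (Fin n) (Fin n) (ZMod 2)} {p s : Fin n → ZMod 2} {ψ : Vec n}

theorem norm_add_row (h : Stabilizes C D p s ψ) (x : Fin n → ZMod 2) (j : Fin n) :
    ‖ψ (x + C j)‖ = ‖ψ x‖ := by
  rw [← h.fix j x]
  simp [norm_sgn]

theorem norm_add_vecMul (h : Stabilizes C D p s ψ) (x l : Fin n → ZMod 2) :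
    ‖ψ (x + l ᵥ* C)‖ = ‖ψ x‖ := by
  rw [vecMul_eq_sum]
  induction (Finset.univ : Finset (Fin n)) using Finset.induction_on generalizing x with
  | empty => simp
  | insert a t ha ih =>
    rw [Finset.sum_insert ha, ← add_assoc, ih]
    rcases zmod_two_cases (l a) with h0 | h0
    · simp [h0]
    · simp [h0, h.norm_add_row]

/-- Two Pauli operators commute up to a sign, and the sign must be 1 if they fix a common nonzero
vector. -/
theorem comm (h : Stabilizes C D p s ψ) : D * Cᵀ = C * Dᵀ := by
  obtain ⟨x, hx⟩ := Function.ne_iff.1 h.ne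
  ext i j
  have e1 := h.fix i x
  rw [← h.fix j (x + C i)] at e1
  have e2 := h.fix j x
  rw [← h.fix i (x + C j), add_right_comm, ← e1] at e2
  have h0 : ψ (x + C i + C j) ≠ 0 := by
    rw [← norm_ne_zero_iff, h.norm_add_row, h.norm_add_row, norm_ne_zero_iff]; exact hx
  have hI : ∀ k : Fin n, Complex.I ^ (p k).val ≠ 0 := fun k => pow_ne_zero _ Complex.I_ne_zero
  have e3 : sgn (D j ⬝ᵥ (x + C j)) * sgn (D i ⬝ᵥ (x + C i + C j)) =
      sgn (D i ⬝ᵥ (x + C i)) * sgn (D j ⬝ᵥ (x + C i + C j)) := by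
    refine mul_right_cancel₀ (mul_ne_zero (mul_ne_zero (mul_ne_zero (hI i) (sgn_ne_zero (s i)))
      (mul_ne_zero (hI j) (sgn_ne_zero (s j)))) h0) ?_
    linear_combination e2
  rw [← sgn_add, ← sgn_add] at e3
  have e4 := sgn_inj e3
  simp only [dotProduct_add] at e4
  have e5 : D i ⬝ᵥ C j = D j ⬝ᵥ C i := by linear_combination e4
  rw [mul_apply', mul_apply']
  exact e5.trans (dotProduct_comm _ _)

/-- The generators span a maximal isotropic subspace. -/
theorem exists_vecMul (h : Stabilizes C D p s ψ) {d z : Fin n → ZMod 2} (hd : D *ᵥ d = C *ᵥ z) :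
    ∃ l, d = l ᵥ* C := by
  set H : Matrix (Fin n) (Fin n ⊕ Fin n) (ZMod 2) := fromCols D C
  set K : Matrix (Fin n) (Fin n ⊕ Fin n) (ZMod 2) := fromCols C D
  have hK : Function.Injective K.vecMulLinear := by
    rw [← LinearMap.ker_eq_bot, LinearMap.ker_eq_bot']
    intro l hl
    rw [vecMulLinear_apply, vecMul_fromCols] at hl
    exact h.indep l (funext fun i => congrFun hl (.inl i)) (funext fun i => congrFun hl (.inr i))
  have hH : H.rank = n := by
    rw [LinearIndependent.rank_matrix, Fintype.card_fin]
    rw [← vecMul_injective_iff]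
    refine (injective_iff_map_eq_zero H.vecMulLinear).2 fun l hl => ?_
    rw [vecMulLinear_apply, vecMul_fromCols] at hl
    exact h.indep l (funext fun i => congrFun hl (.inr i)) (funext fun i => congrFun hl (.inl i))
  have hle : LinearMap.range K.vecMulLinear ≤ LinearMap.ker H.mulVecLin := by
    rintro _ ⟨l, rfl⟩
    rw [LinearMap.mem_ker, mulVecLin_apply, vecMulLinear_apply, vecMul_fromCols, fromCols_mulVec,
      Sum.elim_comp_inl, Sum.elim_comp_inr, ← mulVec_transpose, ← mulVec_transpose, mulVec_mulVec,
      mulVec_mulVec, h.comm, vec_add_self]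
  -- The combinations of the rows of `(C | D)` form a space of dimension `n` by independence. The
  -- kernel of `(D | C)` has dimension `2 n - n`, and it contains that space by commutation, so the
  -- two are equal.
  have heq : LinearMap.range K.vecMulLinear = LinearMap.ker H.mulVecLin := by
    refine Submodule.eq_of_le_of_finrank_eq hle ?_
    have h1 := H.mulVecLin.finrank_range_add_finrank_ker
    rw [← Matrix.rank, hH] at h1
    rw [LinearMap.finrank_range_of_inj hK]
    simp at h1 ⊢
    omega
  have hmem : Sum.elim d z ∈ LinearMap.ker H.mulVecLin := by
    rw [LinearMap.mem_ker, mulVecLin_apply, fromCols_mulVec,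
      Sum.elim_comp_inl, Sum.elim_comp_inr, hd, vec_add_self]
  rw [← heq] at hmem
  obtain ⟨l, hl⟩ := hmem
  rw [vecMulLinear_apply, vecMul_fromCols] at hl
  exact ⟨l, funext fun i => (congrFun hl (.inl i)).symm⟩

/-- The left side is `(1 + C G) D y`. Each row of `1 + C G` annihilates `C`, so `eq_of_prod_fix`
applies to it and evaluates its product with `D y` as an entry of `offset`. The witness for the
auxiliary unknown is thus `z = G D y`. -/
theorem add_offset (h : Stabilizes C D p s ψ) (hn : n ≤ N) {G : Matrix (Fin N) (Fin N) (ZMod 2)}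
    (hG : pad N C * G * pad N C = pad N C) {y : Fin n → ZMod 2} (hy : ψ y ≠ 0) :
    pad N D *ᵥ padV N y + pad N C *ᵥ (G *ᵥ (pad N D *ᵥ padV N y)) =
      offset (pad N C) (pad N D) (padV N p) (padV N s) G := by
  funext r
  set K := 1 + pad N C * G with hK
  set k : Fin N → ZMod 2 := fun i => K r i with hk
  have hKC : K * pad N C = 0 := by
    rw [hK, add_mul, one_mul, hG, mat_add_self]
  have hf : ∀ (j : ℕ) x, Complex.I ^ (extV p j).val * sgn (extV s j) *
      (sgn (extRow D j ⬝ᵥ (x + extRow C j)) * ψ (x + extRow C j)) = ψ x := fun j x => by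
    by_cases hj : j < n
    · simpa [extV, extRow, hj] using h.fix ⟨j, hj⟩ x
    · simp [extV, extRow, hj]
  have h0 : ∑ i ∈ Finset.range N, extV k i • extRow C i = 0 := by
    rw [Finset.sum_range]
    funext v
    have := congrFun (congrFun hKC r) (Fin.castLE hn v)
    rw [mul_apply, Matrix.zero_apply] at this
    rw [Finset.sum_apply, Pi.zero_apply, ← this]
    refine Finset.sum_congr rfl fun i _ => ?_
    rw [extV_fin, Pi.smul_apply, smul_eq_mul, pad_castLE]
  have h1 := eq_of_prod_fix hf h0 hy
  rw [Finset.sum_range, Finset.sum_range] at h1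
  have h2 : (pad N D *ᵥ padV N y + pad N C *ᵥ (G *ᵥ (pad N D *ᵥ padV N y))) r =
      ∑ j : Fin N, extV k j * (extRow D j ⬝ᵥ y) := by
    have e : pad N D *ᵥ padV N y + pad N C *ᵥ (G *ᵥ (pad N D *ᵥ padV N y)) =
        K *ᵥ (pad N D *ᵥ padV N y) := by rw [hK, add_mulVec, one_mulVec, mulVec_mulVec]
    rw [e, mulVec, dotProduct]
    refine Finset.sum_congr rfl fun j _ => ?_
    rw [extV_fin, pad_mulVec_apply hn]
    congr 1
    simp only [padV_castLE, extRow, mulVec]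
    split_ifs <;> simp
  rw [h2, h1, offset, ← hK, mul_assoc, mul_apply]
  refine Finset.sum_congr rfl fun j _ => ?_
  rw [extV_fin, mul_apply]
  have h3 : ∀ j i : Fin N, (pad N D * (pad N C)ᵀ) j i = extRow D j ⬝ᵥ extRow C i := fun j i => by
    have h5 := pad_mulVec_apply hn D (fun v => pad N C i v) j
    simp only [pad_castLE] at h5
    rw [mul_apply', show (fun v => (pad N C)ᵀ v i) = fun v => pad N C i v from rfl]
    refine h5.trans ?_
    simp only [extRow, mulVec]
    split_ifs <;> simp
  have h4 : ∀ j i : Fin N, formMat (pad N C) (pad N D) (padV N p) (padV N s) j i * Kᵀ i r =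
      (if i < j then k i * (extRow D j ⬝ᵥ extRow C i + extV p j * extV p i) else 0) +
        if j = i then (extV s j + extRow D j ⬝ᵥ extRow C j) * k i else 0 := fun j i => by
    simp only [formMat, of_apply, h3, transpose_apply, hk]
    rcases lt_trichotomy i j with h' | h' | h'
    · simp [h', h'.ne', padV, extV]; ring
    · simp [h', padV, extV]
    · simp [h'.not_gt, h'.ne]
  have h6 : ∑ i ∈ Finset.range (j : ℕ), extV k i *
      (extRow D j ⬝ᵥ extRow C i + extV p j * extV p i) = ∑ i : Fin N, if i < j then
        k i * (extRow D j ⬝ᵥ extRow C i + extV p j * extV p i) else 0 := by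
    have h7 : ∑ i : Fin N, (if i < j then
        k i * (extRow D j ⬝ᵥ extRow C i + extV p j * extV p i) else 0) =
        ∑ i ∈ Finset.range N, if i < (j : ℕ) then
          extV k i * (extRow D j ⬝ᵥ extRow C i + extV p j * extV p i) else 0 := by
      rw [Finset.sum_range]
      simp only [extV_fin, Fin.lt_def]
    rw [h7, ← Finset.sum_filter]
    refine Finset.sum_congr (Finset.ext fun i => ?_) fun _ _ => rfl
    simp only [Finset.mem_range, Finset.mem_filter]
    have := j.2
    omega
  simp only [h4, Finset.sum_add_distrib, Finset.sum_ite_eq, Finset.mem_univ, if_true, ← h6]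
  change k j * _ = k j * _
  -- A quadratic form over `𝔽₂` has a linear diagonal part, since `k ^ 2 = k`.
  have h8 : k j * k j = k j := by rcases zmod_two_cases (k j) with h' | h' <;> simp [h']
  linear_combination (-(extV s j + extRow D j ⬝ᵥ extRow C j)) * h8

/-- Two solutions of the equations for the support differ by a combination of the rows. -/
theorem exists_eq_add (h : Stabilizes C D p s ψ) (hn : n ≤ N) {x y : Fin n → ZMod 2}
    {w z : Fin N → ZMod 2} (e : pad N D *ᵥ padV N x + pad N C *ᵥ w =
      pad N D *ᵥ padV N y + pad N C *ᵥ z) : ∃ l, y = x + l ᵥ* C := by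
  have e2 : D *ᵥ (x + y) = C *ᵥ fun i => (w + z) (Fin.castLE hn i) := by
    funext r
    have e3 := congrFun e (Fin.castLE hn r)
    simp only [Pi.add_apply, pad_mulVec_apply hn, padV_castLE, Fin.val_castLE, Fin.is_lt, dif_pos,
      Fin.eta] at e3
    change _ = (C *ᵥ ((fun i => w (Fin.castLE hn i)) + fun i => z (Fin.castLE hn i))) r
    rw [mulVec_add, mulVec_add, Pi.add_apply, Pi.add_apply]
    refine CharTwo.add_eq_zero.1 ?_
    rw [← CharTwo.add_eq_zero] at e3
    rw [← e3]; ring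
  obtain ⟨l, hl⟩ := h.exists_vecMul e2
  exact ⟨l, by rw [← hl, ← add_assoc, vec_add_self, zero_add]⟩

/-- For the converse, a solution is compared with one that comes from the support of `ψ ≠ 0`. They
differ by a combination of rows of `C`, along which the modulus is constant. -/
theorem support_iff (h : Stabilizes C D p s ψ) (hn : n ≤ N) {G : Matrix (Fin N) (Fin N) (ZMod 2)}
    (hG : pad N C * G * pad N C = pad N C) (y : Fin n → ZMod 2) :
    ψ y ≠ 0 ↔ ∃ z, pad N D *ᵥ padV N y + pad N C *ᵥ z =
      offset (pad N C) (pad N D) (padV N p) (padV N s) G := by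
  refine ⟨fun hy => ⟨_, h.add_offset hn hG hy⟩, fun ⟨z, hz⟩ => ?_⟩
  obtain ⟨x, hx⟩ := Function.ne_iff.1 h.ne
  have e := h.add_offset hn hG hx
  obtain ⟨l, rfl⟩ := h.exists_eq_add hn (e.trans hz.symm)
  rw [← norm_ne_zero_iff, h.norm_add_vecMul, norm_ne_zero_iff]
  exact hx

theorem norm_eq (h : Stabilizes C D p s ψ) {x y : Fin n → ZMod 2} (hx : ψ x ≠ 0) (hy : ψ y ≠ 0) :
    ‖ψ x‖ = ‖ψ y‖ := by
  obtain ⟨G, hG⟩ := exists_ginv (pad n C)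
  obtain ⟨l, rfl⟩ := h.exists_eq_add le_rfl
    ((h.add_offset le_rfl hG hx).trans (h.add_offset le_rfl hG hy).symm)
  exact (h.norm_add_vecMul x l).symm

end Stabilizes

end Qubit


namespace Qubit

open WordRAM Matrix

variable {n N : ℕ}

/-! ### Stabilizer states given by a tableau -/

theorem xz_mulVec_comm (a b c d : Fin n → ZMod 2) (φ : Vec n) :
    xz a b *ᵥ (xz c d *ᵥ φ) = sgn (b ⬝ᵥ c + d ⬝ᵥ a) • xz c d *ᵥ (xz a b *ᵥ φ) := by
  funext x
  rw [Pi.smul_apply, smul_eq_mul]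
  simp only [xz_mulVec]
  rw [add_right_comm x c a, ← mul_assoc, ← mul_assoc, ← mul_assoc, ← sgn_add, ← sgn_add, ← sgn_add]
  congr 2
  simp only [dotProduct_add]
  have h1 := CharTwo.add_self_eq_zero (b ⬝ᵥ c)
  linear_combination -h1

theorem ket_zero_apply (x : Fin n → ZMod 2) : ket 0 x = if x = 0 then 1 else 0 := by
  rw [ket, Pi.single_apply]

theorem xz_zero_mulVec_ket (b : Fin n → ZMod 2) : xz 0 b *ᵥ ket 0 = ket 0 := by
  funext x
  rw [xz_mulVec, add_zero, ket_zero_apply]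
  split_ifs with h
  · simp [h]
  · simp

theorem Tableau.rowOp_mulVec (τ : Tableau n) (r : Fin n ⊕ Fin n) (φ : Vec n) :
    τ.rowOp r *ᵥ φ = (Complex.I ^ (τ.p r).val * sgn (τ.s r)) •
      xz (fun v => τ.M r (.inl v)) (fun v => τ.M r (.inr v)) *ᵥ φ := by
  rw [Tableau.rowOp, smul_mulVec, sgn]

/-- Each `Z_j` fixes the zero ket, so its image under conjugation by `Q` fixes `ψ`. The
destabilizers witness independence. -/
theorem Tableau.Represents.stabilizes {τ : Tableau n} {ψ : Vec n} (h : τ.Represents ψ) :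
    Stabilizes (Matrix.of fun r c => τ.M (.inr r) (.inl c))
      (Matrix.of fun r c => τ.M (.inr r) (.inr c)) (fun r => τ.p (.inr r))
      (fun r => τ.s (.inr r)) ψ := by
  obtain ⟨Q, ⟨hQ, hT⟩, rfl⟩ := h
  have hQ1 : Qᴴ * Q = 1 := mem_unitaryGroup_iff'.1 hQ
  have hinj : ∀ v : Vec n, Q *ᵥ v = 0 → v = 0 := fun v hv => by
    rw [← one_mulVec v, ← hQ1, ← mulVec_mulVec, hv, mulVec_zero]
  have hket : (ket 0 : Vec n) ≠ 0 := fun h0 => by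
    have := congrFun h0 0
    rw [ket_zero_apply, if_pos rfl] at this
    exact one_ne_zero this
  have hl : ∀ j v, τ.rowOp (.inl j) *ᵥ (Q *ᵥ v) = Q *ᵥ (xz (Pi.single j 1) 0 *ᵥ v) := fun j v => by
    rw [← (hT j).1, mulVec_mulVec, mul_assoc, hQ1, mul_one, mulVec_mulVec]
  have hr : ∀ j v, τ.rowOp (.inr j) *ᵥ (Q *ᵥ v) = Q *ᵥ (xz 0 (Pi.single j 1) *ᵥ v) := fun j v => by
    rw [← (hT j).2, mulVec_mulVec, mul_assoc, hQ1, mul_one, mulVec_mulVec]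
  refine ⟨fun h0 => hket (hinj _ h0), fun j x => ?_, fun l hC hD => ?_⟩
  · have h1 := congrFun (hr j (ket 0)) x
    rw [xz_zero_mulVec_ket, τ.rowOp_mulVec, Pi.smul_apply, xz_mulVec, smul_eq_mul] at h1
    exact h1
  -- Conjugation by `Q` preserves commutation signs, so the destabilizer `k` anticommutes with the
  -- stabilizer `j` iff `j = k`. Pairing a trivial combination of the stabilizer rows with the
  -- destabilizer `k` therefore gives `l k = 0`.
  · have hcomm : ∀ k j, (fun v => τ.M (.inl k) (.inr v)) ⬝ᵥ (fun v => τ.M (.inr j) (.inl v)) +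
        (fun v => τ.M (.inr j) (.inr v)) ⬝ᵥ (fun v => τ.M (.inl k) (.inl v)) =
        (Pi.single j 1 : Fin n → ZMod 2) k := by
      intro k j
      set w := xz 0 (Pi.single j 1) *ᵥ (xz (Pi.single k 1) 0 *ᵥ (ket 0 : Vec n)) with hw
      have hw0 : w ≠ 0 := fun h0 => by
        have h1 := congrFun h0 (Pi.single k 1)
        rw [hw, xz_mulVec, xz_mulVec, add_zero, vec_add_self, ket_zero_apply, if_pos rfl,
          mul_one] at h1
        exact mul_ne_zero (sgn_ne_zero _) (sgn_ne_zero _) h1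
      have h1 : τ.rowOp (.inl k) *ᵥ (τ.rowOp (.inr j) *ᵥ (Q *ᵥ ket 0)) =
          sgn ((Pi.single j 1 : Fin n → ZMod 2) k) • Q *ᵥ w := by
        rw [hr, hl, xz_mulVec_comm, mulVec_smul, zero_dotProduct, zero_add,
          dotProduct_single_one]
      have h2 : τ.rowOp (.inl k) *ᵥ (τ.rowOp (.inr j) *ᵥ (Q *ᵥ ket 0)) =
          sgn ((fun v => τ.M (.inl k) (.inr v)) ⬝ᵥ (fun v => τ.M (.inr j) (.inl v)) +
            (fun v => τ.M (.inr j) (.inr v)) ⬝ᵥ (fun v => τ.M (.inl k) (.inl v))) • Q *ᵥ w := by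
        rw [hw, ← hr, ← hl]
        simp only [τ.rowOp_mulVec, mulVec_smul]
        rw [xz_mulVec_comm, smul_comm, smul_comm (sgn _)]
        congr 1
        rw [smul_comm]
      refine sgn_inj (smul_left_injective ℂ (fun h0 => hw0 (hinj w h0)) (h2.symm.trans h1))
    funext k
    have h1 : ∑ j, l j * (Pi.single j 1 : Fin n → ZMod 2) k = l k := by
      simp [Pi.single_apply]
    rw [← h1, Pi.zero_apply]
    simp only [← hcomm, mul_add, Finset.sum_add_distrib, dotProduct, Finset.mul_sum]
    rw [Finset.sum_comm, Finset.sum_comm (f := fun j v => l j * (τ.M (.inr j) (.inr v) * _))]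
    have hC' := fun v => congrFun hC v
    have hD' := fun v => congrFun hD v
    simp only [vecMul, dotProduct, of_apply, Pi.zero_apply] at hC' hD'
    have e1 : ∀ v, ∑ j, l j * (τ.M (.inl k) (.inr v) * τ.M (.inr j) (.inl v)) = 0 := fun v => by
      rw [← mul_zero (τ.M (.inl k) (.inr v)), ← hC' v, Finset.mul_sum]
      exact Finset.sum_congr rfl fun _ _ => by ring
    have e2 : ∀ v, ∑ j, l j * (τ.M (.inr j) (.inr v) * τ.M (.inl k) (.inl v)) = 0 := fun v => by
      rw [← zero_mul (τ.M (.inl k) (.inl v)), ← hD' v, Finset.sum_mul]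
      exact Finset.sum_congr rfl fun _ _ => by ring
    simp [e1, e2]

end Qubit


namespace Qubit

open WordRAM Matrix

variable {n N : ℕ}

/-! ### Graph states -/

theorem tensor_mul (U V : Fin n → Op1) : tensor U * tensor V = tensor fun v => U v * V v := by
  ext x y
  simp only [mul_apply, tensor, ← Finset.prod_mul_distrib]
  rw [Finset.prod_univ_sum, Fintype.piFinset_univ]

theorem tensor_smul (c : Fin n → ℂ) (U : Fin n → Op1) :
    (tensor fun v => c v • U v) = (∏ v, c v) • tensor U := by
  ext x y
  simp [tensor, Finset.prod_mul_distrib]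

theorem tensor_one : (tensor fun _ => 1 : Op n) = 1 := by
  ext x y
  simp only [tensor]
  by_cases h : x = y
  · subst h; simp
  · obtain ⟨v, hv⟩ := Function.ne_iff.1 h
    rw [one_apply_ne h]
    exact Finset.prod_eq_zero (Finset.mem_univ v) (one_apply_ne hv)

theorem sum_zmod_two (f : ZMod 2 → ℂ) : ∑ x, f x = f 0 + f 1 := Fin.sum_univ_two f

theorem op1_ext {A B : Op1} (h00 : A 0 0 = B 0 0) (h01 : A 0 1 = B 0 1) (h10 : A 1 0 = B 1 0)
    (h11 : A 1 1 = B 1 1) : A = B := by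
  ext x y
  rcases zmod_two_cases x with rfl | rfl <;> rcases zmod_two_cases y with rfl | rfl <;> assumption

theorem op1_mul_apply (A B : Op1) (x y : ZMod 2) : (A * B) x y = A x 0 * B 0 y + A x 1 * B 1 y := by
  rw [mul_apply, sum_zmod_two]

/-- A unitary that maps a Pauli basis to the computational basis. -/
noncomputable def Basis.change : Basis → Op1
  | .X => hadamard
  | .Y => of fun x y => (-1 : ℂ) ^ (x * y).val * (-Complex.I) ^ y.val / (Real.sqrt 2 : ℂ)
  | .Z => 1

theorem sqrt_two_mul_self : (Real.sqrt 2 : ℂ) * (Real.sqrt 2 : ℂ) = 2 := by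
  rw [← Complex.ofReal_mul, Real.mul_self_sqrt (by norm_num)]; norm_num

theorem sqrt_two_ne_zero : (Real.sqrt 2 : ℂ) ≠ 0 := fun h => by
  have := sqrt_two_mul_self
  rw [h] at this; norm_num at this

theorem Basis.change_conjTranspose_mul (b : Basis) : b.change.conjTranspose * b.change = 1 := by
  have h2 := sqrt_two_mul_self
  have h0 := sqrt_two_ne_zero
  cases b <;> refine op1_ext ?_ ?_ ?_ ?_ <;>
    simp [op1_mul_apply, Basis.change, hadamard, ZMod.val_one, conjTranspose_apply] <;>
    field_simp <;> simp [pow_two, h2] <;> norm_num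

theorem one_add_one : (1 : ZMod 2) + 1 = 0 := by decide

theorem Basis.change_mul_x (b : Basis) : b.change * xz1 1 0 =
    Complex.I ^ (if b.code = 1 then 1 else 0 : ZMod 2).val •
      (xz1 (if b.code = 0 then 0 else 1) (if b.code = 2 then 0 else 1) * b.change) := by
  cases b <;> refine op1_ext ?_ ?_ ?_ ?_ <;>
    simp [op1_mul_apply, Basis.change, hadamard, ZMod.val_one, xz1, Basis.code, one_add_one] <;>
    ring_nf <;> simp

theorem Basis.change_mul_z (b : Basis) (a : ZMod 2) : b.change * xz1 0 a =
    xz1 (if b.code = 2 then 0 else a) (if b.code = 2 then a else 0) * b.change := by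
  rcases zmod_two_cases a with rfl | rfl <;> cases b <;> refine op1_ext ?_ ?_ ?_ ?_ <;>
    simp [op1_mul_apply, Basis.change, hadamard, ZMod.val_one, xz1, Basis.code, one_add_one] <;>
    ring_nf

theorem Basis.change_mul_pauli (b : Basis) : b.change * b.pauli = Basis.Z.pauli * b.change := by
  cases b <;> refine op1_ext ?_ ?_ ?_ ?_ <;>
    simp [op1_mul_apply, Basis.change, hadamard, ZMod.val_one, xz1, Basis.pauli, one_add_one] <;>
    ring_nf <;> simp

/-- The quadratic form of a graph. -/
def quadForm (A : Matrix (Fin n) (Fin n) (ZMod 2)) (y : Fin n → ZMod 2) : ZMod 2 :=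
  ∑ i, ∑ j, if i < j then A i j * (y i * y j) else 0

/-- Polarization of the quadratic form: flipping `y v` changes it by the sum over the neighbours of
`v`. This is what makes `X_v` times `Z` on the neighbours of `v` a stabilizer. -/
theorem quadForm_add_single {A : Matrix (Fin n) (Fin n) (ZMod 2)} (hA : A.IsSymm)
    (hd : ∀ i, A i i = 0) (y : Fin n → ZMod 2) (v : Fin n) :
    quadForm A (y + Pi.single v 1) = quadForm A y + A v ⬝ᵥ y := by
  have h1 : ∀ i j, (if i < j then A i j * ((y + Pi.single v 1 : Fin n → ZMod 2) i *
      (y + Pi.single v 1 : Fin n → ZMod 2) j) else 0) =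
      (if i < j then A i j * (y i * y j) else 0) +
      ((if i < j then if v = i then A i j * y j else 0 else 0) +
        if i < j then if v = j then A i j * y i else 0 else 0) := by
    intro i j
    simp only [Pi.add_apply, Pi.single_apply, eq_comm (a := v)]
    split_ifs with h h2 h3 h3
    · subst h2; exact absurd h3 h.ne'
    all_goals ring
  have h2 : ∑ i, ∑ j, (if i < j then if v = i then A i j * y j else 0 else 0) =
      ∑ j, if v < j then A v j * y j else 0 := by
    rw [Finset.sum_comm]
    refine Finset.sum_congr rfl fun j _ => ?_
    rw [Finset.sum_eq_single v (by intro i _ hi; simp [hi.symm]) (by simp)]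
    simp
  have h3 : ∑ i, ∑ j, (if i < j then if v = j then A i j * y i else 0 else 0) =
      ∑ j, if j < v then A v j * y j else 0 := by
    refine Finset.sum_congr rfl fun j _ => ?_
    rw [Finset.sum_eq_single v (by intro i _ hi; simp [hi.symm]) (by simp)]
    simp [hA.apply v j]
  unfold quadForm
  simp only [h1, Finset.sum_add_distrib]
  rw [h2, h3, ← Finset.sum_add_distrib, dotProduct]
  congr 1
  refine Finset.sum_congr rfl fun j _ => ?_
  rcases lt_trichotomy v j with h | h | h
  · simp [h, h.not_gt]
  · subst h; simp [hd]
  · simp [h, h.not_gt]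

open Classical in
theorem graphState_apply (G : SimpleGraph (Fin n)) (y : Fin n → ZMod 2) :
    graphState G y = sgn (quadForm (G.adjMatrix (ZMod 2)) y) * (1 / (Real.sqrt 2 : ℂ)) ^ n := by
  rw [graphState, mulVec_diagonal]
  congr 1
  · rw [quadForm, ← Finset.sum_product', sgn_sum, Finset.prod_filter]
    refine Finset.prod_congr rfl fun e _ => ?_
    by_cases h1 : e.1 < e.2 <;> by_cases h2 : G.Adj e.1 e.2 <;> simp [h1, h2, sgn]
  · rw [ket, mulVec_single_one]
    simp [tensor, hadamard]

open Classical in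
theorem xz_mulVec_graphState (G : SimpleGraph (Fin n)) (v : Fin n) :
    xz (Pi.single v 1) (G.adjMatrix (ZMod 2) v) *ᵥ graphState G = graphState G := by
  funext x
  rw [xz_mulVec, graphState_apply, graphState_apply,
    quadForm_add_single (G.isSymm_adjMatrix) (fun i => by simp), ← mul_assoc, ← sgn_add]
  congr 2
  rw [dotProduct_add]
  have h := CharTwo.add_self_eq_zero (G.adjMatrix (ZMod 2) v ⬝ᵥ x)
  have h2 : G.adjMatrix (ZMod 2) v ⬝ᵥ Pi.single v 1 = 0 := by simp
  linear_combination h + h2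

open Classical in
theorem stabilizes_graphState (G : SimpleGraph (Fin n)) (B : Fin n → Basis) :
    Stabilizes (StabSim.graphC (G.adjMatrix (ZMod 2)) B) (StabSim.graphD (G.adjMatrix (ZMod 2)) B)
      (StabSim.graphP B) 0 ((tensor fun v => (B v).change) *ᵥ graphState G) := by
  set A := G.adjMatrix (ZMod 2) with hA
  refine ⟨fun h0 => ?_, fun v x => ?_, fun l hC hD => ?_⟩
  · have h1 : graphState G = 0 := by
      rw [← one_mulVec (graphState G), ← tensor_one]
      have : (fun _ => 1 : Fin n → Op1) = fun v => (B v).change.conjTranspose * (B v).change :=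
        funext fun v => (Basis.change_conjTranspose_mul _).symm
      rw [this, ← tensor_mul, ← mulVec_mulVec, h0, mulVec_zero]
    have h2 := congrFun h1 0
    rw [graphState_apply] at h2
    exact mul_ne_zero (sgn_ne_zero _) (pow_ne_zero _ (one_div_ne_zero sqrt_two_ne_zero)) h2
  · have h1 : tensor (fun v => (B v).change) * xz (Pi.single v 1) (A v) =
        Complex.I ^ (StabSim.graphP B v).val •
          (xz (StabSim.graphC A B v) (StabSim.graphD A B v) * tensor fun v => (B v).change) := by
      have h2 : Complex.I ^ (StabSim.graphP B v).val =
          ∏ u, if u = v then Complex.I ^ (StabSim.graphP B v).val else 1 := by simp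
      rw [xz, xz, tensor_mul, tensor_mul, h2, ← tensor_smul]
      congr 1
      funext u
      by_cases hu : u = v
      · subst hu
        simp [StabSim.graphC, StabSim.graphD, StabSim.graphP, hA, Basis.change_mul_x]
      · simp [StabSim.graphC, StabSim.graphD, hu, Ne.symm hu, Basis.change_mul_z]
    have h3 := congrFun (congrArg (fun M => M *ᵥ graphState G) h1) x
    simp only [smul_mulVec, ← mulVec_mulVec, xz_mulVec_graphState, hA] at h3
    rw [← hA, Pi.smul_apply, smul_eq_mul, xz_mulVec] at h3
    rw [h3]; simp
  -- For every `u`, column `u` of `C` (basis `Z`) or of `D` (basis `X` or `Y`) is the unit vector at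
  -- `u`, which isolates `l u`.
  · funext u
    by_cases hu : (B u).code = 2
    · have := congrFun hC u
      simpa [vecMul, dotProduct, StabSim.graphC, hu, Finset.sum_ite_eq] using this
    · have := congrFun hD u
      simpa [vecMul, dotProduct, StabSim.graphD, hu, Finset.sum_ite_eq] using this

theorem norm_tensor_diagonal {V : Fin n → Op1} (hV : ∀ v x y, x ≠ y → V v x y = 0)
    (h1 : ∀ v x, ‖V v x x‖ = 1) (φ : Vec n) (x : Fin n → ZMod 2) : ‖(tensor V *ᵥ φ) x‖ = ‖φ x‖ := by
  rw [mulVec, dotProduct, Finset.sum_eq_single x]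
  · simp [tensor, norm_prod, h1]
  · intro y _ hy
    obtain ⟨v, hv⟩ := Function.ne_iff.1 hy
    rw [tensor, Finset.prod_eq_zero (Finset.mem_univ v) (hV v _ _ hv.symm), zero_mul]
  · simp

/-- The amplitudes do not depend on the choice of the basis change, up to phases. -/
theorem norm_basisChange {B : Fin n → Basis} {U : Fin n → Op1} (hU : StabSim.IsBasisChange B U)
    (φ : Vec n) (x : Fin n → ZMod 2) :
    ‖(tensor U *ᵥ φ) x‖ = ‖((tensor fun v => (B v).change) *ᵥ φ) x‖ := by
  set W : Fin n → Op1 := fun v => (B v).change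
  have hW : ∀ v, (W v)ᴴ * W v = 1 := fun v => Basis.change_conjTranspose_mul _
  have hW' : ∀ v, W v * (W v)ᴴ = 1 := fun v => mul_eq_one_comm.1 (hW v)
  have hUV : tensor U = (tensor fun v => U v * (W v)ᴴ) * tensor W := by
    rw [tensor_mul]
    congr 1; funext v
    rw [mul_assoc, hW, mul_one]
  rw [hUV, ← mulVec_mulVec]
  -- The quotient of two basis changes commutes with `Z`. Hence it is diagonal, and being unitary it
  -- only multiplies amplitudes by phases.
  have hZ : ∀ v, (U v * (W v)ᴴ) * Basis.Z.pauli = Basis.Z.pauli * (U v * (W v)ᴴ) := fun v => by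
    have h1 : (W v)ᴴ * Basis.Z.pauli = (B v).pauli * (W v)ᴴ := by
      calc (W v)ᴴ * Basis.Z.pauli = (W v)ᴴ * (Basis.Z.pauli * W v) * (W v)ᴴ := by
            rw [mul_assoc, mul_assoc, hW', mul_one]
        _ = _ := by rw [← Basis.change_mul_pauli, ← mul_assoc, hW, one_mul]
    have h2 : U v * (B v).pauli = Basis.Z.pauli * U v := by
      rw [← (hU v).2, mul_assoc _ _ (U v),
        show (U v)ᴴ * U v = 1 from mem_unitaryGroup_iff'.1 (hU v).1, mul_one]
    rw [mul_assoc, h1, ← mul_assoc, h2, mul_assoc]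
  have hV : ∀ v x y, x ≠ y → (U v * (W v)ᴴ) x y = 0 := by
    intro v x y hxy
    have h := congrFun (congrFun (hZ v) x) y
    generalize U v * (W v)ᴴ = V at h ⊢
    rw [op1_mul_apply, op1_mul_apply] at h
    rcases zmod_two_cases x with rfl | rfl <;> rcases zmod_two_cases y with rfl | rfl <;>
      simp [Basis.pauli, xz1, ZMod.val_one] at h hxy ⊢
    · linear_combination -(1 / 2) * h
    · linear_combination (1 / 2) * h
  refine norm_tensor_diagonal hV (fun v x => ?_) _ _
  have h1 : (U v * (W v)ᴴ)ᴴ * (U v * (W v)ᴴ) = 1 := by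
    rw [conjTranspose_mul, conjTranspose_conjTranspose, mul_assoc, ← mul_assoc (U v)ᴴ,
      show (U v)ᴴ * U v = 1 from mem_unitaryGroup_iff'.1 (hU v).1, one_mul, hW']
  have h2 := congrFun (congrFun h1 x) x
  rw [mul_apply, Finset.sum_eq_single x (fun y _ hy => by rw [hV v y x hy, mul_zero]) (by simp),
    conjTranspose_apply, one_apply_eq, Complex.star_def, Complex.conj_mul'] at h2
  have h3 : ‖(U v * (W v)ᴴ) x x‖ ^ 2 = 1 := by exact_mod_cast h2
  exact (pow_eq_one_iff_of_nonneg (norm_nonneg _) two_ne_zero).1 h3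

end Qubit


namespace StabSim

open WordRAM Qubit Matrix

variable {n N : ℕ} {C D : Matrix (Fin n) (Fin n) (ZMod 2)} {p s : Fin n → ZMod 2}
  {P : Finset (Fin n)}

/-! ### The solutions of the linear system -/

/-- The auxiliary unknowns. -/
def shiftV (n : ℕ) (u : Fin N → ZMod 2) : Fin N → ZMod 2 :=
  fun i => if h : n + i < N then u ⟨n + i, h⟩ else 0

theorem solMat_mulVec (hN : 2 * n ≤ N) (post : Fin n → ℕ) (u : Fin N → ZMod 2) :
    solMat N C D post *ᵥ u = pad N D *ᵥ padV N (fun v => if post v = 2 then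
      u (Fin.castLE (by omega) v) else 0) + pad N C *ᵥ shiftV n u := by
  obtain ⟨l, rfl⟩ : ∃ l, N = n + (n + l) := ⟨N - 2 * n, by omega⟩
  funext r
  simp only [Pi.add_apply, mulVec, dotProduct]
  rw [Fin.sum_univ_add, Fin.sum_univ_add (f := fun i => pad _ D r i * _)]
  rw [Fin.sum_univ_add (f := fun i => pad _ C r i * _), Fin.sum_univ_add]
  have h1 : ∀ (M : Matrix (Fin n) (Fin n) (ZMod 2)) i, pad (n + (n + l)) M r (Fin.natAdd n i) = 0 :=
    fun M i => by simp [pad]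
  have h2 : ∀ i : Fin l, solMat (n + (n + l)) C D post r (Fin.natAdd n (Fin.natAdd n i)) = 0 :=
    fun i => by simp [solMat, pad]
  simp only [h1, h2, zero_mul, Finset.sum_const_zero, add_zero]
  congr 1
  · refine Finset.sum_congr rfl fun i _ => ?_
    have h3 : (Fin.castLE (by omega) i : Fin (n + (n + l))) = Fin.castAdd (n + l) i := rfl
    simp only [solMat, of_apply, Fin.val_castAdd, Fin.is_lt, dif_pos, padV, h3, Fin.eta]
    split_ifs <;> simp
  · refine Finset.sum_congr rfl fun i _ => ?_
    have h3 : (i : ℕ) < n + l := by omega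
    simp only [solMat, of_apply, Fin.val_natAdd, Fin.val_castAdd]
    simp only [shiftV, Fin.val_castAdd, add_lt_add_iff_left, h3, dif_pos, add_tsub_cancel_left]
    rw [dif_neg (by omega)]
    rfl

theorem join_eq (m : {v // v ∈ P} → ZMod 2) (x : Fin n → ZMod 2) :
    (join m fun v => x v.1) = (fun v => if postF m v = 2 then x v else 0) +
      fun v => if postF m v = 1 then 1 else 0 := by
  funext v
  by_cases h : v ∈ P
  · rcases zmod_two_cases (m ⟨v, h⟩) with h1 | h1 <;>
      simp [Qubit.join, postF, h, h1, ZMod.val_one]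
  · simp [Qubit.join, postF, h]

theorem padV_add (v w : Fin n → ZMod 2) : padV N (v + w) = padV N v + padV N w := by
  funext i
  simp only [padV, Pi.add_apply]
  split_ifs <;> simp

variable {m : {v // v ∈ P} → ZMod 2} {ψ : Vec n} {G : Matrix (Fin N) (Fin N) (ZMod 2)}

/-- In characteristic two the contribution of the postselected bits can be moved to the other side,
which turns the system into the equations for the support at the joined string. -/
theorem ne_zero_of_solution (h : Stabilizes C D p s ψ) (hN : 2 * n ≤ N)
    (hG : pad N C * G * pad N C = pad N C) {u : Fin N → ZMod 2}
    (hu : solMat N C D (postF m) *ᵥ u = solRhs N C D p s (postF m) G) :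
    ψ (join m fun v => u (Fin.castLE (by omega) v.1)) ≠ 0 := by
  rw [h.support_iff (by omega) hG]
  refine ⟨shiftV n u, ?_⟩
  rw [solMat_mulVec hN, solRhs] at hu
  rw [join_eq m fun v => u (Fin.castLE (by omega) v), padV_add, mulVec_add, add_right_comm, hu,
    add_assoc, vec_add_self, add_zero]

theorem exists_solution (h : Stabilizes C D p s ψ) (hN : 2 * n ≤ N)
    (hG : pad N C * G * pad N C = pad N C) {x : {v // v ∉ P} → ZMod 2} (hx : ψ (join m x) ≠ 0) :
    ∃ u : Fin N → ZMod 2, solMat N C D (postF m) *ᵥ u = solRhs N C D p s (postF m) G ∧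
      ∀ v, u (Fin.castLE (by omega) v.1) = x v := by
  obtain ⟨z, hz⟩ := (h.support_iff (by omega) hG _).1 hx
  have hj : (fun v : {v // v ∉ P} => Qubit.join m x v) = x :=
    funext fun v => by simp [Qubit.join, v.2]
  refine ⟨fun i => if h : (i : ℕ) < n then Qubit.join m x ⟨i, h⟩ else z ⟨i - n, by omega⟩, ?_,
    fun v => by simpa using congrFun hj v⟩
  have h1 := join_eq m (Qubit.join m x)
  rw [hj] at h1
  rw [h1] at hz
  rw [solMat_mulVec hN, solRhs, ← hz, padV_add, mulVec_add, add_right_comm, add_assoc _ _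
    (pad N D *ᵥ _), vec_add_self, add_zero]
  congr 1
  · simp
  -- Only the first `n` auxiliary unknowns matter, and `2 n ≤ N` leaves room for them behind the
  -- outcomes.
  · refine pad_mulVec_congr _ fun i hi => ?_
    simp [shiftV, show n + (i : ℕ) < N by omega]

/-- Two functions that are constant on a set, vanish outside it and have the same sum agree. This
replaces counting the support. -/
theorem eq_of_constant_on {ι : Type*} [Fintype ι] {S : ι → Prop} {f g : ι → ℝ}
    (hf : ∀ i, ¬ S i → f i = 0) (hg : ∀ i, ¬ S i → g i = 0)
    (hf' : ∀ i j, S i → S j → f i = f j) (hg' : ∀ i j, S i → S j → g i = g j)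
    (h : ∑ i, f i = ∑ i, g i) : f = g := by
  classical
  funext i
  by_cases hi : S i
  · have h1 : ∀ j, f j = if S j then f i else 0 := fun j => by
      split_ifs with hj
      exacts [hf' j i hj hi, hf j hj]
    have h2 : ∀ j, g j = if S j then g i else 0 := fun j => by
      split_ifs with hj
      exacts [hg' j i hj hi, hg j hj]
    rw [Finset.sum_congr rfl fun j _ => h1 j, Finset.sum_congr rfl fun j _ => h2 j,
      ← Finset.sum_filter, ← Finset.sum_filter, Finset.sum_const, Finset.sum_const,
      nsmul_eq_mul, nsmul_eq_mul] at h
    refine mul_left_cancel₀ ?_ h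
    rw [Nat.cast_ne_zero, Finset.card_ne_zero]
    exact ⟨i, by simpa using hi⟩
  · rw [hf i hi, hg i hi]

theorem sum_condProb {φ : Vec n} (h : margProb φ m ≠ 0) : ∑ x, condProb φ m x = 1 := by
  simp only [condProb]
  rw [← Finset.sum_div, ← margProb, div_self h]

theorem margProb_eq_zero_iff {φ : Vec n} : margProb φ m = 0 ↔ ∀ x, φ (join m x) = 0 := by
  rw [margProb, Finset.sum_eq_zero_iff_of_nonneg fun _ _ => by positivity]
  simp

/-- Flip the coins at the positions where `k` is one. -/
def flip {T : ℕ} (k : Fin N → ZMod 2) (r : Fin T → Bool) : Fin T → Bool :=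
  fun i => if h : (i : ℕ) < N then xor (r i) (k ⟨i, h⟩ == 1) else r i

theorem flip_flip {T : ℕ} (k : Fin N → ZMod 2) (r : Fin T → Bool) : flip k (flip k r) = r := by
  funext i
  simp only [flip]
  split_ifs <;> simp

/-- Flipping coins is translation of the random vector. The tape must be long enough to contain all
`N` coins. -/
theorem tape_flip {T : ℕ} (hT : N ≤ T) (k : Fin N → ZMod 2) (r : Fin T → Bool) (i : Fin N) :
    (if tape (flip k r) i then 1 else 0 : ZMod 2) = (if tape r i then 1 else 0) + k i := by
  have := i.2.trans_le hT
  simp only [tape, this, dif_pos, flip, Fin.is_lt, Fin.eta]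
  rcases zmod_two_cases (k i) with h | h <;> cases r ⟨i, this⟩ <;> simp [h, Qubit.one_add_one]

end StabSim


namespace StabSim

open WordRAM Qubit Matrix

variable {n : ℕ} {C D : Matrix (Fin n) (Fin n) (ZMod 2)} {p s : Fin n → ZMod 2}
  {P : Finset (Fin n)} {m : {v // v ∈ P} → ZMod 2}

/-! ### Correctness of the sampling algorithm -/

theorem margProb_congr {φ χ : Vec n} (h : ∀ y, ‖φ y‖ = ‖χ y‖) : margProb φ m = margProb χ m := by
  simp only [margProb, h]

theorem condProb_congr {φ χ : Vec n} (h : ∀ y, ‖φ y‖ = ‖χ y‖) (x : {v // v ∉ P} → ZMod 2) :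
    condProb φ m x = condProb χ m x := by
  simp only [condProb, h, margProb_congr h]

theorem condProb_eq_of_stabilizes {ψ : Vec n} (h : Stabilizes C D p s ψ)
    {x y : {v // v ∉ P} → ZMod 2} (hx : ψ (Qubit.join m x) ≠ 0) (hy : ψ (Qubit.join m y) ≠ 0) :
    condProb ψ m x = condProb ψ m y := by
  rw [condProb, condProb, h.norm_eq hx hy]

/-- If all fibers over the support have the same size, the samples have the right distribution. -/
theorem card_fiber_eq_condProb {ψ : Vec n} (h : Stabilizes C D p s ψ) (hm : margProb ψ m ≠ 0)
    {T : ℕ} {X : (Fin T → Bool) → {v // v ∉ P} → ZMod 2} (hX : ∀ r, ψ (Qubit.join m (X r)) ≠ 0)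
    (hflip : ∀ x y, ψ (Qubit.join m x) ≠ 0 → ψ (Qubit.join m y) ≠ 0 →
      Nat.card {r // X r = x} = Nat.card {r // X r = y}) (x : {v // v ∉ P} → ZMod 2) :
    (Nat.card {r // X r = x} : ℝ) / 2 ^ T = condProb ψ m x := by
  refine congrFun (eq_of_constant_on (S := fun x => ψ (Qubit.join m x) ≠ 0)
    (f := fun x => (Nat.card {r // X r = x} : ℝ) / 2 ^ T) (g := condProb ψ m)
    (fun x hx => ?_) (fun x hx => ?_) (fun x y hx hy => ?_)
    (fun x y hx hy => condProb_eq_of_stabilizes h hx hy) ?_) x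
  · have : IsEmpty {r // X r = x} := ⟨fun r => hx (r.2 ▸ hX r.1)⟩
    simp
  · rw [not_not] at hx
    simp [condProb, hx]
  · simp only [hflip x y hx hy]
  · rw [sum_condProb hm, ← Finset.sum_div, ← Nat.cast_sum]
    have h1 : ∑ x, Nat.card {r // X r = x} = 2 ^ T := by
      classical
      rw [← Nat.card_sigma, Nat.card_congr (Equiv.sigmaFiberEquiv X)]
      simp
    rw [h1]
    push_cast
    exact div_self (by positivity)

/-- Translating the coins by a kernel vector of `A` is a bijection of coin sequences that translates
the solution by the same vector. The difference of two solutions with prescribed outcomes is such a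
vector, so all fibers over the support have the same size. Since only moduli enter, the state may be
replaced by any vector with the same moduli. -/
theorem samplesPostselected_sampleC {c load : Cmd} {κ : ℕ} {T : ℕ → ℕ} (hc : MatMulBy c κ T)
    {input : List ℕ} (hl : Loads load input C D p s (postF m)) (E : Env)
    (hL : E.L = 8 * ((n + 1) * (n + 1))) (hB : (2 ^ lg n + 2) ^ (κ + 1) ≤ E.B)
    (hT : sampleTime c T n ≤ E.B) (hn : input.getD 0 0 = n)
    (hlen : input.length ≤ 8 * ((n + 1) * (n + 1))) (hb : ∀ i, input.getD i 0 ≤ E.B) {ψ φ : Vec n}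
    (hψ : Stabilizes C D p s ψ) (hφ : ∀ y, ‖φ y‖ = ‖ψ y‖) :
    SamplesPostselected (sampleC c load) E.W (sampleTime c T n) input φ P m := by
  obtain ⟨G, G', hG, hG', hrun⟩ := runs_sampleC hc hl E hL hB hT hn hlen hb
  have hN : 2 * n ≤ 2 ^ lg n := (lg_bounds n).1
  have hNT : 2 ^ lg n ≤ sampleTime c T n := by
    have h1 : 2 ^ lg n ≤ 2 ^ lg n * 2 ^ lg n := Nat.le_mul_self _
    have h2 : 1 ≤ 400 * cst := by unfold cst; norm_num
    have h3 : 2 ^ lg n * 2 ^ lg n + 1 ≤ 400 * cst * (2 ^ lg n * 2 ^ lg n + 1) :=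
      Nat.le_mul_of_pos_left _ h2
    unfold sampleTime; omega
  generalize hNdef : 2 ^ lg n = N at *
  set A := solMat N C D (postF m) with hA
  set b := solRhs N C D p s (postF m) G with hbdef
  choose t ht out hout h0 h1 using fun r : Fin (sampleTime c T n) → Bool => hrun (tape r)
  -- If there is any solution, then `G' b` is one, because `A G' A = A`.
  have hfeas : ∀ u, A *ᵥ u = b → A *ᵥ (G' *ᵥ b) = b := fun u hu => by
    rw [← hu, mulVec_mulVec, mulVec_mulVec, hG']
  simp only [SamplesPostselected, margProb_congr hφ, condProb_congr hφ]
  refine ⟨out, fun r => ⟨t r, ht r, hout r⟩, fun hm r => ?_, fun hm => ?_⟩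
  · rw [h0, if_neg]
    intro hu
    exact ne_zero_of_solution hψ hN hG hu (margProb_eq_zero_iff.1 hm _)
  · obtain ⟨x₀, hx₀⟩ := not_forall.1 (mt margProb_eq_zero_iff.2 hm)
    obtain ⟨u₀, hu₀, -⟩ := exists_solution hψ hN hG hx₀
    have hf := hfeas u₀ hu₀
    refine ⟨fun r => by rw [h0, if_pos hf], fun x => ?_⟩
    let ρ : (Fin (sampleTime c T n) → Bool) → Fin N → ZMod 2 := fun r i => if tape r i then 1 else 0
    let u : (Fin (sampleTime c T n) → Bool) → Fin N → ZMod 2 := fun r =>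
      G' *ᵥ (b + A *ᵥ ρ r) + ρ r
    have hu : ∀ r, A *ᵥ u r = b := fun r => by
      simp only [u, mulVec_add]
      rw [hf, mulVec_mulVec, mulVec_mulVec, mul_assoc, ← mul_assoc A, hG', add_assoc,
        vec_add_self, add_zero]
    let X : (Fin (sampleTime c T n) → Bool) → {v // v ∉ P} → ZMod 2 := fun r v =>
      u r (Fin.castLE (by omega) v.1)
    have hX : ∀ r, ψ (Qubit.join m (X r)) ≠ 0 := fun r => ne_zero_of_solution hψ hN hG (hu r)
    have hmem : ∀ r, (∀ v : {v // v ∉ P}, (out r).mem (v.1 + 1) = (x v).val) ↔ X r = x := fun r => by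
      rw [funext_iff]
      refine forall_congr' fun v => ?_
      rw [h1 r v.1 (Fin.castLE (by omega) v.1) rfl]
      exact (ZMod.val_injective 2).eq_iff
    rw [Nat.card_congr (Equiv.subtypeEquivRight hmem)]
    refine card_fiber_eq_condProb hψ hm hX (fun x y hx hy => ?_) x
    obtain ⟨ux, hux, hxv⟩ := exists_solution hψ hN hG hx
    obtain ⟨uy, huy, hyv⟩ := exists_solution hψ hN hG hy
    have hk : A *ᵥ (ux + uy) = 0 := by
      rw [mulVec_add, hA, hux, huy, vec_add_self]
    -- The term `A ρ` does not see the kernel vector, so only the final summand `ρ` changes.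
    have hflip : ∀ r, u (flip (ux + uy) r) = u r + (ux + uy) := fun r => by
      have e : ρ (flip (ux + uy) r) = ρ r + (ux + uy) := funext fun i => tape_flip hNT _ r i
      simp only [u, e]
      rw [mulVec_add A, hk, add_zero, add_assoc]
    have hXf : ∀ r, X (flip (ux + uy) r) = X r + (x + y) := fun r => by
      funext v
      simp only [X, hflip, Pi.add_apply, hxv, hyv]
    refine Nat.card_congr (Equiv.subtypeEquiv
      ⟨flip (ux + uy), flip (ux + uy), flip_flip _, flip_flip _⟩ fun r => ?_)
    show X r = x ↔ X (flip (ux + uy) r) = y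
    rw [hXf]
    rw [← add_assoc, add_eq_right]
    refine ⟨fun h => h ▸ vec_add_self _, fun h => ?_⟩
    rw [← add_zero (X r), ← vec_add_self x, ← add_assoc, h, zero_add]

/-- One algorithm samples all families of postselected stabilizer states whose generators can be
computed from the input by the program `load`. -/
theorem exists_sampler {ω : ℝ} (hω : 2 ≤ ω) (hmm : MatMulInTime ω) (load : Cmd) :
    ∃ (c : Cmd) (κ : ℕ) (T : ℕ → ℕ), (fun n => (T n : ℝ)) =O[atTop] timeBound ω ∧
      ∀ (n : ℕ) (C D : Matrix (Fin n) (Fin n) (ZMod 2)) (p s : Fin n → ZMod 2) (P : Finset (Fin n))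
        (m : {v // v ∈ P} → ZMod 2) (input : List ℕ) (ψ φ : Vec n),
        Loads load input C D p s (postF m) → input.getD 0 0 = n →
        input.length ≤ 8 * ((n + 1) * (n + 1)) → (∀ i, input.getD i 0 ≤ n + 2) →
        Stabilizes C D p s ψ → (∀ y, ‖φ y‖ = ‖ψ y‖) →
        SamplesPostselected c (wordBound κ n) (T n) input φ P m := by
  obtain ⟨c, κ, T, hT, hc⟩ := hmm
  have hc' : MatMulBy c κ T := fun n A B => hc n A B _
  obtain ⟨a, ha, hTa⟩ := bound_of_isBigO_nat_atTop hT
  have hTa' : ∀ n : ℕ, 1 ≤ n → (T n : ℝ) ≤ a * (n : ℝ) ^ ω := fun n hn => by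
    have hn' : (0 : ℝ) < n := by exact_mod_cast hn
    have h1 := hTa (x := n) (Real.rpow_pos_of_pos hn' ω).ne'
    rwa [Real.norm_of_nonneg (by positivity), Real.norm_of_nonneg (by positivity)] at h1
  have hO := isBigO_sampleTime (c := c) hω hTa' ha.le
  obtain ⟨M, hM⟩ := exists_pow_bound hω hO
  -- The three summands provide for the running time, for the bound `(2 ^ lg n + 2) ^ (κ + 1)`
  -- required by the multiplication, and for the inequalities `32 ≤ B` and `L ≤ B`. The word
  -- exponent `100 * e + 1` gives `B ^ 100 < W`.
  set e := M + 2 * (κ + 1) + 5 with he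
  refine ⟨sampleC c load, 100 * e + 1, sampleTime c T, hO,
    fun n C D p s P m input ψ φ hl hn hlen hb hψ hφ => ?_⟩
  have hle : ∀ k ≤ e, (n + 2) ^ k ≤ (n + 2) ^ e := fun k hk => Nat.pow_le_pow_right (by omega) hk
  have h5 := hle 5 (by omega)
  let E : Env :=
    { B := (n + 2) ^ e
      L := 8 * ((n + 1) * (n + 1))
      W := wordBound (100 * e + 1) n
      coins := fun _ => false
      hB := le_trans (show 2 ^ 5 ≤ (n + 2) ^ 5 from Nat.pow_le_pow_left (by omega) 5) h5
      hL := by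
        refine le_trans ?_ h5
        calc 8 * ((n + 1) * (n + 1)) ≤ 2 ^ 3 * ((n + 2) * (n + 2)) := by nlinarith
          _ ≤ (n + 2) ^ 3 * ((n + 2) * (n + 2)) :=
            Nat.mul_le_mul_right _ (Nat.pow_le_pow_left (by omega) 3)
          _ = (n + 2) ^ 5 := by ring
      hW := by
        rw [wordBound, ← pow_mul, mul_comm e]
        exact Nat.pow_lt_pow_right (by omega) (by omega) }
  refine samplesPostselected_sampleC hc' hl E rfl ?_ ((hM n).trans (hle M (by omega))) hn hlen
    (fun i => (hb i).trans ?_) hψ hφ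
  · calc (2 ^ lg n + 2) ^ (κ + 1) ≤ ((n + 2) ^ 2) ^ (κ + 1) := by
          refine Nat.pow_le_pow_left ?_ _
          have := (lg_bounds n).2
          nlinarith
      _ = (n + 2) ^ (2 * (κ + 1)) := (pow_mul _ _ _).symm
      _ ≤ _ := hle _ (by omega)
  · exact Nat.le_self_pow (by omega) _

end StabSim

/-! ### The main theorem. -/

theorem mainTheorem4 (ω : ℝ) (hω : 2 ≤ ω) (hmm : WordRAM.MatMulInTime ω) :
    StabSim.GraphStateSimulation (StabSim.timeBound ω) ∧
    StabSim.StabilizerSampling (StabSim.timeBound ω) ∧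
    (∀ (n : ℕ) (τ : Qubit.Tableau n) (ψ : Qubit.Vec n) (P : Finset (Fin n))
      (m : {v // v ∈ P} → ZMod 2) (x y : {v // v ∉ P} → ZMod 2), τ.Represents ψ →
      Qubit.condProb ψ m x ≠ 0 → Qubit.condProb ψ m y ≠ 0 →
      Qubit.condProb ψ m x = Qubit.condProb ψ m y) := by
  refine ⟨?_, ?_, fun n τ ψ P m x y h hx hy => ?_⟩
  · obtain ⟨c, κ, T, hT, h⟩ := StabSim.exists_sampler hω hmm StabSim.graphLoad
    refine ⟨c, κ, T, hT, fun n G B P m U hU => ?_⟩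
    refine h n _ _ _ _ P m _ _ _ (StabSim.loads_graphLoad G B m) (by simp [StabSim.graphInput])
      ?_ (StabSim.graphInput_le G B m) (Qubit.stabilizes_graphState G B)
      (Qubit.norm_basisChange hU _)
    rw [StabSim.graphInput_length]
    nlinarith
  · obtain ⟨c, κ, T, hT, h⟩ := StabSim.exists_sampler hω hmm StabSim.tableauLoad
    refine ⟨c, κ, T, hT, fun n τ ψ P m hψ => ?_⟩
    refine h n _ _ _ _ P m _ _ _ (StabSim.loads_tableauLoad τ m) (by simp) ?_
      (StabSim.tableauInput_le τ m) hψ.stabilizes fun _ => rfl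
    rw [StabSim.tableauInput_length]
    nlinarith
  · refine StabSim.condProb_eq_of_stabilizes h.stabilizes ?_ ?_
    · intro h0; exact hx (by simp [Qubit.condProb, h0])
    · intro h0; exact hy (by simp [Qubit.condProb, h0])
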